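/- **Setting.** Let $\mathcal S,\mathcal A$ be Polish spaces, $\gamma\in(0,1)$, $\mathcal P(\cdot,\cdot\mid s,a)$ a Markov kernel giving the joint law of (reward, next state), with rewards in $[0,1]$, and $\pi$ a policy (a Markov kernel from $\mathcal S$ to $\mathcal A$) such that the induced Markov chain of states has a unique stationary distribution $\mu_\pi$. Let $\phi:\mathcal S\to\mathbb R^d$ ($d\ge 1$) be a measurable feature map with $\|\phi(s)\|\le 1$ for all $s$, such that $\Sigma_\phi:=\mathbb E_{s\sim\mu_\pi}[\phi(s)\phi(s)^\top]$ is positive definite, with smallest eigenvalue $\lambda_{\min}$. For $K\in\mathbb N$ put $\iota_K=[K(1-\gamma)]^{-1}$, $x_k=k\iota_K$ ($0\le k\le K$). For $\theta=(\theta(0)^\top,\dots,\theta(K-1)^\top)^\top\in\mathbb R^{dK}$, let $F_k(s;\theta)=\phi(s)^\top\theta(k)+\frac{k+1}{K+1}$ for $0\le k<K$, $F_{-1}=0$, $F_K=1$, $p_k=F_k-F_{k-1}$, and $\eta_\theta(s)=\sum_{k=0}^K p_k(s;\theta)\delta_{x_k}$ (a signed measure). For a signed measure $\nu$ on $[0,(1-\gamma)^{-1}]$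 write $F_\nu(x)=\nu([0,x])$; $W_1$ and $\ell_2$ are the $L^1$ and $L^2$ distances of such functions on $[0,(1-\gamma)^{-1}]$, and $W_{1,\mu_\pi}(\eta,\eta')=(\mathbb E_{s\sim\mu_\pi}W_1^2(\eta(s),\eta'(s)))^{1/2}$, similarly $\ell_{2,\mu_\pi}$. The distributional Bellman operator is $[\mathcal T^\pi\eta](s)=\mathbb E_{a\sim\pi(\cdot\mid s),\,(r,s')\sim\mathcal P(\cdot,\cdot\mid s,a)}[(b_{r,\gamma})_\#\eta(s')]$, $b_{r,\gamma}(x)=r+\gamma x$. The linear-categorical projected Bellman equation for $\theta$ says that $\theta$ minimizes $\theta'\mapsto\ell_{2,\mu_\pi}(\mathcal T^\pi\eta_\theta,\eta_{\theta'})$ over $\mathbb R^{dK}$. Let $C\in\mathbb R^{K\times K}$ be the lower triangular matrix of ones, $g_{j,k}(r)=(1-|(r+\gamma x_j-x_k)/\iota_K|)_+$, $g_j(r)=(g_{j,k}(r))_{k=0}^{K-1}$, and $\tilde G(r)$ the matrix with columns $g_j(r)-g_K(r)$, $0\le j<K$. Given i.i.d. samples $s_t\sim\mu_\pi$, $a_t\sim\pi(\cdot\mid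 s_t)$, $(r_t,s_t')\sim\mathcal P(\cdot,\cdot\mid s_t,a_t)$, a deterministic $\theta_0\in\mathbb R^{dK}$ and a step size $\alpha>0$, Linear-CTD is the iteration $\theta_t=\theta_{t-1}-\alpha(A_t\theta_{t-1}-b_t)$, where $$A_t=I_K\otimes(\phi(s_t)\phi(s_t)^\top)-(C\tilde G(r_t)C^{-1})\otimes(\phi(s_t)\phi(s_t')^\top),\qquad b_t=\tfrac1{K+1}\Big[C\Big(\sum_{j=0}^Kg_j(r_t)-\mathbf 1_K\Big)\Big]\otimes\phi(s_t),$$ with tail average $\bar\theta_T=(T/2+1)^{-1}\sum_{t=T/2}^T\theta_t$ for even $T\ge 2$. **Theorem ($L^p$ convergence).** There is a universal constant $c>0$ such that the following holds in every setting as above with $K\ge(1-\gamma)^{-1}$. The linear-categorical projected Bellman equation has a unique solution $\theta^\star$. Put $\mathcal L(\theta)=W_{1,\mu_\pi}(\eta_{\theta^\star},\eta_\theta)$ and $\|\theta\|_{I_K\otimes\Sigma_\phi}=\sqrt{\theta^\top(I_K\otimes\Sigma_\phi)\theta}$. Then for all real $p>2$, all even $T\ge2$, all $\alpha\in\big(0,(1-\sqrt\gamma)/[38(p+\log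 T)]\big)$ and all $\theta_0$, $$\begin{aligned}\mathbb E^{1/p}\big[\mathcal L(\bar\theta_T)^p\big]\le c\,\Bigg\{&\frac{\sqrt p}{\sqrt T}\,\frac{\frac{1}{\sqrt K(1-\gamma)}\|\theta^\star\|_{I_K\otimes\Sigma_\phi}+1}{(1-\gamma)\sqrt{\lambda_{\min}}}\Big(1+\frac{\sqrt{\alpha p}+\alpha p}{\sqrt{(1-\gamma)\lambda_{\min}}}\Big)\\&+\frac pT\,\frac{\frac{1}{\sqrt K(1-\gamma)}\|\theta^\star\|_{I_K\otimes\Sigma_\phi}+1}{(1-\gamma)^{3/2}\lambda_{\min}}\Big(1+\frac1{\sqrt{\alpha p}}\Big)\\&+\frac1T\,\frac{(1-\frac12\alpha(1-\sqrt\gamma)\lambda_{\min})^{T/2}}{\sqrt\alpha(1-\gamma)\sqrt{\lambda_{\min}}}\Big(\frac1{\sqrt\alpha}+\frac p{\sqrt{(1-\gamma)\lambda_{\min}}}\Big)\frac{1}{\sqrt K(1-\gamma)}\|\theta_0-\theta^\star\|\Bigg\},\end{aligned}$$ and the expectation on the left is finite. -/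

import Mathlib

open MeasureTheory ProbabilityTheory
open scoped Matrix Kronecker

noncomputable section

namespace LinearCTD

variable {S A : Type*} [MeasurableSpace S] [MeasurableSpace A]

/-! ### Signed return distributions, their CDFs and distances -/

/-- The CDF `F_ν(x) = ν([0, x])` of a signed measure on the line. -/
def cdf (ν : SignedMeasure ℝ) (x : ℝ) : ℝ := ν (Set.Icc 0 x)

/-- The `1`-Wasserstein distance: the `L¹` distance of the CDFs on `[0, (1 - γ)⁻¹]`. -/
def W1 (γ : ℝ) (ν₁ ν₂ : SignedMeasure ℝ) : ℝ :=
  ∫ x in (0 : ℝ)..(1 - γ)⁻¹, |cdf ν₁ x - cdf ν₂ x|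

/-- The Cramér distance: the `L²` distance of the CDFs on `[0, (1 - γ)⁻¹]`. -/
def cramer (γ : ℝ) (ν₁ ν₂ : SignedMeasure ℝ) : ℝ :=
  Real.sqrt (∫ x in (0 : ℝ)..(1 - γ)⁻¹, (cdf ν₁ x - cdf ν₂ x) ^ 2)

/-- The `μ`-weighted `1`-Wasserstein distance of two families of signed measures. -/
def W1Weighted (γ : ℝ) (μ : Measure S) (η₁ η₂ : S → SignedMeasure ℝ) : ℝ :=
  Real.sqrt (∫ s, W1 γ (η₁ s) (η₂ s) ^ 2 ∂μ)

/-- The `μ`-weighted Cramér distance of two families of signed measures. -/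
def cramerWeighted (γ : ℝ) (μ : Measure S) (η₁ η₂ : S → SignedMeasure ℝ) : ℝ :=
  Real.sqrt (∫ s, cramer γ (η₁ s) (η₂ s) ^ 2 ∂μ)

/-! ### The policy, the Markov chain of states and the distributional Bellman operator -/

/-- The transition kernel of the state chain `s₀, s₁, …` under the policy `π`. Here `P` is the
joint law of (reward, next state) given (state, action), so `(π ⊗ₖ P) s` is the joint law of
(action, reward, next state) given the state `s`. -/
def stateKernel (π : Kernel S A) (P : Kernel (S × A) (ℝ × S)) : Kernel S S :=
  (π ⊗ₖ P).map (fun y => y.2.2)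

/-- `μ` is the unique stationary distribution of the state chain. -/
structure IsUniqueStationary (π : Kernel S A) (P : Kernel (S × A) (ℝ × S)) (μ : Measure S) :
    Prop where
  isProbabilityMeasure : IsProbabilityMeasure μ
  invariant : (stateKernel π P).Invariant μ
  unique : ∀ ν : Measure S, IsProbabilityMeasure ν → (stateKernel π P).Invariant ν → ν = μ

/-- The law of one sample `(s, a, r, s')` of the generative model:
`s ∼ μ`, `a ∼ π(· ∣ s)`, `(r, s') ∼ P(·, · ∣ s, a)`. -/
def sampleLaw (π : Kernel S A) (P : Kernel (S × A) (ℝ × S)) (μ : Measure S) :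
    Measure (S × A × ℝ × S) :=
  μ ⊗ₘ (π ⊗ₖ P)

open Classical in
/-- The distributional Bellman operator: `(bellman η) s` is the signed measure
`B ↦ 𝔼 [(b_{r,γ})_# η(s') (B)]`, `b_{r,γ}(x) = r + γ x`, where `a ∼ π(· ∣ s)` and
`(r, s') ∼ P(·, · ∣ s, a)`. (The value is `0` when this set function is not a signed measure;
for the bounded measurable families used below it always is one.) -/
def bellman (γ : ℝ) (π : Kernel S A) (P : Kernel (S × A) (ℝ × S))
    (η : S → SignedMeasure ℝ) (s : S) : SignedMeasure ℝ :=
  if h : ∃ ν : SignedMeasure ℝ, ∀ B : Set ℝ, MeasurableSet B →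
      ν B = ∫ y, ((η y.2.2).map (fun x => y.2.1 + γ * x)) B ∂((π ⊗ₖ P) s)
  then h.choose else 0

/-! ### The linear-categorical parametrization -/

/-- The gap `ι_K = (K (1 - γ))⁻¹` of the support grid. -/
def gap (γ : ℝ) (K : ℕ) : ℝ := (K * (1 - γ))⁻¹

/-- The support points `x_k = k ι_K`, `k = 0, …, K`. -/
def atom (γ : ℝ) (K k : ℕ) : ℝ := k * gap γ K

/-- The parameter space `ℝ^{dK}`; the block `θ(k) ∈ ℝ^d` has the coordinates `θ (k, i)`. -/
abbrev Param (d K : ℕ) : Type := EuclideanSpace ℝ (Fin K × Fin d)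

/-- `F_k(s; θ) = φ(s)ᵀ θ(k) + (k + 1) / (K + 1)` for `k < K`, and `F_K(s; θ) = 1`. -/
def linCDF {d K : ℕ} (φ : S → EuclideanSpace ℝ (Fin d)) (θ : Param d K) (s : S) (k : ℕ) : ℝ :=
  if h : k < K then (∑ i, φ s i * θ (⟨k, h⟩, i)) + ((k : ℝ) + 1) / ((K : ℝ) + 1) else 1

/-- `p_k(s; θ) = F_k(s; θ) - F_{k-1}(s; θ)`, with `F_{-1} = 0`. -/
def linPMF {d K : ℕ} (φ : S → EuclideanSpace ℝ (Fin d)) (θ : Param d K) (s : S) : ℕ → ℝ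
  | 0 => linCDF φ θ s 0
  | k + 1 => linCDF φ θ s (k + 1) - linCDF φ θ s k

/-- The family `η_θ(s) = ∑_{k=0}^K p_k(s; θ) δ_{x_k}`. -/
def linCat {d K : ℕ} (γ : ℝ) (φ : S → EuclideanSpace ℝ (Fin d)) (θ : Param d K) (s : S) :
    SignedMeasure ℝ :=
  ∑ k ∈ Finset.range (K + 1), linPMF φ θ s k • (Measure.dirac (atom γ K k)).toSignedMeasure

/-- `η_θ` is the projection of `η` onto the linear-categorical families, that is, a minimizer of
the weighted Cramér distance to `η`. -/
def IsLinCatProjection {d K : ℕ} (γ : ℝ) (μ : Measure S) (φ : S → EuclideanSpace ℝ (Fin d))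
    (η : S → SignedMeasure ℝ) (θ : Param d K) : Prop :=
  ∀ θ' : Param d K,
    cramerWeighted γ μ η (linCat γ φ θ) ≤ cramerWeighted γ μ η (linCat γ φ θ')

/-- `θ` solves the linear-categorical projected Bellman equation: `η_θ` is the projection of the
image of `η_θ` under the distributional Bellman operator. -/
def IsProjectedBellmanSolution {d K : ℕ} (γ : ℝ) (π : Kernel S A) (P : Kernel (S × A) (ℝ × S))
    (μ : Measure S) (φ : S → EuclideanSpace ℝ (Fin d)) (θ : Param d K) : Prop :=
  IsLinCatProjection γ μ φ (bellman γ π P (linCat γ φ θ)) θ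

/-- The feature covariance `Σ_φ = 𝔼_{s ∼ μ} [φ(s) φ(s)ᵀ]`. -/
def featureCov {d : ℕ} (μ : Measure S) (φ : S → EuclideanSpace ℝ (Fin d)) :
    Matrix (Fin d) (Fin d) ℝ :=
  Matrix.of fun i j => ∫ s, φ s i * φ s j ∂μ

/-- The smallest eigenvalue `λ_min` of `Σ_φ`. -/
def lambdaMin {d : ℕ} (μ : Measure S) (φ : S → EuclideanSpace ℝ (Fin d)) : ℝ :=
  sInf (spectrum ℝ (featureCov μ φ))

/-- The weighted norm `‖θ‖_{I_K ⊗ Σ_φ}`, where `‖u‖_B = √(uᵀ B u)`. -/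
def covNorm {d K : ℕ} (μ : Measure S) (φ : S → EuclideanSpace ℝ (Fin d)) (θ : Param d K) : ℝ :=
  Real.sqrt (θ.ofLp ⬝ᵥ (((1 : Matrix (Fin K) (Fin K) ℝ) ⊗ₖ featureCov μ φ) *ᵥ θ.ofLp))

/-! ### The algorithm -/

/-- The lower triangular all-ones matrix `C ∈ ℝ^{K × K}`. -/
def cumMatrix (K : ℕ) : Matrix (Fin K) (Fin K) ℝ :=
  Matrix.of fun i j => if j ≤ i then 1 else 0

/-- `g_{j,k}(r) = (1 - |(r + γ x_j - x_k) / ι_K|)_+`. -/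
def gCoef (γ : ℝ) (K j k : ℕ) (r : ℝ) : ℝ :=
  max (1 - |(r + γ * atom γ K j - atom γ K k) / gap γ K|) 0

/-- `G̃(r)`, the matrix with columns `g_j(r) - g_K(r)`, `0 ≤ j < K`, where
`g_j(r) = (g_{j,k}(r))_{k=0}^{K-1}`. -/
def GTilde (γ : ℝ) (K : ℕ) (r : ℝ) : Matrix (Fin K) (Fin K) ℝ :=
  Matrix.of fun k j => gCoef γ K j k r - gCoef γ K K k r

/-- `A = [I_K ⊗ (φ(s) φ(s)ᵀ)] - [(C G̃(r) C⁻¹) ⊗ (φ(s) φ(s')ᵀ)]` at the sample `(s, a, r, s')`. -/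
def sampleA {d : ℕ} (γ : ℝ) (K : ℕ) (φ : S → EuclideanSpace ℝ (Fin d)) (x : S × A × ℝ × S) :
    Matrix (Fin K × Fin d) (Fin K × Fin d) ℝ :=
  (1 : Matrix (Fin K) (Fin K) ℝ) ⊗ₖ Matrix.vecMulVec (φ x.1).ofLp (φ x.1).ofLp
    - (cumMatrix K * GTilde γ K x.2.2.1 * (cumMatrix K)⁻¹) ⊗ₖ
        Matrix.vecMulVec (φ x.1).ofLp (φ x.2.2.2).ofLp

/-- `b = (K + 1)⁻¹ [C (∑_{j=0}^K g_j(r) - 1_K)] ⊗ φ(s)` at the sample `(s, a, r, s')`. -/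
def sampleB {d : ℕ} (γ : ℝ) (K : ℕ) (φ : S → EuclideanSpace ℝ (Fin d)) (x : S × A × ℝ × S) :
    Fin K × Fin d → ℝ :=
  fun ki => ((K : ℝ) + 1)⁻¹ *
    (cumMatrix K *ᵥ fun k => (∑ j ∈ Finset.range (K + 1), gCoef γ K j k x.2.2.1) - 1) ki.1 *
      φ x.1 ki.2

/-- The iterates `θ_t = θ_{t-1} - α (A_t θ_{t-1} - b_t)`, `t ≥ 1`, driven by the samples
`x 1, x 2, …` and started at `θ₀`. -/
def iterate {d K : ℕ} (γ α : ℝ) (φ : S → EuclideanSpace ℝ (Fin d)) (θ₀ : Param d K)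
    (x : ℕ → S × A × ℝ × S) : ℕ → Param d K
  | 0 => θ₀
  | t + 1 => iterate γ α φ θ₀ x t - α • WithLp.toLp 2
      (sampleA γ K φ (x (t + 1)) *ᵥ (iterate γ α φ θ₀ x t).ofLp - sampleB γ K φ (x (t + 1)))

/-- The tail average `θ̄_T = (T/2 + 1)⁻¹ ∑_{t=T/2}^T θ_t`, used for even `T`. -/
def tailAverage {d K : ℕ} (γ α : ℝ) (φ : S → EuclideanSpace ℝ (Fin d)) (θ₀ : Param d K)
    (x : ℕ → S × A × ℝ × S) (T : ℕ) : Param d K :=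
  ((T : ℝ) / 2 + 1)⁻¹ • ∑ t ∈ Finset.Icc (T / 2) T, iterate γ α φ θ₀ x t

/-- The estimation error `𝓛(θ)`: the weighted `1`-Wasserstein distance of `η_θ` and `η_{θ⋆}`. -/
def loss {d K : ℕ} (γ : ℝ) (μ : Measure S) (φ : S → EuclideanSpace ℝ (Fin d))
    (θstar θ : Param d K) : ℝ :=
  W1Weighted γ μ (linCat γ φ θstar) (linCat γ φ θ)

end LinearCTD

end

/-!
Write `x = (s, a, r, s')` for a sample, `A x` for the random matrix and `b x` for the random vector
of the recursion, `Ā` for the mean of `A`, and `N u = uᵀ (I_K ⊗ Σ_φ) u`.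

*The fixed point.* All CDFs of the families `η_θ` are constant on the cells of the grid. Expanding
the square in the projection objective cell by cell shows that `θ' ↦ ℓ₂²(𝒯 η_θ, η_θ')` is a
quadratic function of `θ' - θ` with quadratic part `ι_K N` and gradient at `θ' = θ` proportional to
`𝔼 [A θ - b]` (`integral_bellmanGap_add`). So the projected Bellman equation is `𝔼 [A θ - b] = 0`
(`isProjectedBellmanSolution_iff`). The matrix `C G̃(r) C⁻¹` has nonnegative entries, row sums at
most `1` and column sums at most `γ`; by Schur's test its norm is at most `√γ`
(`sum_sq_transEntry_le`), and stationarity gives the coercivity `⟨u, Ā u⟩ ≥ (1 - √γ) N u`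
(`le_integral_inner_tdOp`). Hence `Ā` is invertible and the solution `θ⋆` exists and is unique.

*The rate.* The error `e_t = θ_t - θ⋆` satisfies `e_{t+1} = e_t - α (A e_t + ξ)` with the centred
noise `ξ = A θ⋆ - b` (`iterate_sub_eq_chain`). Summation by parts over a window of length `n` gives

`Ā (n⁻¹ ∑ e_t) = n⁻¹ (α⁻¹ (e_{n₀} - e_{n₀+n}) - ∑ ξ_{t+1} - ∑ (A_{t+1} - Ā) e_t)`

(`mean_window_eq`), where the last two sums are martingales. Each is estimated in `L ^ p` by
induction on the number of steps: the noise sum by a Rosenthal inequality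
(`integral_noiseSum_rpow_le`), the other by the `2`-smoothness of the norm
(`integral_multSum_rpow_le`), and `e_t` itself by a Lyapunov argument for `(‖e‖² + W) ^ (p / 2)`
(`integral_norm_chain_rpow_le`, `integral_noisy_chain_rpow_le`). The regularisation `W` is of the
order of the squared bound of `p` times one noise increment. It makes this increment small compared
with `√(‖e‖² + W) / p`, so that a second-order expansion of the power is available (`rpow_drift_le`).

By coercivity, `√(N e) ≤ ‖Ā e‖ / ((1 - √γ) √λ_min)` (`sqrt_covSq_le`), and by Cauchy–Schwarz over
the grid the loss at `θ⋆ + e` is at most `√(N e) / (√K (1 - γ))` (`loss_le`). What remains is the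
comparison of explicit constants (`collect_terms`).
-/

set_option linter.unusedSectionVars false

namespace LinearCTD

/-! ### Pointwise inequalities for powers of norms -/

lemma norm_sq_rpow_half {E : Type*} [NormedAddCommGroup E] (x : E) (p : ℝ) :
    (‖x‖ ^ 2) ^ (p / 2) = ‖x‖ ^ p := by
  rw [← Real.rpow_natCast, ← Real.rpow_mul (norm_nonneg _)]
  congr 1; push_cast; ring

section Pointwise

variable {E : Type*} [NormedAddCommGroup E] [InnerProductSpace ℝ E]

/-- A second-order expansion of `V ^ q`, `V = ‖u‖² + W`, along an increment `D` of size at most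
`√V / q` up to a constant. The regularisation `W` is what makes this smallness available when `‖u‖`
itself is small. -/
lemma rpow_drift_le (u D : E) {W q : ℝ} (hW : 0 ≤ W) (hV : 0 < ‖u‖ ^ 2 + W) (hq : 1 ≤ q)
    (hD : q * ‖D‖ ≤ 2 / 5 * √(‖u‖ ^ 2 + W)) :
    (‖u + D‖ ^ 2 + W) ^ q ≤ (‖u‖ ^ 2 + W) ^ q *
      (1 + q / (‖u‖ ^ 2 + W) * (2 * inner ℝ u D + 11 * q * ‖D‖ ^ 2)) := by
  set V := ‖u‖ ^ 2 + W with hVdef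
  have hsV : 0 < √V := Real.sqrt_pos.2 hV
  have hsq : √V ^ 2 = V := Real.sq_sqrt hV.le
  have huV : ‖u‖ ≤ √V := Real.le_sqrt_of_sq_le (by linarith)
  have hDn := norm_nonneg D
  have hun := norm_nonneg u
  have hD1 : ‖D‖ ≤ 2 / 5 * √V := by nlinarith
  have hin : |inner ℝ u D| ≤ ‖u‖ * ‖D‖ := abs_real_inner_le_norm u D
  set w := inner ℝ u D with hw
  set z := (2 * w + ‖D‖ ^ 2) / V with hz
  have hexp : ‖u + D‖ ^ 2 + W = V * (1 + z) := by
    rw [norm_add_sq_real, hz]; field_simp; rw [hVdef]; ring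
  have h1z : 0 ≤ 1 + z := by
    have : 0 ≤ V * (1 + z) := by rw [← hexp]; positivity
    exact nonneg_of_mul_nonneg_right this hV
  have hnum : |2 * w + ‖D‖ ^ 2| ≤ 12 / 5 * √V * ‖D‖ := by
    rw [abs_le] at hin ⊢
    have h1 : ‖u‖ * ‖D‖ ≤ √V * ‖D‖ := by gcongr
    have h2 : ‖D‖ ^ 2 ≤ 2 / 5 * √V * ‖D‖ := by nlinarith
    constructor <;> nlinarith [sq_nonneg ‖D‖]
  have hqz : |q * z| ≤ 1 := by
    rw [hz, ← mul_div_assoc, abs_div, abs_of_pos hV, div_le_one hV, abs_mul,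
      abs_of_pos (by linarith : 0 < q)]
    calc q * |2 * w + ‖D‖ ^ 2| ≤ q * (12 / 5 * √V * ‖D‖) := by gcongr
      _ = 12 / 5 * √V * (q * ‖D‖) := by ring
      _ ≤ 12 / 5 * √V * (2 / 5 * √V) := by gcongr
      _ ≤ V := by nlinarith
  have hz2 : V * z ^ 2 ≤ 10 * ‖D‖ ^ 2 := by
    have : V * z ^ 2 = (2 * w + ‖D‖ ^ 2) ^ 2 / V := by rw [hz]; field_simp
    rw [this, div_le_iff₀ hV]
    have := sq_le_sq' (abs_le.1 hnum).1 (abs_le.1 hnum).2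
    calc _ ≤ _ := this
      _ = (144 / 25) * ‖D‖ ^ 2 * √V ^ 2 := by ring
      _ ≤ _ := by rw [hsq]; have : 0 ≤ ‖D‖ ^ 2 * V := by positivity
                  nlinarith
  rw [hexp, Real.mul_rpow hV.le h1z]
  refine mul_le_mul_of_nonneg_left ?_ (Real.rpow_nonneg hV.le _)
  -- `(1 + z) ^ q ≤ exp (q z)`, and `|q z| ≤ 1` allows a quadratic bound of the exponential.
  calc (1 + z) ^ q ≤ Real.exp z ^ q :=
        Real.rpow_le_rpow h1z (by linarith [Real.add_one_le_exp z]) (by linarith)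
    _ = Real.exp (q * z) := by rw [← Real.exp_mul, mul_comm]
    _ ≤ 1 + q * z + (q * z) ^ 2 := by
        have := (abs_le.1 (Real.abs_exp_sub_one_sub_id_le hqz)).2
        linarith
    _ ≤ _ := by
        have hzV : 2 * w + ‖D‖ ^ 2 = z * V := by rw [hz]; field_simp
        have : 1 + q * z + (q * z) ^ 2 = 1 + q / V * (2 * w + ‖D‖ ^ 2 + q * (V * z ^ 2)) := by
          rw [hzV]; field_simp; ring
        rw [this]
        have : 2 * w + ‖D‖ ^ 2 + q * (V * z ^ 2) ≤ 2 * w + 11 * q * ‖D‖ ^ 2 := by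
          nlinarith [sq_nonneg ‖D‖]
        gcongr

/-- Bernoulli's inequality around the point `m`. -/
lemma rpow_mul_one_add_le {V m q δ : ℝ} (hV : 0 < V) (hm : 0 ≤ m) (hq : 1 ≤ q) (hδ : 0 ≤ δ) :
    V ^ q * (1 + q * (δ * (m / V - 1))) ≤ (1 - δ) * V ^ q + δ * m ^ q := by
  have h := one_add_mul_self_le_rpow_one_add (s := m / V - 1)
    (by have : 0 ≤ m / V := by positivity
        linarith) hq
  rw [add_sub_cancel, Real.div_rpow hm hV.le, le_div_iff₀ (Real.rpow_pos_of_pos hV q)] at h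
  nlinarith

/-- Midpoint convexity of `t ↦ t ^ q`, at the points `a` and `a + 2 b`. -/
lemma two_mul_rpow_sub_rpow_le {a b q : ℝ} (ha : 0 ≤ a) (hb : 0 ≤ b) (hq : 1 ≤ q) :
    2 * (a + b) ^ q - a ^ q ≤ (a + 2 * b) ^ q := by
  obtain ⟨-, hc⟩ := convexOn_rpow hq
  have h := hc (Set.mem_Ici.2 ha) (Set.mem_Ici.2 (by positivity : 0 ≤ a + 2 * b))
    (by norm_num : (0 : ℝ) ≤ 1 / 2) (by norm_num : (0 : ℝ) ≤ 1 / 2) (by norm_num)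
  simp only [smul_eq_mul] at h
  rw [show 1 / 2 * a + 1 / 2 * (a + 2 * b) = a + b by ring] at h
  linarith

/-- The scalar form of `2`-smoothness: for `q w² ≤ 1` it follows from `cosh x ≤ exp (x² / 2)`, and
otherwise from `|w| ≤ 1 ≤ q w²`. -/
lemma rpow_one_add_add_rpow_one_sub_le {w q : ℝ} (hw : |w| ≤ 1) (hq : 1 ≤ q) :
    (1 + w) ^ q + (1 - w) ^ q ≤ 2 * (1 + q * w ^ 2) ^ q := by
  have hw' := abs_le.1 hw
  have h0 : 0 ≤ q := by linarith
  rcases le_total (q * w ^ 2) 1 with h | h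
  · have h1 : (1 + w) ^ q ≤ Real.exp (q * w) := by
      rw [mul_comm, Real.exp_mul]
      exact Real.rpow_le_rpow (by linarith) (by linarith [Real.add_one_le_exp w]) h0
    have h2 : (1 - w) ^ q ≤ Real.exp (-(q * w)) := by
      rw [← mul_neg, mul_comm, Real.exp_mul]
      exact Real.rpow_le_rpow (by linarith) (by linarith [Real.add_one_le_exp (-w)]) h0
    have h3 : Real.exp (q * w) + Real.exp (-(q * w)) ≤ 2 * Real.exp ((q * w) ^ 2 / 2) := by
      have := Real.cosh_le_exp_half_sq (q * w)
      rw [Real.cosh_eq] at this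
      linarith
    have h4 : Real.exp ((q * w) ^ 2 / 2) ≤ (1 + q * w ^ 2) ^ q := by
      rw [show (q * w) ^ 2 / 2 = (q * w ^ 2 / 2) * q by ring, Real.exp_mul]
      refine Real.rpow_le_rpow (Real.exp_pos _).le ?_ h0
      have hx : 0 ≤ q * w ^ 2 := by positivity
      have := (abs_le.1 (Real.abs_exp_sub_one_sub_id_le (x := q * w ^ 2 / 2)
        (by rw [abs_of_nonneg (by positivity)]; linarith))).2
      nlinarith
    linarith
  · have h1 : (1 + w) ^ q ≤ (1 + q * w ^ 2) ^ q :=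
      Real.rpow_le_rpow (by linarith) (by linarith) h0
    have h2 : (1 - w) ^ q ≤ (1 + q * w ^ 2) ^ q :=
      Real.rpow_le_rpow (by linarith) (by linarith) h0
    linarith

/-- `2`-smoothness of the `p`-th power of the norm, `p = 2 q`, with a constant linear in `q`. -/
lemma norm_add_rpow_add_norm_sub_rpow_le (x d : E) {q : ℝ} (hq : 1 ≤ q) :
    (‖x + d‖ ^ 2) ^ q + (‖x - d‖ ^ 2) ^ q ≤ 2 * (‖x‖ ^ 2 + (1 + 4 * q) * ‖d‖ ^ 2) ^ q := by
  have h0 : 0 ≤ q := by linarith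
  set s := ‖x‖ ^ 2 + ‖d‖ ^ 2 with hs
  have hs0 : 0 ≤ s := by positivity
  rcases hs0.eq_or_lt with h | h
  · have hx : ‖x‖ ^ 2 = 0 := by nlinarith [sq_nonneg ‖x‖, sq_nonneg ‖d‖]
    have hd : ‖d‖ ^ 2 = 0 := by nlinarith [sq_nonneg ‖x‖, sq_nonneg ‖d‖]
    have hx' : x = 0 := by simpa using hx
    have hd' : d = 0 := by simpa using hd
    subst hx' hd'
    simp [Real.zero_rpow (by linarith : q ≠ 0)]
  have hin : |inner ℝ x d| ≤ ‖x‖ * ‖d‖ := abs_real_inner_le_norm x d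
  set w := 2 * inner ℝ x d / s with hw
  have hnum : |2 * inner ℝ x d| ≤ 2 * (‖x‖ * ‖d‖) := by
    rw [abs_mul, abs_two]; linarith
  have hw1 : |w| ≤ 1 := by
    rw [hw, abs_div, abs_of_pos h, div_le_one h]
    nlinarith [sq_nonneg (‖x‖ - ‖d‖)]
  have hsw : s * w ^ 2 ≤ 4 * ‖d‖ ^ 2 := by
    have : s * w ^ 2 = (2 * inner ℝ x d) ^ 2 / s := by rw [hw]; field_simp
    rw [this, div_le_iff₀ h]
    have := sq_le_sq' (abs_le.1 hnum).1 (abs_le.1 hnum).2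
    nlinarith [sq_nonneg (‖d‖ ^ 2)]
  have e1 : ‖x + d‖ ^ 2 = s * (1 + w) := by
    rw [norm_add_sq_real, hw]; field_simp; rw [hs]; ring
  have e2 : ‖x - d‖ ^ 2 = s * (1 - w) := by
    rw [norm_sub_sq_real, hw]; field_simp; rw [hs]; ring
  have hw' := abs_le.1 hw1
  rw [e1, e2, Real.mul_rpow hs0 (by linarith), Real.mul_rpow hs0 (by linarith), ← mul_add]
  calc s ^ q * ((1 + w) ^ q + (1 - w) ^ q) ≤ s ^ q * (2 * (1 + q * w ^ 2) ^ q) := by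
        gcongr; exact rpow_one_add_add_rpow_one_sub_le hw1 hq
    _ = 2 * (s * (1 + q * w ^ 2)) ^ q := by
        rw [Real.mul_rpow hs0 (by positivity)]; ring
    _ ≤ _ := by
        gcongr
        nlinarith

/-- The tangent inequality for `‖·‖ ^ p` at `x`. -/
lemma norm_rpow_sub_le (x d : E) {p : ℝ} (hp : 2 < p) :
    ‖x‖ ^ p - p * ‖x‖ ^ (p - 2) * inner ℝ x d ≤ ‖x - d‖ ^ p := by
  rcases eq_or_ne x 0 with rfl | hx
  · simp only [norm_zero, inner_zero_left, mul_zero, sub_zero]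
    rw [Real.zero_rpow (by linarith)]; positivity
  have hs : 0 < ‖x‖ := norm_pos_iff.2 hx
  set z := (‖d‖ ^ 2 - 2 * inner ℝ x d) / ‖x‖ ^ 2 with hz
  have e : ‖x - d‖ ^ 2 = ‖x‖ ^ 2 * (1 + z) := by
    rw [norm_sub_sq_real, hz]; field_simp; ring
  have hz1 : 0 ≤ 1 + z := by
    have : 0 ≤ ‖x‖ ^ 2 * (1 + z) := by rw [← e]; positivity
    exact nonneg_of_mul_nonneg_right this (by positivity)
  have hb := one_add_mul_self_le_rpow_one_add (s := z) (by linarith) (p := p / 2) (by linarith)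
  rw [← norm_sq_rpow_half (x - d), e, Real.mul_rpow (by positivity) hz1, norm_sq_rpow_half]
  have hsp : ‖x‖ ^ p = ‖x‖ ^ (p - 2) * ‖x‖ ^ 2 := by
    rw [← Real.rpow_natCast ‖x‖ 2, ← Real.rpow_add hs]; norm_num
  calc ‖x‖ ^ p - p * ‖x‖ ^ (p - 2) * inner ℝ x d
      ≤ ‖x‖ ^ p * (1 + p / 2 * z) := by
        have : ‖x‖ ^ p * (1 + p / 2 * z)
            = ‖x‖ ^ p + ‖x‖ ^ (p - 2) * (p / 2) * (‖d‖ ^ 2 - 2 * inner ℝ x d) := by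
          rw [mul_add, mul_one, hsp, hz]; field_simp
        rw [this]
        have : 0 ≤ ‖x‖ ^ (p - 2) * (p / 2) * ‖d‖ ^ 2 := by positivity
        nlinarith
    _ ≤ _ := by gcongr

/-- The one-sided form of `2`-smoothness. The last term is linear in `d` and vanishes on averaging
over a centred `d`. -/
lemma norm_add_rpow_le (x d : E) {p : ℝ} (hp : 2 < p) :
    ‖x + d‖ ^ p ≤ (‖x‖ ^ 2 + 2 * (1 + 2 * p) * ‖d‖ ^ 2) ^ (p / 2)
      + p * ‖x‖ ^ (p - 2) * inner ℝ x d := by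
  have h1 := norm_add_rpow_add_norm_sub_rpow_le x d (q := p / 2) (by linarith)
  have h2 := norm_rpow_sub_le x d hp
  have h3 := two_mul_rpow_sub_rpow_le (a := ‖x‖ ^ 2) (b := (1 + 4 * (p / 2)) * ‖d‖ ^ 2)
    (q := p / 2) (by positivity) (by positivity) (by linarith)
  simp only [norm_sq_rpow_half] at h1 h3
  rw [show 2 * ((1 + 4 * (p / 2)) * ‖d‖ ^ 2) = 2 * (1 + 2 * p) * ‖d‖ ^ 2 by ring] at h3
  linarith

end Pointwise

/-! ### Independence of the past and moments -/

section Past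

variable {Ω Y : Type*} [MeasurableSpace Y]

/-- The `σ`-algebra generated by `X 0, …, X t`. -/
abbrev past (X : ℕ → Ω → Y) (t : ℕ) : MeasurableSpace Ω :=
  ⨆ i ∈ Set.Iic t, MeasurableSpace.comap (X i) inferInstance

lemma past_mono (X : ℕ → Ω → Y) {s t : ℕ} (h : s ≤ t) : past X s ≤ past X t :=
  biSup_mono fun _ hi => le_trans hi h

lemma measurable_past (X : ℕ → Ω → Y) {i t : ℕ} (h : i ≤ t) : Measurable[past X t] (X i) := by
  rw [measurable_iff_comap_le]
  exact le_iSup₂_of_le (f := fun i (_ : i ∈ Set.Iic t) =>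
    MeasurableSpace.comap (X i) inferInstance) i h le_rfl

variable [MeasurableSpace Ω]

lemma past_le {X : ℕ → Ω → Y} (hX : ∀ t, Measurable (X t)) (t : ℕ) :
    past X t ≤ (inferInstance : MeasurableSpace Ω) :=
  iSup₂_le fun i _ => (hX i).comap_le

lemma indepFun_of_measurable_past {F : Type*} [MeasurableSpace F] {ρ : Measure Ω}
    {X : ℕ → Ω → Y} (hX : ∀ t, Measurable (X t)) (hind : iIndepFun X ρ) {t : ℕ} {Z : Ω → F}
    (hZ : Measurable[past X t] Z) : IndepFun Z (X (t + 1)) ρ := by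
  have h := indep_iSup_of_disjoint (fun i => (hX i).comap_le) hind.iIndep
    (S := Set.Iic t) (T := {t + 1}) (by simp)
  rw [IndepFun_iff_Indep]
  refine indep_of_indep_of_le_right (indep_of_indep_of_le_left h hZ.comap_le) ?_
  simp

/-- Conditioning on the past: the fresh sample `X (t + 1)` may be integrated out first. -/
lemma integral_fresh {F : Type*} [MeasurableSpace F] {ρ : Measure Ω} [IsProbabilityMeasure ρ]
    {ν : Measure Y} [IsProbabilityMeasure ν]
    {X : ℕ → Ω → Y} (hX : ∀ t, Measurable (X t)) (hind : iIndepFun X ρ)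
    (hlaw : ∀ t, ρ.map (X t) = ν) {t : ℕ} {Z : Ω → F} (hZ : Measurable[past X t] Z)
    {f : F × Y → ℝ} (hf : Measurable f)
    (hint : Integrable (fun ω => f (Z ω, X (t + 1) ω)) ρ) :
    Integrable (fun ω => ∫ y, f (Z ω, y) ∂ν) ρ ∧
      ∫ ω, f (Z ω, X (t + 1) ω) ∂ρ = ∫ ω, ∫ y, f (Z ω, y) ∂ν ∂ρ := by
  have hZ' : Measurable Z := hZ.mono (past_le hX t) le_rfl
  have hprod : ρ.map (fun ω => (Z ω, X (t + 1) ω)) = (ρ.map Z).prod ν := by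
    rw [(indepFun_iff_map_prod_eq_prod_map_map hZ'.aemeasurable (hX _).aemeasurable).1
      (indepFun_of_measurable_past hX hind hZ), hlaw]
  have hm : Measurable (fun ω => (Z ω, X (t + 1) ω)) := hZ'.prodMk (hX _)
  have := Measure.isProbabilityMeasure_map (μ := ρ) hZ'.aemeasurable
  have hint' : Integrable f ((ρ.map Z).prod ν) := by
    rw [← hprod]
    exact (integrable_map_measure hf.aestronglyMeasurable hm.aemeasurable).2 hint
  constructor
  · exact (integrable_map_measure hint'.integral_prod_left.aestronglyMeasurable
      hZ'.aemeasurable).1 hint'.integral_prod_left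
  · rw [← integral_map (f := f) hm.aemeasurable hf.aestronglyMeasurable, hprod,
      integral_prod f hint',
      integral_map hZ'.aemeasurable hint'.integral_prod_left.aestronglyMeasurable]

end Past

/-- Continuous functions of bounded random vectors are integrable. -/
lemma integrable_continuous_comp {Ω E : Type*} [MeasurableSpace Ω] {ρ : Measure Ω}
    [IsFiniteMeasure ρ] [NormedAddCommGroup E] [NormedSpace ℝ E] [ProperSpace E]
    [MeasurableSpace E] [BorelSpace E] {u : Ω → E} (hu : Measurable u)
    (hb : ∃ C, ∀ ω, ‖u ω‖ ≤ C) {φ : E → ℝ} (hφ : Continuous φ) :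
    Integrable (fun ω => φ (u ω)) ρ := by
  obtain ⟨C, hC⟩ := hb
  obtain ⟨B, hB⟩ := (isCompact_closedBall (0 : E) C).exists_bound_of_continuousOn
    hφ.continuousOn
  exact Integrable.of_bound (hφ.measurable.comp hu).aestronglyMeasurable B
    (Filter.Eventually.of_forall fun ω => hB _ (by simpa using hC ω))

lemma integrable_of_norm_le {Y G : Type*} [MeasurableSpace Y] {ν : Measure Y} [IsFiniteMeasure ν]
    [NormedAddCommGroup G] [MeasurableSpace G] [BorelSpace G] [SecondCountableTopology G]
    {f : Y → G} (hf : Measurable f) (C : ℝ) (h : ∀ y, ‖f y‖ ≤ C) : Integrable f ν :=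
  Integrable.of_bound hf.aestronglyMeasurable C (Filter.Eventually.of_forall h)

section Minkowski

variable {Ω E : Type*} [MeasurableSpace Ω] {ρ : Measure Ω} [NormedAddCommGroup E]

lemma lpNorm_eq_integral {p : ℝ} (hp : 0 < p) {f : Ω → E} (hf : AEStronglyMeasurable f ρ) :
    lpNorm f (ENNReal.ofReal p) ρ = (∫ ω, ‖f ω‖ ^ p ∂ρ) ^ p⁻¹ := by
  rw [lpNorm_eq_integral_norm_rpow_toReal (by simpa using hp) (by simp) hf,
    ENNReal.toReal_ofReal hp.le]

lemma lpNorm_le_of_integral_le {p a : ℝ} (hp : 0 < p) (ha : 0 ≤ a) {f : Ω → E}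
    (hf : AEStronglyMeasurable f ρ) (h : ∫ ω, ‖f ω‖ ^ p ∂ρ ≤ a ^ p) :
    lpNorm f (ENNReal.ofReal p) ρ ≤ a := by
  rw [lpNorm_eq_integral hp hf]
  calc _ ≤ (a ^ p) ^ p⁻¹ := by
        refine Real.rpow_le_rpow (integral_nonneg fun ω => ?_) h (by positivity)
        positivity
    _ = a := Real.rpow_rpow_inv ha hp.ne'

lemma integral_le_of_lpNorm_le {p a : ℝ} (hp : 0 < p) {f : Ω → E}
    (hf : AEStronglyMeasurable f ρ) (h : lpNorm f (ENNReal.ofReal p) ρ ≤ a) :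
    ∫ ω, ‖f ω‖ ^ p ∂ρ ≤ a ^ p := by
  have h0 : 0 ≤ ∫ ω, ‖f ω‖ ^ p ∂ρ := integral_nonneg fun ω => by positivity
  rw [lpNorm_eq_integral hp hf] at h
  calc ∫ ω, ‖f ω‖ ^ p ∂ρ = ((∫ ω, ‖f ω‖ ^ p ∂ρ) ^ p⁻¹) ^ p :=
        (Real.rpow_inv_rpow h0 hp.ne').symm
    _ ≤ a ^ p := Real.rpow_le_rpow (by positivity) h hp.le

/-- Minkowski's inequality for upper bounds of moments. -/
lemma integral_add_rpow_le [IsFiniteMeasure ρ] {q a b : ℝ} (hq : 1 ≤ q) (ha : 0 ≤ a)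
    (hb : 0 ≤ b) {f g : Ω → ℝ} (hf : Measurable f) (hg : Measurable g)
    (hf0 : ∀ ω, 0 ≤ f ω) (hg0 : ∀ ω, 0 ≤ g ω)
    (hfb : ∃ C, ∀ ω, ‖f ω‖ ≤ C)
    (hfa : ∫ ω, f ω ^ q ∂ρ ≤ a ^ q) (hgb : ∫ ω, g ω ^ q ∂ρ ≤ b ^ q) :
    ∫ ω, (f ω + g ω) ^ q ∂ρ ≤ (a + b) ^ q := by
  have hq0 : 0 < q := by linarith
  obtain ⟨C, hC⟩ := hfb
  have h := lpNorm_add_le (p := ENNReal.ofReal q)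
    (MemLp.of_bound (μ := ρ) hf.aestronglyMeasurable C (Filter.Eventually.of_forall hC))
    (by simpa using hq) (g := g)
  have h1 := lpNorm_le_of_integral_le hq0 ha hf.aestronglyMeasurable (ρ := ρ)
    (by simpa only [Real.norm_of_nonneg (hf0 _)] using hfa)
  have h2 := lpNorm_le_of_integral_le hq0 hb hg.aestronglyMeasurable (ρ := ρ)
    (by simpa only [Real.norm_of_nonneg (hg0 _)] using hgb)
  have h3 := integral_le_of_lpNorm_le hq0 (hf.add hg).aestronglyMeasurable
    (h.trans (add_le_add h1 h2))
  simpa only [Pi.add_apply, Real.norm_of_nonneg (add_nonneg (hf0 _) (hg0 _))] using h3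

end Minkowski

/-! ### One step of a stable linear stochastic approximation -/

section LSA

variable {Y E : Type*} [MeasurableSpace Y] [NormedAddCommGroup E] [InnerProductSpace ℝ E]

/-- The centred linear stochastic approximation `u ↦ u - α (A y u + ξ y)`, started at `e₀` and
driven by the samples `x 1, x 2, …`. -/
def chain (α : ℝ) (A : Y → E →ₗ[ℝ] E) (ξ : Y → E) (e₀ : E) (x : ℕ → Y) : ℕ → E
  | 0 => e₀
  | t + 1 => chain α A ξ e₀ x t - α • (A (x (t + 1)) (chain α A ξ e₀ x t) + ξ (x (t + 1)))

lemma chain_eq_add (α : ℝ) (A : Y → E →ₗ[ℝ] E) (ξ : Y → E) (e₀ : E) (x : ℕ → Y) (t : ℕ) :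
    chain α A ξ e₀ x t = chain α A 0 e₀ x t + chain α A ξ 0 x t := by
  induction t with
  | zero => simp [chain]
  | succ t ih =>
    simp only [chain, ih, map_add, Pi.zero_apply, add_zero, smul_add]
    abel

variable [MeasurableSpace E]

/-- The hypotheses on the random operator `A` and the noise `ξ` under which the stochastic
approximation is analysed. The squared seminorm `N` controls both the drift and the second moment
of `A y u`: the mean operator is coercive with constant `κ` with respect to `N`, which in turn
dominates `lam ‖u‖²`. The noise is centred, bounded by `B`, and has variance at most `σ²`. -/
structure IsStableLSA (ν : Measure Y) (A : Y → E →ₗ[ℝ] E) (ξ : Y → E) (N : E → ℝ)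
    (κ lam B σ : ℝ) : Prop where
  measurable_A : Measurable fun p : Y × E => A p.1 p.2
  measurable_noise : Measurable ξ
  norm_A_le : ∀ y u, ‖A y u‖ ≤ 2 * ‖u‖
  norm_noise_le : ∀ y, ‖ξ y‖ ≤ B
  integral_noise : ∫ y, ξ y ∂ν = 0
  le_integral_inner : ∀ u, κ * N u ≤ ∫ y, inner ℝ u (A y u) ∂ν
  integral_sq_A_le : ∀ u, ∫ y, ‖A y u‖ ^ 2 ∂ν ≤ 4 * N u
  integral_sq_noise_le : ∫ y, ‖ξ y‖ ^ 2 ∂ν ≤ σ ^ 2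
  le_N : ∀ u, lam * ‖u‖ ^ 2 ≤ N u
  κ_pos : 0 < κ
  κ_le : κ ≤ 1
  lam_pos : 0 < lam
  lam_le : lam ≤ 1
  B_pos : 0 < B

variable {ν : Measure Y} [IsProbabilityMeasure ν] {A : Y → E →ₗ[ℝ] E} {ξ : Y → E}
  {N : E → ℝ} {κ lam B σ : ℝ} [CompleteSpace E] [BorelSpace E] [SecondCountableTopology E]

lemma integral_rpow_drift_le {D : Y → E} (hDm : Measurable D) (u : E) {W q : ℝ} (hW : 0 ≤ W)
    (hV : 0 < ‖u‖ ^ 2 + W) (hq : 1 ≤ q)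
    (hD : ∀ y, q * ‖D y‖ ≤ 2 / 5 * √(‖u‖ ^ 2 + W)) :
    ∫ y, (‖u + D y‖ ^ 2 + W) ^ q ∂ν ≤ (‖u‖ ^ 2 + W) ^ q *
      (1 + q / (‖u‖ ^ 2 + W) *
        (2 * ∫ y, inner ℝ u (D y) ∂ν + 11 * q * ∫ y, ‖D y‖ ^ 2 ∂ν)) := by
  have hDb : ∀ y, ‖D y‖ ≤ √(‖u‖ ^ 2 + W) := fun y => by
    nlinarith [hD y, norm_nonneg (D y), Real.sqrt_nonneg (‖u‖ ^ 2 + W)]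
  set C := √(‖u‖ ^ 2 + W)
  have i1 : Integrable (fun y => inner ℝ u (D y)) ν :=
    (integrable_of_norm_le hDm C hDb).const_inner u
  have i2 : Integrable (fun y => ‖D y‖ ^ 2) ν :=
    integrable_of_norm_le (hDm.norm.pow_const 2) (C ^ 2) fun y => by
      rw [norm_pow, norm_norm]
      exact pow_le_pow_left₀ (norm_nonneg _) (hDb y) 2
  have i3 : Integrable (fun y => (‖u + D y‖ ^ 2 + W) ^ q) ν :=
    integrable_of_norm_le ((((hDm.const_add u).norm.pow_const 2).add_const W).pow_const q)
      (((‖u‖ + C) ^ 2 + W) ^ q) fun y => by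
      rw [Real.norm_of_nonneg (by positivity)]
      gcongr
      exact (norm_add_le _ _).trans (by gcongr; exact hDb y)
  have i4 : Integrable (fun y => 2 * inner ℝ u (D y) + 11 * q * ‖D y‖ ^ 2) ν :=
    (i1.const_mul 2).add (i2.const_mul (11 * q))
  calc _ ≤ ∫ y, (‖u‖ ^ 2 + W) ^ q *
      (1 + q / (‖u‖ ^ 2 + W) * (2 * inner ℝ u (D y) + 11 * q * ‖D y‖ ^ 2)) ∂ν :=
        integral_mono i3 (((integrable_const _).add (i4.const_mul _)).const_mul _)
          fun y => rpow_drift_le u (D y) hW hV hq (hD y)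
    _ = _ := by
        rw [integral_const_mul, integral_add (integrable_const _) (i4.const_mul _),
          integral_const_mul, integral_add (i1.const_mul 2) (i2.const_mul (11 * q)),
          integral_const_mul, integral_const_mul]
        simp

namespace IsStableLSA

variable (h : IsStableLSA ν A ξ N κ lam B σ)
include h

lemma measurable_A_apply (u : E) : Measurable fun y => A y u :=
  h.measurable_A.comp (measurable_id.prodMk measurable_const)

lemma integrable_A_apply (u : E) : Integrable (fun y => A y u) ν :=
  integrable_of_norm_le (h.measurable_A_apply u) _ fun y => h.norm_A_le y u

lemma integrable_noise : Integrable ξ ν :=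
  integrable_of_norm_le h.measurable_noise _ h.norm_noise_le

lemma N_nonneg (u : E) : 0 ≤ N u :=
  (mul_nonneg h.lam_pos.le (sq_nonneg _)).trans (h.le_N u)

lemma integral_inner_step (α : ℝ) (u : E) :
    ∫ y, inner ℝ u (-(α • (A y u + ξ y))) ∂ν = -(α * ∫ y, inner ℝ u (A y u) ∂ν) := by
  have e : ∀ y, inner ℝ u (-(α • (A y u + ξ y)))
      = -(α * inner ℝ u (A y u) + α * inner ℝ u (ξ y)) := fun y => by
    rw [inner_neg_right, inner_smul_right, inner_add_right]; ring
  simp only [e]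
  rw [integral_neg, integral_add (((h.integrable_A_apply u).const_inner u).const_mul α)
    ((h.integrable_noise.const_inner u).const_mul α), integral_const_mul, integral_const_mul,
    integral_inner h.integrable_noise u, h.integral_noise]
  simp

/-- One step of the homogeneous recursion contracts the `p`-th moment: since `α p ≤ κ / 38`, the
second-order term of the expansion is absorbed by the drift `-2 α κ N u`. -/
lemma integral_norm_step_rpow_le {α p : ℝ} (hα : 0 < α) (hp : 2 < p) (hαp : α * p ≤ κ / 38)
    (u : E) :
    ∫ y, ‖u - α • (A y u)‖ ^ p ∂ν ≤ (1 - 1 / 2 * α * κ * lam) ^ p * ‖u‖ ^ p := by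
  have hκ := h.κ_pos
  have hκ1 := h.κ_le
  have hl := h.lam_pos
  have hl1 := h.lam_le
  rcases eq_or_ne u 0 with rfl | hu
  · simp [Real.zero_rpow (by linarith : p ≠ 0)]
  have hu0 : 0 < ‖u‖ := norm_pos_iff.2 hu
  have hα1 : α ≤ 1 / 76 := by nlinarith
  have hδ : α * κ * lam ≤ 1 / 76 := by
    have : κ * lam ≤ 1 := by nlinarith
    nlinarith
  set q := p / 2 with hq
  have hDn : ∀ y, ‖-(α • A y u)‖ = α * ‖A y u‖ := fun y => by
    rw [norm_neg, norm_smul, Real.norm_of_nonneg hα.le]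
  have key := integral_rpow_drift_le (ν := ν) (D := fun y => -(α • A y u))
    ((h.measurable_A_apply u).const_smul α).neg u (W := 0) le_rfl (by positivity)
    (q := q) (by linarith) (fun y => by
      rw [add_zero, Real.sqrt_sq hu0.le, hDn]
      have := h.norm_A_le y u
      calc q * (α * ‖A y u‖) ≤ q * (α * (2 * ‖u‖)) := by gcongr
        _ = (α * p) * ‖u‖ := by rw [hq]; ring
        _ ≤ _ := by gcongr; linarith)
  simp only [add_zero, ← sub_eq_add_neg, norm_sq_rpow_half, hq] at key
  rw [← hq] at key
  have e1 : ∫ y, inner ℝ u (-(α • (A y u))) ∂ν = -(α * ∫ y, inner ℝ u (A y u) ∂ν) := by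
    simp_rw [inner_neg_right, inner_smul_right]
    rw [integral_neg, integral_const_mul]
  have e2 : ∫ y, ‖-(α • A y u)‖ ^ 2 ∂ν = α ^ 2 * ∫ y, ‖A y u‖ ^ 2 ∂ν := by
    simp_rw [hDn, mul_pow]
    rw [integral_const_mul]
  rw [e1, e2] at key
  refine key.trans ?_
  rw [mul_comm]
  refine mul_le_mul_of_nonneg_right ?_ (by positivity)
  have hN := h.N_nonneg u
  have b1 := h.le_integral_inner u
  have b2 := h.integral_sq_A_le u
  have b3 := h.le_N u
  have hsum : 2 * -(α * ∫ y, inner ℝ u (A y u) ∂ν) + 11 * q * (α ^ 2 * ∫ y, ‖A y u‖ ^ 2 ∂ν)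
      ≤ -(α * κ * lam) * ‖u‖ ^ 2 := by
    have c1 : α * (κ * N u) ≤ α * ∫ y, inner ℝ u (A y u) ∂ν := by gcongr
    have c2 : 11 * q * (α ^ 2 * ∫ y, ‖A y u‖ ^ 2 ∂ν) ≤ 11 * q * (α ^ 2 * (4 * N u)) := by
      gcongr
    have c3 : 11 * q * (α ^ 2 * (4 * N u)) = 22 * (α * p) * (α * N u) := by rw [hq]; ring
    have c4 : 22 * (α * p) * (α * N u) ≤ 22 * (κ / 38) * (α * N u) := by gcongr
    have c5 : α * κ * (lam * ‖u‖ ^ 2) ≤ α * κ * N u := by gcongr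
    have c6 : 0 ≤ α * κ * N u := by positivity
    nlinarith
  have h1 : 1 + q / ‖u‖ ^ 2 * (2 * -(α * ∫ y, inner ℝ u (A y u) ∂ν)
      + 11 * q * (α ^ 2 * ∫ y, ‖A y u‖ ^ 2 ∂ν)) ≤ 1 + q * -(α * κ * lam) := by
    have : q * -(α * κ * lam) = q / ‖u‖ ^ 2 * (-(α * κ * lam) * ‖u‖ ^ 2) := by field_simp
    rw [this]
    gcongr
  have h2 := one_add_mul_self_le_rpow_one_add (s := -(α * κ * lam)) (by linarith) (p := q)
    (by linarith)
  have h3 : (1 + -(α * κ * lam)) ^ q ≤ ((1 - 1 / 2 * α * κ * lam) ^ 2) ^ q := by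
    refine Real.rpow_le_rpow (by linarith) ?_ (by linarith)
    nlinarith [sq_nonneg (α * κ * lam)]
  have h4 : ((1 - 1 / 2 * α * κ * lam) ^ 2) ^ q = (1 - 1 / 2 * α * κ * lam) ^ p := by
    rw [← Real.rpow_natCast, ← Real.rpow_mul (by linarith), hq]
    congr 1; push_cast; ring
  linarith

/-- One step of the recursion with noise. Adding `(2 α p B)²` to the squared norm makes the
increment small enough for the second-order expansion, although `‖u‖` may be smaller than the
noise `α B`. -/
lemma integral_noisy_step_rpow_le {α p : ℝ} (hα : 0 < α) (hp : 2 < p) (hαp : α * p ≤ κ / 38)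
    (u : E) :
    ∫ y, (‖u - α • (A y u + ξ y)‖ ^ 2 + (2 * (α * p) * B) ^ 2) ^ (p / 2) ∂ν ≤
      (1 - 1 / 2 * α * κ * lam) * (‖u‖ ^ 2 + (2 * (α * p) * B) ^ 2) ^ (p / 2)
      + 1 / 2 * α * κ * lam *
        ((2 * (α * p) * B) ^ 2 + 22 * (α * p) * σ ^ 2 / (κ * lam)) ^ (p / 2) := by
  have hκ := h.κ_pos
  have hκ1 := h.κ_le
  have hl := h.lam_pos
  have hB := h.B_pos
  set R := 2 * (α * p) * B with hR
  set q := p / 2 with hq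
  have hR0 : 0 < R := by positivity
  have hV : 0 < ‖u‖ ^ 2 + R ^ 2 := by positivity
  set V := ‖u‖ ^ 2 + R ^ 2 with hVdef
  have huV : ‖u‖ ≤ √V := Real.le_sqrt_of_sq_le (by nlinarith)
  have hRV : R ≤ √V := Real.le_sqrt_of_sq_le (by nlinarith [sq_nonneg ‖u‖])
  have hDm : Measurable fun y => -(α • (A y u + ξ y)) :=
    (((h.measurable_A_apply u).add h.measurable_noise).const_smul α).neg
  have key := integral_rpow_drift_le (ν := ν) hDm u (W := R ^ 2) (by positivity) hV
    (q := q) (by linarith) (fun y => by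
      rw [norm_neg, norm_smul, Real.norm_of_nonneg hα.le]
      have := h.norm_A_le y u
      have := h.norm_noise_le y
      calc q * (α * ‖A y u + ξ y‖) ≤ q * (α * (2 * ‖u‖ + B)) := by
            gcongr
            exact (norm_add_le _ _).trans (by linarith)
        _ = (α * p) * ‖u‖ + R / 4 := by rw [hq, hR]; ring
        _ ≤ (1 / 38) * ‖u‖ + R / 4 := by gcongr; linarith
        _ ≤ _ := by linarith)
  simp only [← sub_eq_add_neg] at key
  rw [← hVdef, h.integral_inner_step] at key
  refine key.trans (le_trans ?_ (rpow_mul_one_add_le (q := q) hV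
    (m := R ^ 2 + 22 * (α * p) * σ ^ 2 / (κ * lam)) (by positivity) (by linarith)
    (δ := 1 / 2 * α * κ * lam) (by positivity)))
  refine mul_le_mul_of_nonneg_left ?_ (by positivity)
  have hN := h.N_nonneg u
  have b1 := h.le_integral_inner u
  have b2 := h.integral_sq_A_le u
  have b3 := h.le_N u
  have b4 := h.integral_sq_noise_le
  have iA : Integrable (fun y => ‖A y u‖ ^ 2) ν :=
    integrable_of_norm_le ((h.measurable_A_apply u).norm.pow_const 2) ((2 * ‖u‖) ^ 2)
      fun y => by
        rw [norm_pow, norm_norm]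
        exact pow_le_pow_left₀ (norm_nonneg _) (h.norm_A_le y u) 2
  have iξ : Integrable (fun y => ‖ξ y‖ ^ 2) ν :=
    integrable_of_norm_le (h.measurable_noise.norm.pow_const 2) (B ^ 2)
      fun y => by
        rw [norm_pow, norm_norm]
        exact pow_le_pow_left₀ (norm_nonneg _) (h.norm_noise_le y) 2
  have b5 : ∫ y, ‖-(α • (A y u + ξ y))‖ ^ 2 ∂ν ≤ α ^ 2 * (8 * N u + 2 * σ ^ 2) := by
    calc _ ≤ ∫ y, α ^ 2 * (2 * ‖A y u‖ ^ 2 + 2 * ‖ξ y‖ ^ 2) ∂ν := by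
          refine integral_mono_of_nonneg (Filter.Eventually.of_forall fun y => by positivity)
            (((iA.const_mul 2).add (iξ.const_mul 2)).const_mul _)
            (Filter.Eventually.of_forall fun y => ?_)
          simp only
          rw [norm_neg, norm_smul, Real.norm_of_nonneg hα.le, mul_pow]
          gcongr
          have := norm_add_le (A y u) (ξ y)
          nlinarith [sq_nonneg (‖A y u‖ - ‖ξ y‖), norm_nonneg (A y u + ξ y)]
      _ ≤ _ := by
          rw [integral_const_mul, integral_add (iA.const_mul 2) (iξ.const_mul 2),
            integral_const_mul, integral_const_mul]
          exact mul_le_mul_of_nonneg_left (by linarith) (by positivity)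
  have hsum : 2 * -(α * ∫ y, inner ℝ u (A y u) ∂ν)
      + 11 * q * ∫ y, ‖-(α • (A y u + ξ y))‖ ^ 2 ∂ν
      ≤ -(1 / 2 * α * κ * lam) * ‖u‖ ^ 2 + 11 * (α * p) * (α * σ ^ 2) := by
    have c1 : α * (κ * N u) ≤ α * ∫ y, inner ℝ u (A y u) ∂ν := by gcongr
    have c2 : 11 * q * ∫ y, ‖-(α • (A y u + ξ y))‖ ^ 2 ∂ν
        ≤ 11 * q * (α ^ 2 * (8 * N u + 2 * σ ^ 2)) := by gcongr
    have c3 : 11 * q * (α ^ 2 * (8 * N u + 2 * σ ^ 2))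
        = 44 * (α * p) * (α * N u) + 11 * (α * p) * (α * σ ^ 2) := by rw [hq]; ring
    have c4 : 44 * (α * p) * (α * N u) ≤ 44 * (κ / 38) * (α * N u) := by gcongr
    have c5 : α * κ * (lam * ‖u‖ ^ 2) ≤ α * κ * N u := by gcongr
    have c6 : 0 ≤ α * κ * N u := by positivity
    nlinarith
  have : q * (1 / 2 * α * κ * lam * ((R ^ 2 + 22 * (α * p) * σ ^ 2 / (κ * lam)) / V - 1))
      = q / V * (-(1 / 2 * α * κ * lam) * ‖u‖ ^ 2 + 11 * (α * p) * (α * σ ^ 2)) := by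
    rw [show ‖u‖ ^ 2 = V - R ^ 2 by rw [hVdef]; ring]
    field_simp
    ring
  rw [this]
  gcongr

/-- One step of a Rosenthal inequality: adding a centred noise term of variance `σ ^ 2` to `u`
increases the level `M` of the regularised squared norm by a multiple of `p σ ^ 2`. -/
lemma integral_add_noise_rpow_le {p M : ℝ} (hp : 2 < p) (hM : 0 < M) (u : E) :
    ∫ y, (‖u + ξ y‖ ^ 2 + (2 * p * B) ^ 2) ^ (p / 2) ∂ν ≤
      (1 + (p / 2 - 1) * (6 * p * σ ^ 2 / M)) * (‖u‖ ^ 2 + (2 * p * B) ^ 2) ^ (p / 2)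
      + 6 * p * σ ^ 2 / M * M ^ (p / 2) := by
  have hB := h.B_pos
  set R := 2 * p * B with hR
  set q := p / 2 with hq
  have hR0 : 0 < R := by positivity
  have hV : 0 < ‖u‖ ^ 2 + R ^ 2 := by positivity
  set V := ‖u‖ ^ 2 + R ^ 2 with hVdef
  have hRV : R ≤ √V := Real.le_sqrt_of_sq_le (by nlinarith [sq_nonneg ‖u‖])
  have key := integral_rpow_drift_le (ν := ν) h.measurable_noise u (W := R ^ 2)
    (by positivity) hV (q := q) (by linarith) (fun y => by
      calc q * ‖ξ y‖ ≤ q * B := by gcongr; exact h.norm_noise_le y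
        _ = R / 4 := by rw [hq, hR]; ring
        _ ≤ _ := by linarith)
  rw [integral_inner h.integrable_noise, h.integral_noise, inner_zero_right, ← hVdef] at key
  have b := rpow_mul_one_add_le (q := q) hV hM.le (by linarith) (δ := 6 * p * σ ^ 2 / M)
    (by positivity)
  have hle : 1 + q / V * (2 * 0 + 11 * q * ∫ y, ‖ξ y‖ ^ 2 ∂ν)
      ≤ 1 + q * (6 * p * σ ^ 2 / M * (M / V - 1)) + q * (6 * p * σ ^ 2 / M) := by
    have : 1 + q * (6 * p * σ ^ 2 / M * (M / V - 1)) + q * (6 * p * σ ^ 2 / M)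
        = 1 + q / V * (6 * p * σ ^ 2) := by field_simp; ring
    rw [this]
    gcongr
    have := h.integral_sq_noise_le
    calc 2 * 0 + 11 * q * ∫ y, ‖ξ y‖ ^ 2 ∂ν ≤ 2 * 0 + 11 * q * σ ^ 2 := by gcongr
      _ ≤ _ := by rw [hq]; nlinarith [sq_nonneg σ]
  have hm := mul_le_mul_of_nonneg_left hle (Real.rpow_nonneg hV.le q)
  nlinarith

lemma norm_A_sub_mean_le (y : Y) (e : E) : ‖A y e - ∫ y', A y' e ∂ν‖ ≤ 4 * ‖e‖ := by
  have h1 := h.norm_A_le y e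
  have h2 : ‖∫ y', A y' e ∂ν‖ ≤ 2 * ‖e‖ := by
    simpa using norm_integral_le_of_norm_le_const (μ := ν)
      (Filter.Eventually.of_forall fun y => h.norm_A_le y e)
  linarith [norm_sub_le (A y e) (∫ y', A y' e ∂ν)]

/-- The `2`-smoothness of `L ^ p`, for the increment `A y e - 𝔼 A e`. -/
lemma integral_norm_add_rpow_le {p : ℝ} (hp : 2 < p) (x e : E) :
    ∫ y, ‖x + (A y e - ∫ y', A y' e ∂ν)‖ ^ p ∂ν
      ≤ (‖x‖ ^ 2 + 32 * (1 + 2 * p) * ‖e‖ ^ 2) ^ (p / 2) := by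
  have hm : Measurable fun y => A y e - ∫ y', A y' e ∂ν :=
    (h.measurable_A_apply e).sub_const _
  have hb := fun y => h.norm_A_sub_mean_le y e
  have hi : Integrable (fun y => A y e - ∫ y', A y' e ∂ν) ν := integrable_of_norm_le hm _ hb
  have hi' := hi.const_inner (𝕜 := ℝ) x
  have h0 : ∫ y, inner ℝ x (A y e - ∫ y', A y' e ∂ν) ∂ν = 0 := by
    rw [integral_inner hi, integral_sub (h.integrable_A_apply e) (integrable_const _)]
    simp
  calc _ ≤ ∫ y, ((‖x‖ ^ 2 + 32 * (1 + 2 * p) * ‖e‖ ^ 2) ^ (p / 2)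
        + p * ‖x‖ ^ (p - 2) * inner ℝ x (A y e - ∫ y', A y' e ∂ν)) ∂ν := by
        refine integral_mono_of_nonneg (Filter.Eventually.of_forall fun y => by positivity)
          ((integrable_const _).add (hi'.const_mul _)) (Filter.Eventually.of_forall fun y => ?_)
        refine (norm_add_rpow_le x (A y e - ∫ y', A y' e ∂ν) hp).trans ?_
        simp only
        gcongr ?_ ^ _ + _
        have := pow_le_pow_left₀ (norm_nonneg _) (hb y) 2
        nlinarith
    _ = _ := by
        rw [integral_add (integrable_const _) (hi'.const_mul _), integral_const_mul, h0]
        simp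

end IsStableLSA

end LSA

/-! ### Moments along the trajectory -/

section Trajectory

variable {Ω Y E : Type*} [MeasurableSpace Ω] [MeasurableSpace Y] [NormedAddCommGroup E]
  [InnerProductSpace ℝ E] [MeasurableSpace E] [BorelSpace E] [FiniteDimensional ℝ E]
  {ν : Measure Y} [IsProbabilityMeasure ν] {A : Y → E →ₗ[ℝ] E} {ξ : Y → E}
  {N : E → ℝ} {κ lam B σ : ℝ} {ρ : Measure Ω} [IsProbabilityMeasure ρ] {X : ℕ → Ω → Y}

/-- The partial sums `∑ ξ(X_{t+1})` over `n` consecutive times `t ≥ n₀`. -/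
def noiseSum (ξ : Y → E) (n₀ : ℕ) (x : ℕ → Y) (n : ℕ) : E :=
  ∑ i ∈ Finset.range n, ξ (x (n₀ + i + 1))

/-- The partial sums `∑ (A(X_{t+1}) - 𝔼 A) e_t` over `n` consecutive times `t ≥ n₀`, along the
trajectory `e` of the centred recursion. -/
noncomputable def multSum (ν : Measure Y) (α : ℝ) (A : Y → E →ₗ[ℝ] E) (ξ : Y → E) (e₀ : E)
    (n₀ : ℕ) (x : ℕ → Y) (n : ℕ) : E :=
  ∑ i ∈ Finset.range n, (A (x (n₀ + i + 1)) (chain α A ξ e₀ x (n₀ + i))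
    - ∫ y, A y (chain α A ξ e₀ x (n₀ + i)) ∂ν)

namespace IsStableLSA

variable (h : IsStableLSA ν A ξ N κ lam B σ) (hX : ∀ t, Measurable (X t))
include h

omit [IsProbabilityMeasure ρ] in
/-- The homogeneous system, without noise, satisfies the same hypotheses. -/
lemma homogeneous : IsStableLSA ν A (0 : Y → E) N κ lam B σ where
  measurable_A := h.measurable_A
  measurable_noise := measurable_const
  norm_A_le := h.norm_A_le
  norm_noise_le := fun y => by simpa using h.B_pos.le
  integral_noise := by simp
  le_integral_inner := h.le_integral_inner
  integral_sq_A_le := h.integral_sq_A_le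
  integral_sq_noise_le := by simpa using sq_nonneg σ
  le_N := h.le_N
  κ_pos := h.κ_pos
  κ_le := h.κ_le
  lam_pos := h.lam_pos
  lam_le := h.lam_le
  B_pos := h.B_pos

lemma measurable_chain (α : ℝ) (e₀ : E) (t : ℕ) :
    Measurable[past X t] fun ω => chain α A ξ e₀ (X · ω) t := by
  induction t with
  | zero => exact measurable_const
  | succ t ih =>
    have h1 : Measurable[past X (t + 1)] fun ω => chain α A ξ e₀ (X · ω) t :=
      ih.mono (past_mono X t.le_succ) le_rfl
    have h2 : Measurable[past X (t + 1)] (X (t + 1)) := measurable_past X le_rfl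
    simp only [chain]
    exact h1.sub (((h.measurable_A.comp (h2.prodMk h1)).add
      (h.measurable_noise.comp h2)).const_smul α)

lemma bounded_chain (α : ℝ) (e₀ : E) (t : ℕ) :
    ∃ C, ∀ x : ℕ → Y, ‖chain α A ξ e₀ x t‖ ≤ C := by
  induction t with
  | zero => exact ⟨‖e₀‖, fun x => le_rfl⟩
  | succ t ih =>
    obtain ⟨C, hC⟩ := ih
    refine ⟨C + |α| * (2 * C + B), fun x => ?_⟩
    refine (norm_sub_le _ _).trans (add_le_add (hC x) ?_)
    rw [norm_smul, Real.norm_eq_abs]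
    gcongr
    refine (norm_add_le _ _).trans (add_le_add ((h.norm_A_le _ _).trans ?_) (h.norm_noise_le _))
    linarith [hC x]

lemma measurable_mean : Measurable fun e : E => ∫ y, A y e ∂ν := by
  have : StronglyMeasurable (fun p : E × Y => A p.2 p.1) :=
    (h.measurable_A.comp measurable_swap).stronglyMeasurable
  exact this.integral_prod_right.measurable

lemma measurable_noiseSum (n₀ n : ℕ) :
    Measurable[past X (n₀ + n)] fun ω => noiseSum ξ n₀ (X · ω) n := by
  unfold noiseSum
  refine Finset.measurable_fun_sum _ fun i hi => ?_
  exact h.measurable_noise.comp (measurable_past X (by have := Finset.mem_range.1 hi; omega))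

lemma bounded_noiseSum (n₀ n : ℕ) : ∀ x : ℕ → Y, ‖noiseSum ξ n₀ x n‖ ≤ n * B := fun x => by
  refine (norm_sum_le _ _).trans ?_
  calc _ ≤ ∑ i ∈ Finset.range n, B := Finset.sum_le_sum fun i _ => h.norm_noise_le _
    _ = n * B := by simp

lemma measurable_multSum (α : ℝ) (e₀ : E) (n₀ n : ℕ) :
    Measurable[past X (n₀ + n)] fun ω => multSum ν α A ξ e₀ n₀ (X · ω) n := by
  unfold multSum
  refine Finset.measurable_fun_sum _ fun i hi => ?_
  have hi := Finset.mem_range.1 hi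
  have h1 : Measurable[past X (n₀ + n)] fun ω => chain α A ξ e₀ (X · ω) (n₀ + i) :=
    (h.measurable_chain α e₀ _).mono (past_mono X (by omega)) le_rfl
  have h2 : Measurable[past X (n₀ + n)] (X (n₀ + i + 1)) := measurable_past X (by omega)
  exact (h.measurable_A.comp (h2.prodMk h1)).sub (h.measurable_mean.comp h1)

lemma bounded_multSum (α : ℝ) (e₀ : E) (n₀ n : ℕ) :
    ∃ C, ∀ x : ℕ → Y, ‖multSum ν α A ξ e₀ n₀ x n‖ ≤ C := by
  choose C hC using fun t => h.bounded_chain α e₀ t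
  refine ⟨∑ i ∈ Finset.range n, 4 * C (n₀ + i), fun x => (norm_sum_le _ _).trans ?_⟩
  exact Finset.sum_le_sum fun i _ => (h.norm_A_sub_mean_le _ _).trans (by linarith [hC (n₀ + i) x])

variable (hind : iIndepFun X ρ) (hlaw : ∀ t, ρ.map (X t) = ν)
include hX hind hlaw

lemma integral_norm_chain_rpow_le {α p : ℝ} (hα : 0 < α) (hp : 2 < p) (hαp : α * p ≤ κ / 38)
    (e₀ : E) (t : ℕ) :
    ∫ ω, ‖chain α A 0 e₀ (X · ω) t‖ ^ p ∂ρ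
      ≤ ((1 - 1 / 2 * α * κ * lam) ^ t * ‖e₀‖) ^ p := by
  have hκ := h.κ_pos
  have hc0 : 0 ≤ 1 - 1 / 2 * α * κ * lam := by
    have h1 : κ * lam ≤ 1 := by nlinarith [h.κ_le, h.lam_le, h.lam_pos]
    have h2 : α ≤ 1 := by nlinarith [h.κ_le]
    nlinarith
  have hcont : Continuous fun u : E => ‖u‖ ^ p :=
    continuous_norm.rpow_const fun _ => Or.inr (by linarith)
  have h0 := h.homogeneous
  have hint : ∀ t, Integrable (fun ω => ‖chain α A 0 e₀ (X · ω) t‖ ^ p) ρ := fun t => by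
    obtain ⟨C, hC⟩ := h0.bounded_chain α e₀ t
    exact integrable_continuous_comp (φ := fun u : E => ‖u‖ ^ p)
      ((h0.measurable_chain α e₀ t).mono (past_le hX t) le_rfl) ⟨C, fun ω => hC _⟩ hcont
  induction t with
  | zero => simp [chain]
  | succ t ih =>
    have hf : Measurable fun z : E × Y => ‖z.1 - α • (A z.2 z.1)‖ ^ p :=
      hcont.measurable.comp
        (measurable_fst.sub ((h.measurable_A.comp measurable_swap).const_smul α))
    have hi := hint (t + 1)
    simp only [chain, Pi.zero_apply, add_zero] at hi ⊢
    obtain ⟨i1, e1⟩ := integral_fresh hX hind hlaw (h0.measurable_chain α e₀ t) hf hi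
    simp only at i1 e1
    rw [e1]
    calc _ ≤ ∫ ω, (1 - 1 / 2 * α * κ * lam) ^ p * ‖chain α A 0 e₀ (X · ω) t‖ ^ p ∂ρ :=
          integral_mono i1 ((hint t).const_mul _) fun ω =>
            h.integral_norm_step_rpow_le hα hp hαp _
      _ ≤ (1 - 1 / 2 * α * κ * lam) ^ p * ((1 - 1 / 2 * α * κ * lam) ^ t * ‖e₀‖) ^ p := by
          rw [integral_const_mul]
          gcongr
      _ = _ := by
          rw [← Real.mul_rpow hc0 (by positivity), pow_succ']
          ring_nf

/-- Started at `0`, the trajectory stays at the stationary level in `L ^ p`. -/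
lemma integral_noisy_chain_rpow_le {α p : ℝ} (hα : 0 < α) (hp : 2 < p)
    (hαp : α * p ≤ κ / 38) (t : ℕ) :
    ∫ ω, (‖chain α A ξ 0 (X · ω) t‖ ^ 2 + (2 * (α * p) * B) ^ 2) ^ (p / 2) ∂ρ
      ≤ ((2 * (α * p) * B) ^ 2 + 22 * (α * p) * σ ^ 2 / (κ * lam)) ^ (p / 2) := by
  have hκ := h.κ_pos
  have hl := h.lam_pos
  have hB := h.B_pos
  have hc0 : 0 ≤ 1 - 1 / 2 * α * κ * lam := by
    have h1 : κ * lam ≤ 1 := by nlinarith [h.κ_le, h.lam_le, h.lam_pos]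
    have h2 : α ≤ 1 := by nlinarith [h.κ_le]
    nlinarith
  have hcont : Continuous fun u : E => (‖u‖ ^ 2 + (2 * (α * p) * B) ^ 2) ^ (p / 2) :=
    ((continuous_norm.pow 2).add continuous_const).rpow_const fun _ => Or.inr (by linarith)
  have hint : ∀ t, Integrable (fun ω =>
      (‖chain α A ξ 0 (X · ω) t‖ ^ 2 + (2 * (α * p) * B) ^ 2) ^ (p / 2)) ρ := fun t => by
    obtain ⟨C, hC⟩ := h.bounded_chain α 0 t
    exact integrable_continuous_comp
      (φ := fun u : E => (‖u‖ ^ 2 + (2 * (α * p) * B) ^ 2) ^ (p / 2))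
      ((h.measurable_chain α 0 t).mono (past_le hX t) le_rfl) ⟨C, fun ω => hC _⟩ hcont
  induction t with
  | zero =>
    simp only [chain, norm_zero, integral_const, probReal_univ, one_smul]
    refine Real.rpow_le_rpow (by positivity) ?_ (by linarith)
    have : 0 ≤ 22 * (α * p) * σ ^ 2 / (κ * lam) := by positivity
    nlinarith
  | succ t ih =>
    have hf : Measurable fun z : E × Y =>
        (‖z.1 - α • (A z.2 z.1 + ξ z.2)‖ ^ 2 + (2 * (α * p) * B) ^ 2) ^ (p / 2) :=
      hcont.measurable.comp (measurable_fst.sub (((h.measurable_A.comp measurable_swap).add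
        (h.measurable_noise.comp measurable_snd)).const_smul α))
    have hi := hint (t + 1)
    simp only [chain] at hi ⊢
    obtain ⟨i1, e1⟩ := integral_fresh hX hind hlaw (h.measurable_chain α 0 t) hf hi
    simp only at i1 e1
    rw [e1]
    refine (integral_mono i1 (((hint t).const_mul _).add (integrable_const _)) fun ω =>
            h.integral_noisy_step_rpow_le hα hp hαp _).trans ?_
    rw [integral_add' ((hint t).const_mul _) (integrable_const _), integral_const_mul,
      integral_const, probReal_univ, one_smul]
    have := mul_le_mul_of_nonneg_left ih hc0
    linarith

/-- Rosenthal's inequality for the noise: the level of the regularised squared norm grows linearly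
in `n`, at rate `6 p σ²`. -/
lemma integral_noiseSum_rpow_le {p : ℝ} (hp : 2 < p) (n₀ n : ℕ) :
    ∫ ω, (‖noiseSum ξ n₀ (X · ω) n‖ ^ 2 + (2 * p * B) ^ 2) ^ (p / 2) ∂ρ
      ≤ ((2 * p * B) ^ 2 + n * (6 * p * σ ^ 2)) ^ (p / 2) := by
  have hB := h.B_pos
  have hcont : Continuous fun u : E => (‖u‖ ^ 2 + (2 * p * B) ^ 2) ^ (p / 2) :=
    ((continuous_norm.pow 2).add continuous_const).rpow_const fun _ => Or.inr (by linarith)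
  have hint : ∀ n, Integrable (fun ω =>
      (‖noiseSum ξ n₀ (X · ω) n‖ ^ 2 + (2 * p * B) ^ 2) ^ (p / 2)) ρ := fun n =>
    integrable_continuous_comp (φ := fun u : E => (‖u‖ ^ 2 + (2 * p * B) ^ 2) ^ (p / 2))
      ((h.measurable_noiseSum n₀ n).mono (past_le hX _) le_rfl)
      ⟨n * B, fun ω => h.bounded_noiseSum n₀ n _⟩ hcont
  induction n with
  | zero => simp [noiseSum]
  | succ n ih =>
    set M := (2 * p * B) ^ 2 + n * (6 * p * σ ^ 2) with hM
    have hM0 : 0 < M := by positivity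
    have hf : Measurable fun z : E × Y => (‖z.1 + ξ z.2‖ ^ 2 + (2 * p * B) ^ 2) ^ (p / 2) :=
      hcont.measurable.comp (measurable_fst.add (h.measurable_noise.comp measurable_snd))
    have hi := hint (n + 1)
    simp only [noiseSum, Finset.sum_range_succ] at hi ⊢
    obtain ⟨i1, e1⟩ := integral_fresh hX hind hlaw (h.measurable_noiseSum n₀ n) hf hi
    simp only [noiseSum] at i1 e1
    rw [e1]
    refine (integral_mono i1 (((hint n).const_mul _).add (integrable_const _)) fun ω =>
            h.integral_add_noise_rpow_le hp hM0 _).trans ?_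
    rw [integral_add' ((hint n).const_mul _) (integrable_const _), integral_const_mul,
      integral_const, probReal_univ, one_smul]
    have h1 : 0 ≤ 6 * p * σ ^ 2 / M := by positivity
    have h2 := mul_le_mul_of_nonneg_left ih
      (by have := mul_nonneg (by linarith : 0 ≤ p / 2 - 1) h1
          linarith : 0 ≤ 1 + (p / 2 - 1) * (6 * p * σ ^ 2 / M))
    have h3 := one_add_mul_self_le_rpow_one_add (s := 6 * p * σ ^ 2 / M) (by linarith)
      (p := p / 2) (by linarith)
    have h4 : (2 * p * B) ^ 2 + ((n + 1 : ℕ) : ℝ) * (6 * p * σ ^ 2)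
        = M * (1 + 6 * p * σ ^ 2 / M) := by
      rw [mul_add, mul_one, mul_div_cancel₀ _ hM0.ne', hM]; push_cast; ring
    rw [h4, Real.mul_rpow hM0.le (by positivity)]
    have h5 := mul_le_mul_of_nonneg_left h3 (Real.rpow_nonneg hM0.le (p / 2))
    nlinarith

/-- A Burkholder-type inequality, from `2`-smoothness and Minkowski's inequality in
`L ^ (p / 2)`. -/
lemma integral_multSum_rpow_le {α p : ℝ} (hp : 2 < p) (e₀ : E) (n₀ : ℕ) {d : ℕ → ℝ}
    (hd0 : ∀ i, 0 ≤ d i)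
    (hd : ∀ i, ∫ ω, ‖chain α A ξ e₀ (X · ω) (n₀ + i)‖ ^ p ∂ρ ≤ d i ^ p) (n : ℕ) :
    ∫ ω, ‖multSum ν α A ξ e₀ n₀ (X · ω) n‖ ^ p ∂ρ
      ≤ (32 * (1 + 2 * p) * ∑ i ∈ Finset.range n, d i ^ 2) ^ (p / 2) := by
  have hcont : Continuous fun u : E => ‖u‖ ^ p :=
    continuous_norm.rpow_const fun _ => Or.inr (by linarith)
  have hmS : ∀ n, Measurable (fun ω => multSum ν α A ξ e₀ n₀ (X · ω) n) := fun n =>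
    (h.measurable_multSum α e₀ n₀ n).mono (past_le hX _) le_rfl
  have hme : ∀ n, Measurable (fun ω => chain α A ξ e₀ (X · ω) n) := fun n =>
    (h.measurable_chain α e₀ n).mono (past_le hX _) le_rfl
  have hint : ∀ n, Integrable (fun ω => ‖multSum ν α A ξ e₀ n₀ (X · ω) n‖ ^ p) ρ := fun n => by
    obtain ⟨C, hC⟩ := h.bounded_multSum α e₀ n₀ n
    exact integrable_continuous_comp (φ := fun u : E => ‖u‖ ^ p) (hmS n) ⟨C, fun ω => hC _⟩ hcont
  induction n with
  | zero => simp [multSum, Real.zero_rpow (by linarith : p ≠ 0),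
      Real.zero_rpow (by linarith : p / 2 ≠ 0)]
  | succ n ih =>
    have hf : Measurable fun z : (E × E) × Y =>
        ‖z.1.1 + (A z.2 z.1.2 - ∫ y, A y z.1.2 ∂ν)‖ ^ p :=
      hcont.measurable.comp ((measurable_fst.comp measurable_fst).add
        ((h.measurable_A.comp (measurable_snd.prodMk (measurable_snd.comp measurable_fst))).sub
          (h.measurable_mean.comp (measurable_snd.comp measurable_fst))))
    have hi := hint (n + 1)
    simp only [multSum, Finset.sum_range_succ] at hi ⊢
    obtain ⟨i1, e1⟩ := integral_fresh hX hind hlaw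
      ((h.measurable_multSum α e₀ n₀ n).prodMk (h.measurable_chain α e₀ (n₀ + n))) hf hi
    simp only [multSum] at i1 e1
    rw [e1]
    obtain ⟨C, hC⟩ := h.bounded_multSum α e₀ n₀ n
    obtain ⟨C', hC'⟩ := h.bounded_chain α e₀ (n₀ + n)
    have hcont2 : Continuous fun z : E × E =>
        (‖z.1‖ ^ 2 + 32 * (1 + 2 * p) * ‖z.2‖ ^ 2) ^ (p / 2) :=
      (((continuous_norm.comp continuous_fst).pow 2).add
        (((continuous_norm.comp continuous_snd).pow 2).const_mul _)).rpow_const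
          fun _ => Or.inr (by linarith)
    refine (integral_mono i1 (integrable_continuous_comp ((hmS n).prodMk (hme (n₀ + n)))
      ⟨max C C', fun ω => max_le_max (hC fun i => X i ω) (hC' fun i => X i ω)⟩ hcont2) fun ω =>
        h.integral_norm_add_rpow_le hp _ _).trans ?_
    rw [mul_add (32 * (1 + 2 * p))]
    have hp' : 0 ≤ p := by linarith
    refine integral_add_rpow_le (ρ := ρ) (q := p / 2)
      (a := 32 * (1 + 2 * p) * ∑ i ∈ Finset.range n, d i ^ 2)
      (b := 32 * (1 + 2 * p) * d n ^ 2)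
      (f := fun ω => ‖multSum ν α A ξ e₀ n₀ (X · ω) n‖ ^ 2)
      (g := fun ω => 32 * (1 + 2 * p) * ‖chain α A ξ e₀ (X · ω) (n₀ + n)‖ ^ 2)
      (by linarith) (by positivity) (by positivity)
      ((hmS n).norm.pow_const 2) (((hme (n₀ + n)).norm.pow_const 2).const_mul _)
      (fun ω => by positivity) (fun ω => by positivity) ⟨C ^ 2, fun ω => ?_⟩ ?_ ?_
    · rw [norm_pow, norm_norm]
      exact pow_le_pow_left₀ (norm_nonneg _) (hC _) 2
    · simpa only [norm_sq_rpow_half, multSum] using ih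
    · have hc : 0 ≤ 32 * (1 + 2 * p) := by positivity
      simp_rw [Real.mul_rpow hc (sq_nonneg _), norm_sq_rpow_half]
      rw [integral_const_mul]
      gcongr
      refine (hd n).trans (le_of_eq ?_)
      rw [← Real.norm_of_nonneg (hd0 n), ← norm_sq_rpow_half, Real.norm_of_nonneg (hd0 n)]

end IsStableLSA
end Trajectory

/-! ### The mean operator at a window average -/

section TailAverage

variable {Ω Y E : Type*} [MeasurableSpace Ω] [MeasurableSpace Y] [NormedAddCommGroup E]
  [InnerProductSpace ℝ E] [MeasurableSpace E] [BorelSpace E] [FiniteDimensional ℝ E]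
  {ν : Measure Y} [IsProbabilityMeasure ν] {A : Y → E →ₗ[ℝ] E} {ξ : Y → E}
  {N : E → ℝ} {κ lam B σ : ℝ} {ρ : Measure Ω} [IsProbabilityMeasure ρ] {X : ℕ → Ω → Y}

namespace IsStableLSA

variable (h : IsStableLSA ν A ξ N κ lam B σ)
include h

/-- Summation by parts of the recursion: the mean operator applied to a window average of the
trajectory telescopes up to two martingales. -/
lemma mean_window_eq {α : ℝ} (hα : 0 < α) (e₀ : E) (x : ℕ → Y) (n₀ n : ℕ) :
    ∫ y, A y ((n : ℝ)⁻¹ • ∑ i ∈ Finset.range n, chain α A ξ e₀ x (n₀ + i)) ∂ν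
      = (n : ℝ)⁻¹ • (α⁻¹ • (chain α A ξ e₀ x n₀ - chain α A ξ e₀ x (n₀ + n))
        - noiseSum ξ n₀ x n - multSum ν α A ξ e₀ n₀ x n) := by
  have h1 : ∫ y, A y ((n : ℝ)⁻¹ • ∑ i ∈ Finset.range n, chain α A ξ e₀ x (n₀ + i)) ∂ν
      = (n : ℝ)⁻¹ • ∑ i ∈ Finset.range n, ∫ y, A y (chain α A ξ e₀ x (n₀ + i)) ∂ν := by
    simp only [map_smul, map_sum]
    rw [integral_smul, integral_finsetSum]
    exact fun i _ => h.integrable_A_apply _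
  rw [h1]
  congr 1
  induction n with
  | zero => simp [noiseSum, multSum]
  | succ n ih =>
    rw [Finset.sum_range_succ, ih (by
      simp only [map_smul, map_sum]
      rw [integral_smul, integral_finsetSum]
      exact fun i _ => h.integrable_A_apply _)]
    simp only [noiseSum, multSum, Finset.sum_range_succ]
    rw [show n₀ + (n + 1) = n₀ + n + 1 by ring]
    simp only [chain, smul_sub, smul_smul, inv_mul_cancel₀ hα.ne', one_smul]
    abel

variable (hX : ∀ t, Measurable (X t)) (hind : iIndepFun X ρ) (hlaw : ∀ t, ρ.map (X t) = ν)
include hX hind hlaw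

/-- The initial error is forgotten geometrically; the noise contributes the stationary level. -/
lemma lpNorm_chain_le {α p : ℝ} (hα : 0 < α) (hp : 2 < p) (hαp : α * p ≤ κ / 38)
    (e₀ : E) (t : ℕ) :
    lpNorm (fun ω => chain α A ξ e₀ (X · ω) t) (ENNReal.ofReal p) ρ
      ≤ (1 - 1 / 2 * α * κ * lam) ^ t * ‖e₀‖
        + √((2 * (α * p) * B) ^ 2 + 22 * (α * p) * σ ^ 2 / (κ * lam)) := by
  have hκ := h.κ_pos
  have hl := h.lam_pos
  have h0 := h.homogeneous
  have hc0 : 0 ≤ 1 - 1 / 2 * α * κ * lam := by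
    have h1 : κ * lam ≤ 1 := by nlinarith [h.κ_le, h.lam_le, h.lam_pos]
    have h2 : α ≤ 1 := by nlinarith [h.κ_le]
    nlinarith
  have hm1 : Measurable (fun ω => chain α A 0 e₀ (X · ω) t) :=
    (h0.measurable_chain α e₀ t).mono (past_le hX _) le_rfl
  have hm2 : Measurable (fun ω => chain α A ξ 0 (X · ω) t) :=
    (h.measurable_chain α 0 t).mono (past_le hX _) le_rfl
  obtain ⟨C, hC⟩ := h0.bounded_chain α e₀ t
  obtain ⟨C', hC'⟩ := h.bounded_chain α 0 t
  have e : (fun ω => chain α A ξ e₀ (X · ω) t)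
      = (fun ω => chain α A 0 e₀ (X · ω) t) + fun ω => chain α A ξ 0 (X · ω) t := by
    funext ω; exact chain_eq_add α A ξ e₀ _ t
  rw [e]
  refine (lpNorm_add_le (MemLp.of_bound hm1.aestronglyMeasurable C
    (Filter.Eventually.of_forall fun ω => hC _)) (by simpa using by linarith)).trans
    (add_le_add ?_ ?_)
  · exact lpNorm_le_of_integral_le (by linarith) (by positivity) hm1.aestronglyMeasurable
      (h.integral_norm_chain_rpow_le hX hind hlaw hα hp hαp e₀ t)
  · refine lpNorm_le_of_integral_le (by linarith) (by positivity) hm2.aestronglyMeasurable ?_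
    rw [← Real.norm_of_nonneg (Real.sqrt_nonneg _), ← norm_sq_rpow_half,
      Real.norm_of_nonneg (Real.sqrt_nonneg _), Real.sq_sqrt (by positivity)]
    refine le_trans ?_ (h.integral_noisy_chain_rpow_le hX hind hlaw hα hp hαp t)
    refine integral_mono_of_nonneg (Filter.Eventually.of_forall fun ω => by positivity) ?_
      (Filter.Eventually.of_forall fun ω => ?_)
    · exact integrable_continuous_comp
        (φ := fun u : E => (‖u‖ ^ 2 + (2 * (α * p) * B) ^ 2) ^ (p / 2)) hm2
        ⟨C', fun ω => hC' _⟩ (((continuous_norm.pow 2).add continuous_const).rpow_const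
          fun _ => Or.inr (by linarith))
    · simp only
      rw [← norm_sq_rpow_half]
      exact Real.rpow_le_rpow (by positivity) (le_add_of_nonneg_right (by positivity))
        (by linarith)

lemma lpNorm_noiseSum_le {p : ℝ} (hp : 2 < p) (n₀ n : ℕ) :
    lpNorm (fun ω => noiseSum ξ n₀ (X · ω) n) (ENNReal.ofReal p) ρ
      ≤ √((2 * p * B) ^ 2 + n * (6 * p * σ ^ 2)) := by
  have hm : Measurable (fun ω => noiseSum ξ n₀ (X · ω) n) :=
    (h.measurable_noiseSum n₀ n).mono (past_le hX _) le_rfl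
  refine lpNorm_le_of_integral_le (by linarith) (by positivity) hm.aestronglyMeasurable ?_
  rw [← Real.norm_of_nonneg (Real.sqrt_nonneg _), ← norm_sq_rpow_half,
    Real.norm_of_nonneg (Real.sqrt_nonneg _), Real.sq_sqrt (by positivity)]
  refine le_trans ?_ (h.integral_noiseSum_rpow_le hX hind hlaw hp n₀ n)
  refine integral_mono_of_nonneg (Filter.Eventually.of_forall fun ω => by positivity) ?_
    (Filter.Eventually.of_forall fun ω => ?_)
  · exact integrable_continuous_comp
      (φ := fun u : E => (‖u‖ ^ 2 + (2 * p * B) ^ 2) ^ (p / 2)) hm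
      ⟨_, fun ω => h.bounded_noiseSum n₀ n _⟩
      (((continuous_norm.pow 2).add continuous_const).rpow_const fun _ => Or.inr (by linarith))
  · simp only
    rw [← norm_sq_rpow_half]
    exact Real.rpow_le_rpow (by positivity) (le_add_of_nonneg_right (by positivity))
      (by linarith)

lemma lpNorm_multSum_le {α p : ℝ} (hp : 2 < p) (e₀ : E) (n₀ : ℕ) {d : ℕ → ℝ}
    (hd : ∀ i, lpNorm (fun ω => chain α A ξ e₀ (X · ω) (n₀ + i)) (ENNReal.ofReal p) ρ ≤ d i)
    (n : ℕ) :
    lpNorm (fun ω => multSum ν α A ξ e₀ n₀ (X · ω) n) (ENNReal.ofReal p) ρ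
      ≤ √(32 * (1 + 2 * p) * ∑ i ∈ Finset.range n, d i ^ 2) := by
  have hp0 : 0 < p := by linarith
  have hm : Measurable (fun ω => multSum ν α A ξ e₀ n₀ (X · ω) n) :=
    (h.measurable_multSum α e₀ n₀ n).mono (past_le hX _) le_rfl
  refine lpNorm_le_of_integral_le hp0 (by positivity) hm.aestronglyMeasurable ?_
  rw [← Real.norm_of_nonneg (Real.sqrt_nonneg _), ← norm_sq_rpow_half,
    Real.norm_of_nonneg (Real.sqrt_nonneg _),
    Real.sq_sqrt (mul_nonneg (by positivity) (Finset.sum_nonneg fun i _ => sq_nonneg _))]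
  exact h.integral_multSum_rpow_le hX hind hlaw hp e₀ n₀ (fun i => lpNorm_nonneg.trans (hd i))
    (fun i => integral_le_of_lpNorm_le hp0
      ((h.measurable_chain α e₀ _).mono (past_le hX _) le_rfl).aestronglyMeasurable (hd i)) n

/-- The `L ^ p` bound for the mean operator applied to a window average of the trajectory. -/
theorem lpNorm_mean_window_le {α p : ℝ} (hα : 0 < α) (hp : 2 < p) (hαp : α * p ≤ κ / 38)
    (e₀ : E) (n₀ n : ℕ) {m : ℝ}
    (hm : m = √((2 * (α * p) * B) ^ 2 + 22 * (α * p) * σ ^ 2 / (κ * lam))) :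
    lpNorm (fun ω => ∫ y, A y ((n : ℝ)⁻¹ • ∑ i ∈ Finset.range n,
        chain α A ξ e₀ (X · ω) (n₀ + i)) ∂ν) (ENNReal.ofReal p) ρ
      ≤ (n : ℝ)⁻¹ * (α⁻¹ * (2 * ((1 - 1 / 2 * α * κ * lam) ^ n₀ * ‖e₀‖ + m))
        + √((2 * p * B) ^ 2 + n * (6 * p * σ ^ 2))
        + √(32 * (1 + 2 * p) * ∑ i ∈ Finset.range n,
            ((1 - 1 / 2 * α * κ * lam) ^ (n₀ + i) * ‖e₀‖ + m) ^ 2)) := by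
  have hκ := h.κ_pos
  have hl := h.lam_pos
  have hκl : κ * lam ≤ 1 := by nlinarith [h.κ_le, h.lam_le, h.lam_pos]
  have hα1 : α ≤ 1 := by nlinarith [h.κ_le]
  have hc0 : 0 ≤ 1 - 1 / 2 * α * κ * lam := by nlinarith
  have hc1 : 1 - 1 / 2 * α * κ * lam ≤ 1 := by
    have : 0 ≤ 1 / 2 * α * κ * lam := by positivity
    linarith
  have hp1 : (1 : ENNReal) ≤ ENNReal.ofReal p := by simpa using by linarith
  simp_rw [h.mean_window_eq hα]
  have hch := h.lpNorm_chain_le hX hind hlaw hα hp hαp e₀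
  rw [← hm] at hch
  have hL : ∀ {f : Ω → E}, Measurable f → (∃ C, ∀ ω, ‖f ω‖ ≤ C) →
      MemLp f (ENNReal.ofReal p) ρ := fun hf ⟨C, hC⟩ =>
    MemLp.of_bound hf.aestronglyMeasurable C (Filter.Eventually.of_forall hC)
  have hLc : ∀ t, MemLp (fun ω => chain α A ξ e₀ (X · ω) t) (ENNReal.ofReal p) ρ := fun t => by
    obtain ⟨C, hC⟩ := h.bounded_chain α e₀ t
    exact hL ((h.measurable_chain α e₀ t).mono (past_le hX _) le_rfl) ⟨C, fun ω => hC _⟩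
  have hLn : MemLp (fun ω => noiseSum ξ n₀ (X · ω) n) (ENNReal.ofReal p) ρ :=
    hL ((h.measurable_noiseSum n₀ n).mono (past_le hX _) le_rfl)
      ⟨_, fun ω => h.bounded_noiseSum n₀ n _⟩
  have e : (fun ω => (n : ℝ)⁻¹ • (α⁻¹ • (chain α A ξ e₀ (X · ω) n₀
        - chain α A ξ e₀ (X · ω) (n₀ + n))
        - noiseSum ξ n₀ (X · ω) n - multSum ν α A ξ e₀ n₀ (X · ω) n))
      = (n : ℝ)⁻¹ • (α⁻¹ • ((fun ω => chain α A ξ e₀ (X · ω) n₀)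
        - (fun ω => chain α A ξ e₀ (X · ω) (n₀ + n)))
        - (fun ω => noiseSum ξ n₀ (X · ω) n)
        - (fun ω => multSum ν α A ξ e₀ n₀ (X · ω) n)) := rfl
  have hLd := ((hLc n₀).sub (hLc (n₀ + n))).const_smul α⁻¹
  rw [e, lpNorm_const_smul, Real.nnnorm_of_nonneg (by positivity)]
  refine mul_le_mul_of_nonneg_left ?_ (by positivity)
  refine (lpNorm_sub_le (hLd.sub hLn) hp1).trans (add_le_add ?_
    (h.lpNorm_multSum_le hX hind hlaw hp e₀ n₀ (fun i => hch (n₀ + i)) n))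
  refine (lpNorm_sub_le hLd hp1).trans (add_le_add ?_ (h.lpNorm_noiseSum_le hX hind hlaw hp n₀ n))
  rw [lpNorm_const_smul, Real.nnnorm_of_nonneg (by positivity)]
  refine mul_le_mul_of_nonneg_left ?_ (by positivity)
  refine (lpNorm_sub_le (hLc n₀) hp1).trans ?_
  have h1 := hch n₀
  have h2 := hch (n₀ + n)
  have h3 : (1 - 1 / 2 * α * κ * lam) ^ (n₀ + n) * ‖e₀‖
      ≤ (1 - 1 / 2 * α * κ * lam) ^ n₀ * ‖e₀‖ :=
    mul_le_mul_of_nonneg_right (pow_le_pow_of_le_one hc0 hc1 (by omega)) (norm_nonneg _)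
  linarith

end IsStableLSA
end TailAverage

/-! ### The categorical projection on the grid -/

section Ramp

/-- The projected CDF profile: `ramp (y - k)` is the mass that the two-point projection of a unit
mass at `y` onto the integer grid puts on `(-∞, k]`. -/
def ramp (u : ℝ) : ℝ := max (min (1 - u) 1) 0

lemma ramp_nonneg (u : ℝ) : 0 ≤ ramp u := le_max_right _ _

lemma ramp_le_one (u : ℝ) : ramp u ≤ 1 := max_le (min_le_right _ _) zero_le_one

lemma ramp_antitone : Antitone ramp := fun u v h => by
  unfold ramp
  gcongr

lemma ramp_natCast_sub (j k : ℕ) : ramp ((j : ℝ) - k) = if j ≤ k then 1 else 0 := by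
  unfold ramp
  split_ifs with h
  · have : (j : ℝ) ≤ k := by exact_mod_cast h
    rw [min_eq_right (by linarith)]; simp
  · have : (k : ℝ) + 1 ≤ j := by exact_mod_cast Nat.lt_of_not_le h
    rw [max_eq_right]
    exact (min_le_left _ _).trans (by linarith)

@[fun_prop]
lemma continuous_ramp : Continuous ramp := by unfold ramp; fun_prop

/-- Partial sums of the hat functions are ramps. -/
lemma sum_hat_eq_ramp {y : ℝ} (hy : 0 ≤ y) (k : ℕ) :
    ∑ i ∈ Finset.range (k + 1), max (1 - |y - i|) 0 = ramp (y - k) := by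
  induction k with
  | zero =>
    simp only [zero_add, Finset.range_one, Finset.sum_singleton, Nat.cast_zero, sub_zero, ramp]
    rw [abs_of_nonneg hy, min_eq_left (by linarith)]
  | succ k ih =>
    rw [Finset.sum_range_succ, ih]
    unfold ramp
    push_cast
    rcases le_total y (k + 1) with h | h
    · rw [abs_of_nonpos (by linarith), min_eq_right (by linarith : (1 : ℝ) ≤ 1 - (y - (k + 1)))]
      rcases le_total y k with h' | h'
      · rw [min_eq_right (by linarith), max_eq_left (by norm_num),
          max_eq_right (by linarith)]
        norm_num
      · rw [min_eq_left (by linarith), max_eq_left (by linarith), max_eq_left (by linarith),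
          max_eq_left (by norm_num)]
        ring
    · rw [abs_of_nonneg (by linarith), min_eq_left (by linarith : 1 - (y - k) ≤ 1),
        max_eq_right (by linarith : 1 - (y - k) ≤ 0),
        min_eq_left (by linarith : 1 - (y - (k + 1)) ≤ 1), zero_add]

lemma sum_ramp {y : ℝ} (hy : 0 ≤ y) (K : ℕ) :
    ∑ k ∈ Finset.range K, ramp (y - k) = max (K - y) 0 := by
  induction K with
  | zero => simp [hy]
  | succ K ih =>
    rw [Finset.sum_range_succ, ih]
    unfold ramp
    push_cast
    rcases le_total y K with h | h
    · rw [max_eq_left (by linarith), min_eq_right (by linarith), max_eq_left (by norm_num),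
        max_eq_left (by linarith)]
      ring
    · rw [max_eq_right (by linarith), min_eq_left (by linarith), zero_add]
      ring_nf

end Ramp

section Coefficients

variable {γ r : ℝ} {K : ℕ}

/-- The position of `r + γ x_j` on the grid, in units of the gap. -/
noncomputable def gridPos (γ : ℝ) (K : ℕ) (r : ℝ) (j : ℕ) : ℝ := r / gap γ K + γ * j

/-- The entry `(k, j)` of the matrix `C G̃(r) C⁻¹`, see `cumMatrix_conj_GTilde`. -/
noncomputable def transEntry (γ : ℝ) (K : ℕ) (r : ℝ) (k j : ℕ) : ℝ :=
  ramp (gridPos γ K r j - k) - ramp (gridPos γ K r (j + 1) - k)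

lemma gap_pos (hγ : γ < 1) (hK : 0 < K) : 0 < gap γ K := by
  unfold gap
  have : 0 < 1 - γ := by linarith
  positivity

lemma gCoef_eq (hg : 0 < gap γ K) (j k : ℕ) :
    gCoef γ K j k r = max (1 - |gridPos γ K r j - k|) 0 := by
  unfold gCoef gridPos atom
  congr 3
  field_simp

lemma gridPos_nonneg (hg : 0 < gap γ K) (hγ : 0 ≤ γ) (hr : 0 ≤ r) (j : ℕ) :
    0 ≤ gridPos γ K r j := by unfold gridPos; positivity

lemma gridPos_succ (j : ℕ) : gridPos γ K r (j + 1) = gridPos γ K r j + γ := by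
  unfold gridPos; push_cast; ring

lemma sum_gCoef (hg : 0 < gap γ K) (hγ : 0 ≤ γ) (hr : 0 ≤ r) (j k : ℕ) :
    ∑ i ∈ Finset.range (k + 1), gCoef γ K j i r = ramp (gridPos γ K r j - k) := by
  simp_rw [gCoef_eq hg]
  exact sum_hat_eq_ramp (gridPos_nonneg hg hγ hr j) k

lemma transEntry_nonneg (hγ : 0 ≤ γ) (k j : ℕ) : 0 ≤ transEntry γ K r k j := by
  unfold transEntry
  rw [gridPos_succ, sub_nonneg]
  exact ramp_antitone (by linarith)

lemma sum_transEntry_row (k : ℕ) : ∑ j ∈ Finset.range K, transEntry γ K r k j ≤ 1 := by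
  unfold transEntry
  rw [Finset.sum_range_sub' (fun j => ramp (gridPos γ K r j - k))]
  linarith [ramp_le_one (gridPos γ K r 0 - k), ramp_nonneg (gridPos γ K r K - k)]

/-- The column sum telescopes to `(K - y)₊ - (K - y - γ)₊`, where `y` is the grid position. -/
lemma sum_transEntry_col (hg : 0 < gap γ K) (hγ : 0 ≤ γ) (hr : 0 ≤ r) (j : ℕ) :
    ∑ k ∈ Finset.range K, transEntry γ K r k j ≤ γ := by
  unfold transEntry
  rw [Finset.sum_sub_distrib, sum_ramp (gridPos_nonneg hg hγ hr j),
    sum_ramp (gridPos_nonneg hg hγ hr _), gridPos_succ]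
  have := le_max_left (K - (gridPos γ K r j + γ)) 0
  have := le_max_right (K - (gridPos γ K r j + γ)) 0
  rw [sub_le_iff_le_add]
  exact max_le (by linarith) (by linarith)

/-- Schur's test: `C G̃(r) C⁻¹` has nonnegative entries, row sums at most `1` and column sums at
most `γ`, hence operator norm at most `√γ`. -/
lemma sum_sq_transEntry_le (hg : 0 < gap γ K) (hγ : 0 ≤ γ) (hr : 0 ≤ r) (w : Fin K → ℝ) :
    ∑ k : Fin K, (∑ j : Fin K, transEntry γ K r k j * w j) ^ 2 ≤ γ * ∑ j, w j ^ 2 := by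
  have h1 : ∀ k : Fin K, (∑ j : Fin K, transEntry γ K r k j * w j) ^ 2
      ≤ ∑ j : Fin K, transEntry γ K r k j * w j ^ 2 := fun k => by
    have hs : ∑ j : Fin K, transEntry γ K r k j ≤ 1 := by
      rw [Fin.sum_univ_eq_sum_range (fun j => transEntry γ K r k j)]
      exact sum_transEntry_row k
    have hn : 0 ≤ ∑ j : Fin K, transEntry γ K r k j * w j ^ 2 :=
      Finset.sum_nonneg fun j _ => mul_nonneg (transEntry_nonneg hγ _ _) (sq_nonneg _)
    have := Finset.sum_sq_le_sum_mul_sum_of_sq_le_mul Finset.univ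
      (r := fun j : Fin K => transEntry γ K r k j * w j)
      (f := fun j : Fin K => transEntry γ K r k j)
      (g := fun j : Fin K => transEntry γ K r k j * w j ^ 2)
      (fun j _ => transEntry_nonneg hγ _ _)
      (fun j _ => mul_nonneg (transEntry_nonneg hγ _ _) (sq_nonneg _))
      (fun j _ => le_of_eq (by ring))
    nlinarith
  calc _ ≤ ∑ k : Fin K, ∑ j : Fin K, transEntry γ K r k j * w j ^ 2 :=
        Finset.sum_le_sum fun k _ => h1 k
    _ = ∑ j : Fin K, (∑ k : Fin K, transEntry γ K r k j) * w j ^ 2 := by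
        rw [Finset.sum_comm]; simp_rw [Finset.sum_mul]
    _ ≤ ∑ j : Fin K, γ * w j ^ 2 := by
        refine Finset.sum_le_sum fun j _ => mul_le_mul_of_nonneg_right ?_ (sq_nonneg _)
        rw [Fin.sum_univ_eq_sum_range (fun k => transEntry γ K r k j)]
        exact sum_transEntry_col hg hγ hr j
    _ = _ := by rw [Finset.mul_sum]

lemma isUnit_det_cumMatrix (K : ℕ) : IsUnit (cumMatrix K).det := by
  rw [Matrix.det_of_isLowerTriangular]
  · simp [cumMatrix]
  · intro i j hij
    have : ¬ j ≤ i := not_le.2 hij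
    simp [cumMatrix, this]

lemma sum_range_ite_le {k K : ℕ} (hk : k < K) (a : ℕ → ℝ) :
    ∑ i ∈ Finset.range K, (if i ≤ k then a i else 0) = ∑ i ∈ Finset.range (k + 1), a i := by
  rw [← Finset.sum_filter]
  congr 1
  ext i
  simp only [Finset.mem_filter, Finset.mem_range]
  omega

lemma cumMatrix_mulVec (v : ℕ → ℝ) (k : Fin K) :
    (cumMatrix K *ᵥ fun i => v i) k = ∑ i ∈ Finset.range (k + 1), v i := by
  simp only [Matrix.mulVec, dotProduct, cumMatrix, Matrix.of_apply, ite_mul, one_mul, zero_mul]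
  rw [← sum_range_ite_le k.2,
    ← Fin.sum_univ_eq_sum_range (fun i => if i ≤ (k : ℕ) then v i else 0)]
  simp only [Fin.le_def]

lemma cumMatrix_mul_GTilde (hg : 0 < gap γ K) (hγ : 0 ≤ γ) (hr : 0 ≤ r) (k j : Fin K) :
    (cumMatrix K * GTilde γ K r) k j
      = ramp (gridPos γ K r j - k) - ramp (gridPos γ K r K - k) := by
  have := cumMatrix_mulVec (fun i => gCoef γ K j i r - gCoef γ K K i r) k
  rw [Finset.sum_sub_distrib, sum_gCoef hg hγ hr, sum_gCoef hg hγ hr] at this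
  rw [← this]
  rfl

lemma sum_range_ite_sub {j n : ℕ} (h : j ≤ n) (f : ℕ → ℝ) :
    ∑ i ∈ Finset.range n, (f i - f (i + 1)) * (if j ≤ i then 1 else 0) = f j - f n := by
  induction n, h using Nat.le_induction with
  | base =>
    rw [sub_self]
    refine Finset.sum_eq_zero fun i hi => ?_
    rw [if_neg (by have := Finset.mem_range.1 hi; omega), mul_zero]
  | succ n hn ih =>
    rw [Finset.sum_range_succ, ih, if_pos hn]; ring

lemma cumMatrix_conj_GTilde (hg : 0 < gap γ K) (hγ : 0 ≤ γ) (hr : 0 ≤ r) :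
    cumMatrix K * GTilde γ K r * (cumMatrix K)⁻¹
      = Matrix.of fun k j : Fin K => transEntry γ K r k j := by
  have h : cumMatrix K * GTilde γ K r
      = (Matrix.of fun k j : Fin K => transEntry γ K r k j) * cumMatrix K := by
    ext k j
    rw [cumMatrix_mul_GTilde hg hγ hr, Matrix.mul_apply]
    simp only [Matrix.of_apply, cumMatrix, transEntry, Fin.le_def]
    rw [Fin.sum_univ_eq_sum_range (fun i => (ramp (gridPos γ K r i - k)
      - ramp (gridPos γ K r (i + 1) - k)) * (if (j : ℕ) ≤ i then 1 else 0))]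
    exact (sum_range_ite_sub j.2.le (fun i => ramp (gridPos γ K r i - k))).symm
  rw [h, Matrix.mul_assoc, Matrix.mul_nonsing_inv _ (isUnit_det_cumMatrix K), Matrix.mul_one]

/-- `∑_j` of the projected CDFs of the points `r + γ x_j` at `x_k`, compared with its value
`k + 1` for the undisturbed grid. -/
lemma abs_sum_ramp_sub_le (hγ : γ ≤ 1) (hK : 1 ≤ K * (1 - γ)) (hr0 : 0 ≤ r) (hr1 : r ≤ 1)
    (k : ℕ) (hk : k < K) :
    |∑ j ∈ Finset.range (K + 1), ramp (gridPos γ K r j - k) - (k + 1)| ≤ 2 * (K * (1 - γ)) := by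
  set Δ : ℝ := K * (1 - γ) with hΔ
  have hpos : ∀ j, gridPos γ K r j = r * Δ + γ * j := fun j => by
    unfold gridPos gap
    rw [div_inv_eq_mul]
  -- The points `r Δ + γ j` lie between `j - Δ` and `j + Δ`, so at least `k + 1 - D` and at most
  -- `k + 1 + D` of them count towards the sum.
  set D := ⌈Δ⌉₊ with hD
  have hD1 : Δ ≤ D := Nat.le_ceil Δ
  have hD2 : (D : ℝ) < Δ + 1 := Nat.ceil_lt_add_one (by linarith)
  have up : ∑ j ∈ Finset.range (K + 1), ramp (gridPos γ K r j - k) ≤ k + D + 1 := by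
    calc _ ≤ ∑ j ∈ Finset.range (K + 1), if j ≤ k + D then (1 : ℝ) else 0 := by
          refine Finset.sum_le_sum fun j hj => ?_
          rw [← ramp_natCast_sub]
          refine ramp_antitone ?_
          have hj' : (j : ℝ) ≤ K := by exact_mod_cast Nat.lt_succ_iff.1 (Finset.mem_range.1 hj)
          rw [hpos]
          push_cast
          have : (1 - γ) * j ≤ (1 - γ) * K := by gcongr
          have : 0 ≤ r * Δ := mul_nonneg hr0 (by linarith)
          nlinarith
      _ ≤ ∑ j ∈ Finset.range (k + D + 1), (1 : ℝ) := by
          rw [← Finset.sum_filter]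
          refine Finset.sum_le_sum_of_subset_of_nonneg (fun j hj => ?_)
            fun _ _ _ => zero_le_one
          have := (Finset.mem_filter.1 hj).2
          exact Finset.mem_range.2 (by omega)
      _ = _ := by simp
  have low : (k : ℝ) + 1 - D ≤ ∑ j ∈ Finset.range (K + 1), ramp (gridPos γ K r j - k) := by
    calc (k : ℝ) + 1 - D ≤ ∑ j ∈ Finset.range (k + 1 - D), (1 : ℝ) := by
          simp only [Finset.sum_const, Finset.card_range, nsmul_eq_mul, mul_one]
          rw [sub_le_iff_le_add]
          exact_mod_cast (by omega : k + 1 ≤ k + 1 - D + D)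
      _ ≤ ∑ j ∈ Finset.range (K + 1), if j + D ≤ k then (1 : ℝ) else 0 := by
          rw [← Finset.sum_filter]
          refine Finset.sum_le_sum_of_subset_of_nonneg (fun j hj => ?_)
            fun _ _ _ => zero_le_one
          have := Finset.mem_range.1 hj
          exact Finset.mem_filter.2 ⟨Finset.mem_range.2 (by omega), by omega⟩
      _ ≤ _ := by
          refine Finset.sum_le_sum fun j hj => ?_
          rw [← ramp_natCast_sub]
          refine ramp_antitone ?_
          rw [hpos]
          push_cast
          have : r * Δ ≤ 1 * Δ := by gcongr
          have : γ * j ≤ 1 * (j : ℝ) := by gcongr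
          linarith
  rw [abs_le]
  constructor <;> linarith

end Coefficients

/-! ### Features, samples and coercivity of the mean operator -/

section Features

variable {S A : Type*} [MeasurableSpace S] [MeasurableSpace A] {d K : ℕ} {γ : ℝ}
  {φ : S → EuclideanSpace ℝ (Fin d)} {π : Kernel S A} {P : Kernel (S × A) (ℝ × S)}
  {μ : Measure S}

/-- The feature products `φ(s)ᵀ u(k)`. -/
noncomputable def feat (φ : S → EuclideanSpace ℝ (Fin d)) (u : Param d K) (s : S)
    (k : Fin K) : ℝ :=
  ∑ i, φ s i * u (k, i)

/-- The squared norm of the vector `(φ(s)ᵀ u(k))_k`. -/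
noncomputable def featSq (φ : S → EuclideanSpace ℝ (Fin d)) (u : Param d K) (s : S) : ℝ :=
  ∑ k, feat φ u s k ^ 2

/-- The quadratic form `uᵀ (I_K ⊗ Σ_φ) u`, written as an expectation. -/
noncomputable def covSq (μ : Measure S) (φ : S → EuclideanSpace ℝ (Fin d)) (u : Param d K) : ℝ :=
  ∫ s, featSq φ u s ∂μ

lemma featSq_nonneg (u : Param d K) (s : S) : 0 ≤ featSq φ u s :=
  Finset.sum_nonneg fun _ _ => sq_nonneg _

lemma norm_sq_param (u : Param d K) : ‖u‖ ^ 2 = ∑ k, ∑ i, u (k, i) ^ 2 := by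
  rw [EuclideanSpace.norm_sq_eq, Fintype.sum_prod_type]
  simp

lemma norm_sq_feature (s : S) : ‖φ s‖ ^ 2 = ∑ i, φ s i ^ 2 := by
  rw [EuclideanSpace.norm_sq_eq]; simp

lemma feat_sq_le (hφ1 : ∀ s, ‖φ s‖ ≤ 1) (u : Param d K) (s : S) (k : Fin K) :
    feat φ u s k ^ 2 ≤ ∑ i, u (k, i) ^ 2 := by
  have h := Finset.sum_mul_sq_le_sq_mul_sq Finset.univ (fun i => φ s i) (fun i => u (k, i))
  rw [← norm_sq_feature] at h
  have h1 : ‖φ s‖ ^ 2 ≤ 1 := by nlinarith [hφ1 s, norm_nonneg (φ s)]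
  have h2 : 0 ≤ ∑ i, u (k, i) ^ 2 := Finset.sum_nonneg fun _ _ => sq_nonneg _
  unfold feat
  nlinarith

lemma featSq_le (hφ1 : ∀ s, ‖φ s‖ ≤ 1) (u : Param d K) (s : S) : featSq φ u s ≤ ‖u‖ ^ 2 := by
  rw [norm_sq_param]
  exact Finset.sum_le_sum fun k _ => feat_sq_le hφ1 u s k

lemma abs_feat_le (hφ1 : ∀ s, ‖φ s‖ ≤ 1) (u : Param d K) (s : S) (k : Fin K) :
    |feat φ u s k| ≤ ‖u‖ := by
  refine abs_le_of_sq_le_sq ?_ (norm_nonneg _)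
  refine le_trans ?_ (featSq_le hφ1 u s)
  exact Finset.single_le_sum (f := fun k => feat φ u s k ^ 2) (fun k _ => sq_nonneg _)
    (Finset.mem_univ k)

lemma feat_add (u v : Param d K) (s : S) (k : Fin K) :
    feat φ (u + v) s k = feat φ u s k + feat φ v s k := by
  simp [feat, mul_add, Finset.sum_add_distrib]

lemma feat_sub (u v : Param d K) (s : S) (k : Fin K) :
    feat φ (u - v) s k = feat φ u s k - feat φ v s k := by
  simp [feat, mul_sub, Finset.sum_sub_distrib]

lemma measurable_feature_apply (hφ : Measurable φ) (i : Fin d) : Measurable fun s => φ s i :=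
  (EuclideanSpace.proj (𝕜 := ℝ) i).continuous.measurable.comp hφ

lemma measurable_feat_prod (hφ : Measurable φ) (k : Fin K) :
    Measurable fun q : Param d K × S => feat φ q.1 q.2 k := by
  unfold feat
  refine Finset.measurable_fun_sum _ fun i _ => ?_
  exact ((measurable_feature_apply hφ i).comp measurable_snd).mul
    (((EuclideanSpace.proj (𝕜 := ℝ) (k, i)).continuous.measurable).comp measurable_fst)

lemma measurable_feat (hφ : Measurable φ) (u : Param d K) (k : Fin K) :
    Measurable fun s => feat φ u s k :=
  (measurable_feat_prod hφ k).comp measurable_prodMk_left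

lemma measurable_featSq (hφ : Measurable φ) (u : Param d K) : Measurable (featSq φ u) :=
  Finset.measurable_fun_sum _ fun k _ => (measurable_feat hφ u k).pow_const 2

lemma integrable_featSq [IsProbabilityMeasure μ] (hφ : Measurable φ) (hφ1 : ∀ s, ‖φ s‖ ≤ 1)
    (u : Param d K) : Integrable (featSq φ u) μ :=
  integrable_of_norm_le (measurable_featSq hφ u) _ fun s => by
    rw [Real.norm_of_nonneg (featSq_nonneg u s)]; exact featSq_le hφ1 u s

/-- The quadratic form of the feature covariance. -/
lemma dotProduct_featureCov [IsProbabilityMeasure μ] (hφ : Measurable φ)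
    (hφ1 : ∀ s, ‖φ s‖ ≤ 1) (v : Fin d → ℝ) :
    v ⬝ᵥ (featureCov μ φ *ᵥ v) = ∫ s, (∑ i, φ s i * v i) ^ 2 ∂μ := by
  have hb : ∀ i s, |φ s i| ≤ 1 := fun i s => by
    have := EuclideanSpace.norm_eq (φ s)
    have h2 : φ s i ^ 2 ≤ ‖φ s‖ ^ 2 := by
      rw [norm_sq_feature]
      exact Finset.single_le_sum (f := fun i => φ s i ^ 2) (fun k _ => sq_nonneg _)
        (Finset.mem_univ i)
    exact (abs_le_of_sq_le_sq h2 (norm_nonneg _)).trans (hφ1 s)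
  have hint : ∀ i j, Integrable (fun s => φ s i * φ s j) μ := fun i j =>
    integrable_of_norm_le ((measurable_feature_apply hφ i).mul (measurable_feature_apply hφ j)) 1
      fun s => by
        rw [norm_mul, Real.norm_eq_abs, Real.norm_eq_abs]
        exact mul_le_one₀ (hb i s) (abs_nonneg _) (hb j s)
  have e : ∀ s, (∑ i, φ s i * v i) ^ 2 = ∑ i, ∑ j, (v i * v j) * (φ s i * φ s j) := fun s => by
    rw [sq, Finset.sum_mul_sum]
    exact Finset.sum_congr rfl fun i _ => Finset.sum_congr rfl fun j _ => by ring
  simp_rw [e]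
  rw [integral_finsetSum _ fun i _ => integrable_finsetSum _ fun j _ => (hint i j).const_mul _]
  simp only [dotProduct, Matrix.mulVec, featureCov, Matrix.of_apply, Finset.mul_sum]
  refine Finset.sum_congr rfl fun i _ => ?_
  rw [integral_finsetSum _ fun j _ => (hint i j).const_mul _]
  refine Finset.sum_congr rfl fun j _ => ?_
  rw [integral_const_mul]; ring

lemma covSq_eq_sum [IsProbabilityMeasure μ] (hφ : Measurable φ) (hφ1 : ∀ s, ‖φ s‖ ≤ 1)
    (u : Param d K) :
    covSq μ φ u = ∑ k, (fun i => u (k, i)) ⬝ᵥ (featureCov μ φ *ᵥ fun i => u (k, i)) := by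
  unfold covSq featSq
  rw [integral_finsetSum]
  · exact Finset.sum_congr rfl fun k _ => (dotProduct_featureCov hφ hφ1 _).symm
  · intro k _
    refine integrable_of_norm_le ((measurable_feat hφ u k).pow_const 2) (‖u‖ ^ 2) fun s => ?_
    rw [norm_pow, Real.norm_eq_abs]
    exact pow_le_pow_left₀ (abs_nonneg _) (abs_feat_le hφ1 u s k) 2

lemma covNorm_eq [IsProbabilityMeasure μ] (hφ : Measurable φ) (hφ1 : ∀ s, ‖φ s‖ ≤ 1)
    (u : Param d K) : covNorm μ φ u = √(covSq μ φ u) := by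
  rw [covSq_eq_sum hφ hφ1, covNorm]
  congr 1
  simp only [dotProduct, Matrix.mulVec, Fintype.sum_prod_type, Matrix.kroneckerMap_apply,
    Matrix.one_apply, ite_mul, one_mul, zero_mul]
  refine Finset.sum_congr rfl fun k _ => Finset.sum_congr rfl fun i _ => ?_
  congr 1
  rw [Finset.sum_eq_single k]
  · simp
  · intro l _ hl
    simp [hl.symm]
  · simp

lemma covSq_nonneg (u : Param d K) : 0 ≤ covSq μ φ u :=
  integral_nonneg fun s => featSq_nonneg u s

lemma covSq_le [IsProbabilityMeasure μ] (hφ : Measurable φ) (hφ1 : ∀ s, ‖φ s‖ ≤ 1)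
    (u : Param d K) : covSq μ φ u ≤ ‖u‖ ^ 2 := by
  calc covSq μ φ u ≤ ∫ _, ‖u‖ ^ 2 ∂μ :=
        integral_mono (integrable_featSq hφ hφ1 u) (integrable_const _) fun s => featSq_le hφ1 u s
    _ = _ := by simp

lemma lambdaMin_pos (hd : 0 < d) (hpos : (featureCov μ φ).PosDef) : 0 < lambdaMin μ φ := by
  have : Nonempty (Fin d) := ⟨⟨0, hd⟩⟩
  have hs := hpos.1.spectrum_real_eq_range_eigenvalues
  have hmem : lambdaMin μ φ ∈ spectrum ℝ (featureCov μ φ) :=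
    Set.Nonempty.csInf_mem (by rw [hs]; exact Set.range_nonempty _)
      (Matrix.finite_real_spectrum)
  rw [hs] at hmem
  obtain ⟨i, hi⟩ := hmem
  rw [← hi]
  exact hpos.eigenvalues_pos i

lemma lambdaMin_mul_le (hpos : (featureCov μ φ).PosDef) (v : Fin d → ℝ) :
    lambdaMin μ φ * ∑ i, v i ^ 2 ≤ v ⬝ᵥ (featureCov μ φ *ᵥ v) := by
  have hps : (featureCov μ φ - algebraMap ℝ (Matrix (Fin d) (Fin d) ℝ)
      (lambdaMin μ φ)).PosSemidef := by
    rw [Matrix.posSemidef_iff_isHermitian_and_spectrum_nonneg]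
    refine ⟨hpos.1.sub ?_, ?_⟩
    · rw [Matrix.algebraMap_eq_diagonal]
      exact Matrix.isHermitian_diagonal _
    · rw [← spectrum.sub_singleton_eq]
      rintro _ ⟨x, hx, y, hy, rfl⟩
      rw [Set.mem_singleton_iff] at hy
      subst hy
      exact sub_nonneg.2 (csInf_le Matrix.finite_real_spectrum.bddBelow hx)
  have h := hps.dotProduct_mulVec_nonneg v
  rw [Matrix.sub_mulVec, dotProduct_sub, Matrix.algebraMap_eq_diagonal] at h
  have e : star v ⬝ᵥ ((Matrix.diagonal (algebraMap ℝ (Fin d → ℝ) (lambdaMin μ φ))) *ᵥ v)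
      = lambdaMin μ φ * ∑ i, v i ^ 2 := by
    simp only [dotProduct, Matrix.mulVec_diagonal, Finset.mul_sum]
    exact Finset.sum_congr rfl fun i _ => by simp; ring
  rw [e] at h
  simpa using h

lemma lambdaMin_mul_norm_sq_le [IsProbabilityMeasure μ] (hφ : Measurable φ)
    (hφ1 : ∀ s, ‖φ s‖ ≤ 1) (hpos : (featureCov μ φ).PosDef) (u : Param d K) :
    lambdaMin μ φ * ‖u‖ ^ 2 ≤ covSq μ φ u := by
  rw [covSq_eq_sum hφ hφ1, norm_sq_param, Finset.mul_sum]
  exact Finset.sum_le_sum fun k _ => lambdaMin_mul_le hpos _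

lemma lambdaMin_le_one [IsProbabilityMeasure μ] (hd : 0 < d) (hφ : Measurable φ)
    (hφ1 : ∀ s, ‖φ s‖ ≤ 1) (hpos : (featureCov μ φ).PosDef) : lambdaMin μ φ ≤ 1 := by
  set u : Param d 1 := EuclideanSpace.single (0, ⟨0, hd⟩) 1
  have h1 := lambdaMin_mul_norm_sq_le (K := 1) hφ hφ1 hpos u
  have h2 := covSq_le (K := 1) (μ := μ) hφ hφ1 u
  have h3 : ‖u‖ = 1 := by simp [u]
  rw [h3] at h1 h2
  linarith

end Features

section Samples

variable {S A : Type*} [MeasurableSpace S] [MeasurableSpace A] {d K : ℕ} {γ : ℝ}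
  {φ : S → EuclideanSpace ℝ (Fin d)} {π : Kernel S A} {P : Kernel (S × A) (ℝ × S)}
  {μ : Measure S}

/-- A sample with its reward clipped to `[0, 1]`; almost surely nothing changes, but bounds hold
everywhere for clipped rewards. -/
def clipReward (x : S × A × ℝ × S) : S × A × ℝ × S :=
  (x.1, x.2.1, max 0 (min x.2.2.1 1), x.2.2.2)

/-- The random operator of the recursion, at the sample with clipped reward. -/
noncomputable def tdOp (γ : ℝ) (K : ℕ) (φ : S → EuclideanSpace ℝ (Fin d)) (x : S × A × ℝ × S) :
    Param d K →ₗ[ℝ] Param d K :=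
  Matrix.toEuclideanLin (sampleA γ K φ (clipReward x))

/-- The random right-hand side of the recursion, at the sample with clipped reward. -/
noncomputable def tdVec (γ : ℝ) (K : ℕ) (φ : S → EuclideanSpace ℝ (Fin d)) (x : S × A × ℝ × S) :
    Param d K :=
  WithLp.toLp 2 (sampleB γ K φ (clipReward x))

/-- The coordinates of the random operator before multiplication with the feature `φ(s)`. -/
noncomputable def tdCoord (γ : ℝ) (φ : S → EuclideanSpace ℝ (Fin d)) (u : Param d K)
    (x : S × A × ℝ × S) (k : Fin K) : ℝ :=
  feat φ u x.1 k - ∑ j : Fin K, transEntry γ K x.2.2.1 k j * feat φ u x.2.2.2 j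

/-- The coordinates of the random right-hand side before multiplication with the feature. -/
noncomputable def tdShift (γ : ℝ) (K : ℕ) (r : ℝ) (k : ℕ) : ℝ :=
  ((K : ℝ) + 1)⁻¹ * (∑ j ∈ Finset.range (K + 1), ramp (gridPos γ K r j - k) - (k + 1))

lemma clipReward_mem (x : S × A × ℝ × S) : (clipReward x).2.2.1 ∈ Set.Icc (0 : ℝ) 1 :=
  ⟨le_max_left _ _, max_le zero_le_one (min_le_right _ _)⟩

lemma clipReward_eq {x : S × A × ℝ × S} (hx : x.2.2.1 ∈ Set.Icc (0 : ℝ) 1) :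
    clipReward x = x := by
  obtain ⟨s, a, r, s'⟩ := x
  simp only [clipReward]
  rw [min_eq_left hx.2, max_eq_right hx.1]

lemma measurable_clipReward : Measurable (clipReward : S × A × ℝ × S → S × A × ℝ × S) := by
  unfold clipReward
  fun_prop

lemma sampleA_mulVec (hg : 0 < gap γ K) (hγ : 0 ≤ γ) {x : S × A × ℝ × S} (hr : 0 ≤ x.2.2.1)
    (u : Param d K) (ki : Fin K × Fin d) :
    (sampleA γ K φ x *ᵥ u.ofLp) ki = φ x.1 ki.2 * tdCoord γ φ u x ki.1 := by
  obtain ⟨k, i⟩ := ki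
  rw [sampleA, cumMatrix_conj_GTilde hg hγ hr, Matrix.sub_mulVec]
  simp only [Pi.sub_apply, Matrix.mulVec, dotProduct, Fintype.sum_prod_type,
    Matrix.kroneckerMap_apply, Matrix.one_apply, Matrix.vecMulVec_apply, Matrix.of_apply,
    tdCoord, feat, mul_sub, Finset.mul_sum, ite_mul, one_mul, zero_mul]
  congr 1
  · rw [Finset.sum_eq_single k]
    · simp [mul_assoc]
    · intro l _ hl
      simp [hl.symm]
    · simp
  · exact Finset.sum_congr rfl fun j _ => Finset.sum_congr rfl fun l _ => by ring

lemma sampleB_apply (hg : 0 < gap γ K) (hγ : 0 ≤ γ) {x : S × A × ℝ × S} (hr : 0 ≤ x.2.2.1)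
    (ki : Fin K × Fin d) :
    sampleB γ K φ x ki = φ x.1 ki.2 * tdShift γ K x.2.2.1 ki.1 := by
  rw [sampleB, cumMatrix_mulVec (fun k => (∑ j ∈ Finset.range (K + 1), gCoef γ K j k x.2.2.1) - 1),
    Finset.sum_sub_distrib, Finset.sum_comm, tdShift]
  simp_rw [sum_gCoef hg hγ hr]
  simp
  ring

lemma tdOp_apply (hg : 0 < gap γ K) (hγ : 0 ≤ γ) (x : S × A × ℝ × S) (u : Param d K)
    (ki : Fin K × Fin d) :
    tdOp γ K φ x u ki = φ x.1 ki.2 * tdCoord γ φ u (clipReward x) ki.1 := by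
  rw [tdOp, Matrix.toLpLin_apply]
  exact sampleA_mulVec hg hγ (clipReward_mem x).1 u ki

lemma tdVec_apply (hg : 0 < gap γ K) (hγ : 0 ≤ γ) (x : S × A × ℝ × S) (ki : Fin K × Fin d) :
    tdVec γ K φ x ki = φ x.1 ki.2 * tdShift γ K (clipReward x).2.2.1 ki.1 :=
  sampleB_apply hg hγ (clipReward_mem x).1 ki

lemma norm_sq_of_coord {x : S × A × ℝ × S} {v : Param d K} {c : Fin K → ℝ}
    (hφ1 : ∀ s, ‖φ s‖ ≤ 1) (hv : ∀ ki, v ki = φ x.1 ki.2 * c ki.1) :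
    ‖v‖ ^ 2 ≤ ∑ k, c k ^ 2 := by
  rw [norm_sq_param]
  refine Finset.sum_le_sum fun k _ => ?_
  simp_rw [hv, mul_pow]
  rw [← Finset.sum_mul, ← norm_sq_feature]
  have : ‖φ x.1‖ ^ 2 ≤ 1 := by nlinarith [hφ1 x.1, norm_nonneg (φ x.1)]
  nlinarith [sq_nonneg (c k)]

lemma inner_of_coord {x : S × A × ℝ × S} {u v : Param d K} {c : Fin K → ℝ}
    (hv : ∀ ki, v ki = φ x.1 ki.2 * c ki.1) : inner ℝ u v = ∑ k, feat φ u x.1 k * c k := by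
  rw [PiLp.inner_apply, Fintype.sum_prod_type]
  refine Finset.sum_congr rfl fun k _ => ?_
  rw [feat, Finset.sum_mul]
  refine Finset.sum_congr rfl fun i _ => ?_
  rw [hv]
  simp only [RCLike.inner_apply, conj_trivial]
  ring

lemma sum_sq_trans_feat_le (hg : 0 < gap γ K) (hγ : 0 ≤ γ) {r : ℝ} (hr : 0 ≤ r)
    (u : Param d K) (s : S) :
    ∑ k : Fin K, (∑ j : Fin K, transEntry γ K r k j * feat φ u s j) ^ 2 ≤ γ * featSq φ u s :=
  sum_sq_transEntry_le hg hγ hr _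

lemma norm_sq_tdOp_le (hg : 0 < gap γ K) (hγ : 0 ≤ γ) (hγ1 : γ ≤ 1) (hφ1 : ∀ s, ‖φ s‖ ≤ 1)
    (x : S × A × ℝ × S) (u : Param d K) :
    ‖tdOp γ K φ x u‖ ^ 2 ≤ 2 * featSq φ u x.1 + 2 * featSq φ u x.2.2.2 := by
  refine (norm_sq_of_coord hφ1 (tdOp_apply hg hγ x u)).trans ?_
  have h := sum_sq_trans_feat_le (φ := φ) hg hγ (clipReward_mem x).1 u x.2.2.2
  have h0 := featSq_nonneg (φ := φ) u x.2.2.2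
  calc ∑ k, tdCoord γ φ u (clipReward x) k ^ 2
      ≤ ∑ k, (2 * feat φ u x.1 k ^ 2 + 2 * (∑ j : Fin K,
          transEntry γ K (clipReward x).2.2.1 k j * feat φ u x.2.2.2 j) ^ 2) := by
        refine Finset.sum_le_sum fun k _ => ?_
        simp only [tdCoord]
        change (feat φ u (clipReward x).1 k - _) ^ 2 ≤ 2 * feat φ u (clipReward x).1 k ^ 2 +
          2 * (∑ j : Fin K,
            transEntry γ K (clipReward x).2.2.1 k j * feat φ u (clipReward x).2.2.2 j) ^ 2
        nlinarith [sq_nonneg (feat φ u (clipReward x).1 k + ∑ j : Fin K,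
          transEntry γ K (clipReward x).2.2.1 k j * feat φ u (clipReward x).2.2.2 j)]
    _ = 2 * featSq φ u x.1 + 2 * ∑ k : Fin K, (∑ j : Fin K,
          transEntry γ K (clipReward x).2.2.1 k j * feat φ u x.2.2.2 j) ^ 2 := by
        rw [Finset.sum_add_distrib, ← Finset.mul_sum, ← Finset.mul_sum, featSq]
    _ ≤ _ := by nlinarith

lemma norm_tdOp_le (hg : 0 < gap γ K) (hγ : 0 ≤ γ) (hγ1 : γ ≤ 1) (hφ1 : ∀ s, ‖φ s‖ ≤ 1)
    (x : S × A × ℝ × S) (u : Param d K) : ‖tdOp γ K φ x u‖ ≤ 2 * ‖u‖ := by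
  refine le_of_sq_le_sq ?_ (by positivity)
  have h1 := norm_sq_tdOp_le hg hγ hγ1 hφ1 x u
  have h2 := featSq_le hφ1 u x.1
  have h3 := featSq_le hφ1 u x.2.2.2
  nlinarith

/-- Young's inequality with weight `√γ` for the cross term `⟨f(s), C G̃(r) C⁻¹ f(s')⟩`, where
`f(s) = (φ(s)ᵀ u(k))_k`. -/
lemma le_inner_tdOp (hg : 0 < gap γ K) (hγ : 0 < γ) (x : S × A × ℝ × S) (u : Param d K) :
    featSq φ u x.1 - √γ / 2 * (featSq φ u x.1 + featSq φ u x.2.2.2)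
      ≤ inner ℝ u (tdOp γ K φ x u) := by
  rw [inner_of_coord (tdOp_apply hg hγ.le x u)]
  have h := sum_sq_trans_feat_le (φ := φ) hg hγ.le (clipReward_mem x).1 u x.2.2.2
  set w : Fin K → ℝ := fun k => ∑ j : Fin K,
    transEntry γ K (clipReward x).2.2.1 k j * feat φ u x.2.2.2 j with hw
  have hs : 0 < √γ := Real.sqrt_pos.2 hγ
  have hss : √γ ^ 2 = γ := Real.sq_sqrt hγ.le
  have e : ∑ k, feat φ u x.1 k * tdCoord γ φ u (clipReward x) k
      = featSq φ u x.1 - ∑ k, feat φ u x.1 k * w k := by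
    rw [featSq, ← Finset.sum_sub_distrib]
    refine Finset.sum_congr rfl fun k _ => ?_
    simp only [tdCoord, hw, clipReward]
    ring
  rw [e]
  have h2 : ∑ k, feat φ u x.1 k * w k ≤ √γ / 2 * featSq φ u x.1 + (2 * √γ)⁻¹ * ∑ k, w k ^ 2 := by
    rw [featSq, Finset.mul_sum, Finset.mul_sum, ← Finset.sum_add_distrib]
    refine Finset.sum_le_sum fun k _ => ?_
    have h3 : √γ / 2 * feat φ u x.1 k ^ 2 + (2 * √γ)⁻¹ * w k ^ 2 - feat φ u x.1 k * w k
        = (2 * √γ)⁻¹ * (√γ * feat φ u x.1 k - w k) ^ 2 := by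
      field_simp; ring
    have h4 : 0 ≤ (2 * √γ)⁻¹ * (√γ * feat φ u x.1 k - w k) ^ 2 := by positivity
    linarith
  have h5 : (2 * √γ)⁻¹ * ∑ k, w k ^ 2 ≤ (2 * √γ)⁻¹ * (γ * featSq φ u x.2.2.2) := by
    gcongr
  have h6 : (2 * √γ)⁻¹ * (γ * featSq φ u x.2.2.2) = √γ / 2 * featSq φ u x.2.2.2 := by
    nth_rewrite 2 [← hss]; field_simp
  linarith

lemma abs_tdShift_le (hγ : γ ≤ 1) (hK : 1 ≤ K * (1 - γ)) {r : ℝ} (hr : r ∈ Set.Icc (0 : ℝ) 1)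
    {k : ℕ} (hk : k < K) : |tdShift γ K r k| ≤ 2 * (1 - γ) := by
  rw [tdShift, abs_mul, abs_of_pos (by positivity), inv_mul_le_iff₀ (by positivity)]
  refine (abs_sum_ramp_sub_le hγ hK hr.1 hr.2 k hk).trans ?_
  nlinarith

/-- Each of the `K` coordinates of the right-hand side is of the order `1 - γ`. -/
lemma norm_tdVec_le (hg : 0 < gap γ K) (hγ : 0 ≤ γ) (hγ1 : γ ≤ 1) (hK : 1 ≤ K * (1 - γ))
    (hφ1 : ∀ s, ‖φ s‖ ≤ 1) (x : S × A × ℝ × S) :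
    ‖tdVec γ K φ x‖ ≤ 2 * (√K * (1 - γ)) := by
  have h0 : 0 ≤ 1 - γ := by linarith
  refine le_of_sq_le_sq ?_ (by positivity)
  refine (norm_sq_of_coord (x := x) (φ := φ)
    (c := fun k => tdShift γ K (clipReward x).2.2.1 k) hφ1 (tdVec_apply hg hγ x)).trans ?_
  calc ∑ k : Fin K, tdShift γ K (clipReward x).2.2.1 k ^ 2
      ≤ ∑ k : Fin K, (2 * (1 - γ)) ^ 2 := by
        refine Finset.sum_le_sum fun k _ => ?_
        rw [← sq_abs]
        exact pow_le_pow_left₀ (abs_nonneg _) (abs_tdShift_le hγ1 hK (clipReward_mem x) k.2) 2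
    _ = _ := by
        simp only [Finset.sum_const, Finset.card_univ, Fintype.card_fin, nsmul_eq_mul]
        rw [mul_pow, mul_pow, mul_pow, Real.sq_sqrt (by positivity)]
        ring

@[fun_prop]
lemma measurable_gridPos (j : ℕ) : Measurable fun r => gridPos γ K r j := by
  unfold gridPos; fun_prop

@[fun_prop]
lemma measurable_transEntry (k j : ℕ) : Measurable fun r => transEntry γ K r k j := by
  unfold transEntry
  exact (continuous_ramp.measurable.comp ((measurable_gridPos j).sub_const _)).sub
    (continuous_ramp.measurable.comp ((measurable_gridPos (j + 1)).sub_const _))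

@[fun_prop]
lemma measurable_tdShift (k : ℕ) : Measurable fun r => tdShift γ K r k := by
  unfold tdShift
  refine ((Finset.measurable_fun_sum _ fun j _ => ?_).sub_const _).const_mul _
  exact continuous_ramp.measurable.comp ((measurable_gridPos j).sub_const _)

lemma measurable_tdOp (hg : 0 < gap γ K) (hγ : 0 ≤ γ) (hφ : Measurable φ) :
    Measurable fun p : (S × A × ℝ × S) × Param d K => tdOp γ K φ p.1 p.2 := by
  have : (fun p : (S × A × ℝ × S) × Param d K => tdOp γ K φ p.1 p.2)
      = fun p => WithLp.toLp 2 fun ki : Fin K × Fin d =>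
        φ p.1.1 ki.2 * tdCoord γ φ p.2 (clipReward p.1) ki.1 := by
    funext p
    ext ki
    exact tdOp_apply hg hγ p.1 p.2 ki
  rw [this]
  refine (WithLp.measurable_toLp 2 _).comp (measurable_pi_lambda _ fun ki => ?_)
  refine ((measurable_feature_apply hφ _).comp (by fun_prop)).mul ?_
  unfold tdCoord
  refine ((measurable_feat_prod hφ ki.1).comp
    (measurable_snd.prodMk (measurable_fst.comp measurable_fst))).sub
    (Finset.measurable_fun_sum _ fun j _ => ?_)
  refine ((measurable_transEntry _ _).comp (measurable_fst.comp (measurable_snd.comp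
    (measurable_snd.comp (measurable_clipReward.comp measurable_fst))))).mul ?_
  exact (measurable_feat_prod hφ j).comp (measurable_snd.prodMk (measurable_snd.comp
    (measurable_snd.comp (measurable_snd.comp measurable_fst))))

lemma measurable_tdVec (hg : 0 < gap γ K) (hγ : 0 ≤ γ) (hφ : Measurable φ) :
    Measurable (tdVec γ K φ : S × A × ℝ × S → Param d K) := by
  have : (tdVec γ K φ : S × A × ℝ × S → Param d K)
      = fun x => WithLp.toLp 2 fun ki : Fin K × Fin d =>
        φ x.1 ki.2 * tdShift γ K (clipReward x).2.2.1 ki.1 := by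
    funext x
    ext ki
    exact tdVec_apply hg hγ x ki
  rw [this]
  refine (WithLp.measurable_toLp 2 _).comp (measurable_pi_lambda _ fun ki => ?_)
  exact ((measurable_feature_apply hφ _).comp measurable_fst).mul ((measurable_tdShift _).comp
    (measurable_fst.comp (measurable_snd.comp (measurable_snd.comp measurable_clipReward))))

variable [IsMarkovKernel π] [IsMarkovKernel P]

instance [IsProbabilityMeasure μ] : IsProbabilityMeasure (sampleLaw π P μ) := by
  unfold sampleLaw; infer_instance

lemma ae_reward_kernel (hr : ∀ sa : S × A, ∀ᵐ z ∂(P sa), z.1 ∈ Set.Icc (0 : ℝ) 1) (s : S) :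
    ∀ᵐ y ∂((π ⊗ₖ P) s), y.2.1 ∈ Set.Icc (0 : ℝ) 1 := by
  refine Kernel.ae_compProd_of_ae_ae ?_ (Filter.Eventually.of_forall fun a => hr (s, a))
  exact (measurable_fst.comp measurable_snd) measurableSet_Icc

lemma ae_reward [IsProbabilityMeasure μ]
    (hr : ∀ sa : S × A, ∀ᵐ z ∂(P sa), z.1 ∈ Set.Icc (0 : ℝ) 1) :
    ∀ᵐ x ∂(sampleLaw π P μ), x.2.2.1 ∈ Set.Icc (0 : ℝ) 1 := by
  refine Measure.ae_compProd_of_ae_ae ?_ (Filter.Eventually.of_forall fun s =>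
    ae_reward_kernel hr s)
  exact (measurable_fst.comp (measurable_snd.comp measurable_snd)) measurableSet_Icc

lemma map_fst_sampleLaw [IsProbabilityMeasure μ] :
    (sampleLaw π P μ).map (fun x => x.1) = μ := by
  exact Measure.fst_compProd μ (π ⊗ₖ P)

/-- By stationarity the next state of a sample has law `μ`. -/
lemma map_next_sampleLaw [IsProbabilityMeasure μ] (hinv : (stateKernel π P).Invariant μ) :
    (sampleLaw π P μ).map (fun x => x.2.2.2) = μ := by
  have h1 : (sampleLaw π P μ).map (fun x => x.2.2.2)
      = ((sampleLaw π P μ).snd).map (fun y => y.2.2) := by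
    rw [Measure.snd, Measure.map_map (by fun_prop) measurable_snd]
    rfl
  rw [h1, sampleLaw, Measure.snd_compProd, Measure.map_comp _ _ (by fun_prop)]
  exact hinv

lemma integral_featSq_fst [IsProbabilityMeasure μ] (hφ : Measurable φ) (hφ1 : ∀ s, ‖φ s‖ ≤ 1)
    (u : Param d K) : Integrable (fun x => featSq φ u x.1) (sampleLaw π P μ) ∧
      ∫ x, featSq φ u x.1 ∂(sampleLaw π P μ) = covSq μ φ u := by
  have hm := (measurable_featSq hφ u).aestronglyMeasurable
    (μ := (sampleLaw π P μ).map (fun x => x.1))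
  have hi : Integrable (featSq φ u) ((sampleLaw π P μ).map (fun x => x.1)) := by
    rw [map_fst_sampleLaw]; exact integrable_featSq hφ hφ1 u
  refine ⟨(integrable_map_measure hm (by fun_prop)).1 hi, ?_⟩
  rw [← integral_map (φ := fun x : S × A × ℝ × S => x.1) (by fun_prop) hm, map_fst_sampleLaw]
  rfl

lemma integral_featSq_next [IsProbabilityMeasure μ] (hinv : (stateKernel π P).Invariant μ)
    (hφ : Measurable φ) (hφ1 : ∀ s, ‖φ s‖ ≤ 1)
    (u : Param d K) : Integrable (fun x => featSq φ u x.2.2.2) (sampleLaw π P μ) ∧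
      ∫ x, featSq φ u x.2.2.2 ∂(sampleLaw π P μ) = covSq μ φ u := by
  have hm := (measurable_featSq hφ u).aestronglyMeasurable
    (μ := (sampleLaw π P μ).map (fun x => x.2.2.2))
  have hi : Integrable (featSq φ u) ((sampleLaw π P μ).map (fun x => x.2.2.2)) := by
    rw [map_next_sampleLaw hinv]; exact integrable_featSq hφ hφ1 u
  refine ⟨(integrable_map_measure hm (by fun_prop)).1 hi, ?_⟩
  rw [← integral_map (φ := fun x : S × A × ℝ × S => x.2.2.2) (by fun_prop) hm,
    map_next_sampleLaw hinv]
  rfl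

lemma measurable_tdOp_apply (hg : 0 < gap γ K) (hγ : 0 ≤ γ) (hφ : Measurable φ) (u : Param d K) :
    Measurable fun x : S × A × ℝ × S => tdOp γ K φ x u := by
  have h : Measurable fun x : S × A × ℝ × S => (x, u) := measurable_prodMk_right
  have h2 := (measurable_tdOp (A := A) (K := K) hg hγ hφ).comp h
  simp only [Function.comp_def] at h2
  exact h2

lemma integral_sq_tdOp_le [IsProbabilityMeasure μ] (hg : 0 < gap γ K) (hγ : 0 ≤ γ)
    (hγ1 : γ ≤ 1) (hinv : (stateKernel π P).Invariant μ)
    (hφ : Measurable φ) (hφ1 : ∀ s, ‖φ s‖ ≤ 1) (u : Param d K) :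
    ∫ x, ‖tdOp γ K φ x u‖ ^ 2 ∂(sampleLaw π P μ) ≤ 4 * covSq μ φ u := by
  obtain ⟨i1, e1⟩ := integral_featSq_fst (π := π) (P := P) (μ := μ) hφ hφ1 u
  obtain ⟨i2, e2⟩ := integral_featSq_next hinv hφ hφ1 u
  calc _ ≤ ∫ x, (2 * featSq φ u x.1 + 2 * featSq φ u x.2.2.2) ∂(sampleLaw π P μ) :=
        integral_mono_of_nonneg (Filter.Eventually.of_forall fun x => by positivity)
          ((i1.const_mul 2).add (i2.const_mul 2))
          (Filter.Eventually.of_forall fun x => norm_sq_tdOp_le hg hγ hγ1 hφ1 x u)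
    _ = _ := by
        rw [integral_add (i1.const_mul 2) (i2.const_mul 2), integral_const_mul,
          integral_const_mul, e1, e2]
        ring

/-- Coercivity of the mean operator: by `‖C G̃(r) C⁻¹‖ ≤ √γ` and stationarity, the cross term costs
at most a factor `√γ`. -/
lemma le_integral_inner_tdOp [IsProbabilityMeasure μ] (hg : 0 < gap γ K) (hγ : 0 < γ)
    (hγ1 : γ ≤ 1) (hinv : (stateKernel π P).Invariant μ)
    (hφ : Measurable φ) (hφ1 : ∀ s, ‖φ s‖ ≤ 1) (u : Param d K) :
    (1 - √γ) * covSq μ φ u ≤ ∫ x, inner ℝ u (tdOp γ K φ x u) ∂(sampleLaw π P μ) := by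
  obtain ⟨i1, e1⟩ := integral_featSq_fst (π := π) (P := P) (μ := μ) hφ hφ1 u
  obtain ⟨i2, e2⟩ := integral_featSq_next hinv hφ hφ1 u
  have i3 : Integrable (fun x => √γ / 2 * (featSq φ u x.1 + featSq φ u x.2.2.2))
      (sampleLaw π P μ) := (i1.add i2).const_mul _
  have i4 : Integrable (fun x => inner ℝ u (tdOp γ K φ x u)) (sampleLaw π P μ) :=
    (integrable_of_norm_le (measurable_tdOp_apply hg hγ.le hφ u) _
      fun x => norm_tdOp_le hg hγ.le hγ1 hφ1 x u).const_inner u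
  refine le_trans (le_of_eq ?_) (integral_mono (i1.sub i3) i4 fun x => le_inner_tdOp hg hγ x u)
  rw [integral_sub' i1 i3, integral_const_mul, integral_add i1 i2, e1, e2]
  ring

lemma integral_sq_noise_td_le [IsProbabilityMeasure μ] (hg : 0 < gap γ K) (hγ : 0 ≤ γ)
    (hγ1 : γ ≤ 1) (hK : 1 ≤ K * (1 - γ)) (hinv : (stateKernel π P).Invariant μ)
    (hφ : Measurable φ) (hφ1 : ∀ s, ‖φ s‖ ≤ 1) (θ : Param d K) :
    ∫ x, ‖tdOp γ K φ x θ - tdVec γ K φ x‖ ^ 2 ∂(sampleLaw π P μ)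
      ≤ (3 * (√(covSq μ φ θ) + √K * (1 - γ))) ^ 2 := by
  have hi : Integrable (fun x => ‖tdOp γ K φ x θ‖ ^ 2) (sampleLaw π P μ) :=
    integrable_of_norm_le ((measurable_tdOp_apply hg hγ hφ θ).norm.pow_const 2)
      ((2 * ‖θ‖) ^ 2) fun x => by
        rw [norm_pow, norm_norm]
        exact pow_le_pow_left₀ (norm_nonneg _) (norm_tdOp_le hg hγ hγ1 hφ1 x θ) 2
  have hA := integral_sq_tdOp_le (π := π) (P := P) hg hγ hγ1 hinv hφ hφ1 θ
  set b := √(K : ℝ) * (1 - γ) with hb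
  have hb0 : 0 ≤ b := mul_nonneg (Real.sqrt_nonneg _) (by linarith)
  calc _ ≤ ∫ x, (2 * ‖tdOp γ K φ x θ‖ ^ 2 + 8 * b ^ 2) ∂(sampleLaw π P μ) := by
        refine integral_mono_of_nonneg (Filter.Eventually.of_forall fun x => by positivity)
          ((hi.const_mul 2).add (integrable_const _)) (Filter.Eventually.of_forall fun x => ?_)
        have h1 := norm_sub_le (tdOp γ K φ x θ) (tdVec γ K φ x)
        have h2 := norm_tdVec_le hg hγ hγ1 hK hφ1 x
        have h4 := pow_le_pow_left₀ (norm_nonneg _) (h1.trans (add_le_add_right h2 _)) 2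
        simp only
        nlinarith [sq_nonneg (‖tdOp γ K φ x θ‖ - 2 * b)]
    _ = 2 * ∫ x, ‖tdOp γ K φ x θ‖ ^ 2 ∂(sampleLaw π P μ) + 8 * b ^ 2 := by
        rw [integral_add (hi.const_mul 2) (integrable_const _), integral_const_mul]
        simp only [integral_const, probReal_univ, one_smul]
    _ ≤ _ := by
        have h0 := Real.sqrt_nonneg (covSq μ φ θ)
        have h1 := Real.sq_sqrt (covSq_nonneg (μ := μ) (φ := φ) θ)
        nlinarith [mul_nonneg h0 hb0]

/-- The pointwise bound of the noise is worse than its second moment by the factor `λ_min ^ (-1/2)`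
of the norm comparison `λ_min ‖θ‖² ≤ covSq θ`. -/
lemma norm_noise_td_le [IsProbabilityMeasure μ] (hg : 0 < gap γ K) (hγ : 0 ≤ γ) (hγ1 : γ ≤ 1)
    (hK : 1 ≤ K * (1 - γ)) (hd : 0 < d) (hφ : Measurable φ) (hφ1 : ∀ s, ‖φ s‖ ≤ 1)
    (hpos : (featureCov μ φ).PosDef) (θ : Param d K) (x : S × A × ℝ × S) :
    ‖tdOp γ K φ x θ - tdVec γ K φ x‖
      ≤ 2 * (√(covSq μ φ θ) + √K * (1 - γ)) / √(lambdaMin μ φ) := by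
  have hl := lambdaMin_pos hd hpos
  have hsl : 0 < √(lambdaMin μ φ) := Real.sqrt_pos.2 hl
  have hsl1 : √(lambdaMin μ φ) ≤ 1 := Real.sqrt_le_one.2 (lambdaMin_le_one hd hφ hφ1 hpos)
  have hθN : ‖θ‖ ≤ √(covSq μ φ θ) / √(lambdaMin μ φ) := by
    rw [le_div_iff₀ hsl]
    refine Real.le_sqrt_of_sq_le ?_
    rw [mul_pow, Real.sq_sqrt hl.le, mul_comm]
    exact lambdaMin_mul_norm_sq_le hφ hφ1 hpos θ
  have h1 := norm_tdOp_le hg hγ hγ1 hφ1 x θ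
  have h2 := norm_tdVec_le hg hγ hγ1 hK hφ1 x
  have hb0 : 0 ≤ √(K : ℝ) * (1 - γ) := mul_nonneg (Real.sqrt_nonneg _) (by linarith)
  have h3 : √(K : ℝ) * (1 - γ) ≤ √K * (1 - γ) / √(lambdaMin μ φ) := by
    rw [le_div_iff₀ hsl]; nlinarith
  rw [mul_div_assoc, add_div]
  linarith [norm_sub_le (tdOp γ K φ x θ) (tdVec γ K φ x)]

/-- Under the sampling law the recursion is a stable linear stochastic approximation. -/
theorem isStableLSA_td [IsProbabilityMeasure μ] (hγ0 : 0 < γ) (hγ1 : γ < 1)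
    (hK : 1 ≤ K * (1 - γ)) (hg : 0 < gap γ K)
    (hinv : (stateKernel π P).Invariant μ) (hd : 0 < d) (hφ : Measurable φ)
    (hφ1 : ∀ s, ‖φ s‖ ≤ 1) (hpos : (featureCov μ φ).PosDef) (θ : Param d K)
    (hθ : ∫ x, (tdOp γ K φ x θ - tdVec γ K φ x) ∂(sampleLaw π P μ) = 0) :
    IsStableLSA (sampleLaw π P μ) (tdOp γ K φ) (fun x => tdOp γ K φ x θ - tdVec γ K φ x)
      (covSq μ φ) (1 - √γ) (lambdaMin μ φ)
      (2 * (√(covSq μ φ θ) + √K * (1 - γ)) / √(lambdaMin μ φ))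
      (3 * (√(covSq μ φ θ) + √K * (1 - γ))) where
  measurable_A := measurable_tdOp hg hγ0.le hφ
  measurable_noise := (measurable_tdOp_apply hg hγ0.le hφ θ).sub (measurable_tdVec hg hγ0.le hφ)
  norm_A_le := fun x u => norm_tdOp_le hg hγ0.le hγ1.le hφ1 x u
  norm_noise_le := norm_noise_td_le hg hγ0.le hγ1.le hK hd hφ hφ1 hpos θ
  integral_noise := hθ
  le_integral_inner := le_integral_inner_tdOp hg hγ0 hγ1.le hinv hφ hφ1
  integral_sq_A_le := integral_sq_tdOp_le hg hγ0.le hγ1.le hinv hφ hφ1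
  integral_sq_noise_le := integral_sq_noise_td_le hg hγ0.le hγ1.le hK hinv hφ hφ1 θ
  le_N := lambdaMin_mul_norm_sq_le hφ hφ1 hpos
  κ_pos := by
    have : √γ < 1 := by rw [← Real.sqrt_one]; exact Real.sqrt_lt_sqrt hγ0.le hγ1
    linarith
  κ_le := by linarith [Real.sqrt_nonneg γ]
  lam_pos := lambdaMin_pos hd hpos
  lam_le := lambdaMin_le_one hd hφ hφ1 hpos
  B_pos := by
    have h1 := Real.sqrt_nonneg (covSq μ φ θ)
    have h2 : 0 < √(lambdaMin μ φ) := Real.sqrt_pos.2 (lambdaMin_pos hd hpos)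
    have hKr : (0 : ℝ) < K := by
      by_contra h
      have : (K : ℝ) = 0 := le_antisymm (not_lt.1 h) (Nat.cast_nonneg K)
      rw [this] at hK
      norm_num at hK
    have h3 : 0 < √(K : ℝ) * (1 - γ) := mul_pos (Real.sqrt_pos.2 hKr) (by linarith)
    positivity

end Samples

/-! ### Distribution functions of categorical families and of their Bellman images -/

section CategoricalCDF

variable {S A : Type*} [MeasurableSpace S] [MeasurableSpace A] {d K : ℕ} {γ : ℝ}
  {φ : S → EuclideanSpace ℝ (Fin d)} {π : Kernel S A} {P : Kernel (S × A) (ℝ × S)}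
  {μ : Measure S}

lemma linCDF_of_lt (θ : Param d K) (s : S) (k : Fin K) :
    linCDF φ θ s k = feat φ θ s k + ((k : ℝ) + 1) / ((K : ℝ) + 1) := by
  simp [linCDF, feat]

lemma linCDF_self (θ : Param d K) (s : S) : linCDF φ θ s K = 1 := by simp [linCDF]

/-- Summation by parts for the masses `p_k`. -/
lemma sum_linPMF_mul (θ : Param d K) (s : S) (m : ℕ → ℝ) (n : ℕ) :
    ∑ k ∈ Finset.range (n + 1), linPMF φ θ s k * m k
      = ∑ k ∈ Finset.range n, linCDF φ θ s k * (m k - m (k + 1)) + linCDF φ θ s n * m n := by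
  induction n with
  | zero => simp [linPMF]
  | succ n ih =>
    rw [Finset.sum_range_succ, ih, Finset.sum_range_succ]
    simp only [linPMF]
    ring

lemma signedMeasure_sum_apply {α ι : Type*} [MeasurableSpace α] (t : Finset ι)
    (ν : ι → SignedMeasure α) (B : Set α) : (∑ k ∈ t, ν k) B = ∑ k ∈ t, ν k B := by
  classical
  induction t using Finset.induction_on with
  | empty => simp
  | insert a t ha ih => rw [Finset.sum_insert ha, Finset.sum_insert ha, _root_.add_apply, ih]

lemma linCat_apply (θ : Param d K) (s : S) {B : Set ℝ} (hB : MeasurableSet B) :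
    linCat γ φ θ s B
      = ∑ k ∈ Finset.range (K + 1), linPMF φ θ s k * B.indicator 1 (atom γ K k) := by
  rw [linCat, signedMeasure_sum_apply]
  refine Finset.sum_congr rfl fun k _ => ?_
  rw [_root_.smul_apply, Measure.toSignedMeasure_apply_measurable hB, smul_eq_mul]
  congr 1
  simp only [Measure.real, Measure.dirac_apply' _ hB]
  by_cases h : atom γ K k ∈ B <;> simp [h]

lemma cdf_linCat_eq_sum (θ : Param d K) (s : S) (x : ℝ) :
    cdf (linCat γ φ θ s) x = ∑ k ∈ Finset.range (K + 1),
      linPMF φ θ s k * (Set.Icc 0 x).indicator 1 (atom γ K k) :=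
  linCat_apply θ s measurableSet_Icc

/-- Between two neighbouring support points the CDF of `η_θ(s)` is constant. -/
lemma cdf_linCat (hg : 0 < gap γ K) (θ : Param d K) (s : S) {k : ℕ} (hk : k < K) {x : ℝ}
    (hx1 : atom γ K k ≤ x) (hx2 : x < atom γ K (k + 1)) :
    cdf (linCat γ φ θ s) x = linCDF φ θ s k := by
  have hm : ∀ i, (Set.Icc 0 x).indicator (1 : ℝ → ℝ) (atom γ K i) = if i ≤ k then 1 else 0 := by
    intro i
    have h0 : 0 ≤ atom γ K i := by unfold atom; positivity
    have hiff : atom γ K i ∈ Set.Icc 0 x ↔ i ≤ k := by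
      constructor
      · intro h
        by_contra hc
        have : atom γ K (k + 1) ≤ atom γ K i := by
          unfold atom
          gcongr
          exact_mod_cast Nat.lt_of_not_le hc
        linarith [h.2]
      · intro h
        refine ⟨h0, le_trans ?_ hx1⟩
        unfold atom
        gcongr
    by_cases h : i ≤ k
    · rw [if_pos h, Set.indicator_of_mem (hiff.2 h)]; rfl
    · rw [if_neg h, Set.indicator_of_notMem (fun h' => h (hiff.1 h'))]
  rw [cdf_linCat_eq_sum]
  simp_rw [hm]
  rw [sum_linPMF_mul, if_neg (by omega), mul_zero, add_zero,
    Finset.sum_eq_single_of_mem k (Finset.mem_range.2 hk)]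
  · simp
  · intro i _ hi
    by_cases h : i ≤ k
    · rw [if_pos h, if_pos (by omega)]; simp
    · rw [if_neg h, if_neg (by omega)]; simp

lemma atom_succ (k : ℕ) : atom γ K (k + 1) = atom γ K k + gap γ K := by
  unfold atom; push_cast; ring

lemma atom_top (hK : 0 < K) : atom γ K K = (1 - γ)⁻¹ := by
  unfold atom gap
  have : (K : ℝ) ≠ 0 := by exact_mod_cast hK.ne'
  rw [mul_inv, ← mul_assoc, mul_inv_cancel₀ this, one_mul]

/-- Integrals over the return range, cell by cell. -/
lemma integral_eq_sum_cells (hK : 0 < K) {f : ℝ → ℝ}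
    (hf : ∀ a b, IntervalIntegrable f volume a b) :
    ∫ x in (0 : ℝ)..(1 - γ)⁻¹, f x
      = ∑ k ∈ Finset.range K, ∫ x in atom γ K k..atom γ K (k + 1), f x := by
  rw [intervalIntegral.sum_integral_adjacent_intervals fun k _ => hf _ _, atom_top hK]
  simp [atom]

lemma integral_cell_congr (hg : 0 < gap γ K) (θ : Param d K) (s : S) {k : ℕ} (hk : k < K)
    (F : ℝ → ℝ → ℝ) :
    ∫ x in atom γ K k..atom γ K (k + 1), F x (cdf (linCat γ φ θ s) x)
      = ∫ x in atom γ K k..atom γ K (k + 1), F x (linCDF φ θ s k) := by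
  refine intervalIntegral.integral_congr_ae ?_
  have hne : ∀ᵐ x : ℝ, x ≠ atom γ K (k + 1) := by
    simp [ae_iff]
  filter_upwards [hne] with x hx hmem
  rw [Set.uIoc_of_le (by rw [atom_succ]; linarith)] at hmem
  rw [cdf_linCat hg θ s hk hmem.1.le (lt_of_le_of_ne hmem.2 hx)]

lemma measurable_linCDF (hφ : Measurable φ) (θ : Param d K) (k : ℕ) :
    Measurable fun s => linCDF φ θ s k := by
  by_cases h : k < K
  · have : (fun s => linCDF φ θ s k)
        = fun s => feat φ θ s ⟨k, h⟩ + ((k : ℝ) + 1) / ((K : ℝ) + 1) := by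
      funext s; exact linCDF_of_lt θ s ⟨k, h⟩
    rw [this]
    exact (measurable_feat hφ θ _).add_const _
  · simp only [linCDF, dif_neg h]; exact measurable_const

lemma measurable_linPMF (hφ : Measurable φ) (θ : Param d K) (k : ℕ) :
    Measurable fun s => linPMF φ θ s k := by
  cases k with
  | zero => exact measurable_linCDF hφ θ 0
  | succ k => exact (measurable_linCDF hφ θ (k + 1)).sub (measurable_linCDF hφ θ k)

lemma abs_linCDF_le (hφ1 : ∀ s, ‖φ s‖ ≤ 1) (θ : Param d K) (s : S) (k : ℕ) :
    |linCDF φ θ s k| ≤ ‖θ‖ + 1 := by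
  by_cases h : k < K
  · have e := linCDF_of_lt (φ := φ) θ s ⟨k, h⟩
    simp only at e
    rw [e]
    refine (abs_add_le _ _).trans (add_le_add (abs_feat_le hφ1 θ s _) ?_)
    rw [abs_of_nonneg (by positivity), div_le_one (by positivity)]
    have : (k : ℝ) < K := by exact_mod_cast h
    linarith
  · simp only [linCDF, dif_neg h, abs_one]
    linarith [norm_nonneg θ]

lemma abs_linPMF_le (hφ1 : ∀ s, ‖φ s‖ ≤ 1) (θ : Param d K) (s : S) (k : ℕ) :
    |linPMF φ θ s k| ≤ 2 * (‖θ‖ + 1) := by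
  cases k with
  | zero =>
    have := abs_linCDF_le hφ1 θ s 0
    simp only [linPMF]
    linarith [abs_nonneg (linCDF φ θ s 0)]
  | succ k =>
    simp only [linPMF]
    refine (abs_sub _ _).trans ?_
    linarith [abs_linCDF_le hφ1 θ s k, abs_linCDF_le hφ1 θ s (k + 1)]

end CategoricalCDF

section Bellman

variable {S A : Type*} [MeasurableSpace S] [MeasurableSpace A] {d K : ℕ} {γ : ℝ}
  {φ : S → EuclideanSpace ℝ (Fin d)} {π : Kernel S A} {P : Kernel (S × A) (ℝ × S)}
  {μ : Measure S}

/-- The CDF at `x` of the pushforward of `η_θ(s')` under `z ↦ r + γ z`. -/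
noncomputable def pushCDF (γ : ℝ) (φ : S → EuclideanSpace ℝ (Fin d)) (θ : Param d K)
    (y : A × ℝ × S) (x : ℝ) : ℝ :=
  ∑ k ∈ Finset.range (K + 1), linPMF φ θ y.2.2 k *
    (Set.Icc 0 x).indicator 1 (y.2.1 + γ * atom γ K k)

lemma abs_sum_linPMF_indicator_le (hφ1 : ∀ s, ‖φ s‖ ≤ 1) (θ : Param d K) (s : S) (B : Set ℝ)
    (z : ℕ → ℝ) :
    |∑ k ∈ Finset.range (K + 1), linPMF φ θ s k * B.indicator 1 (z k)|
      ≤ (K + 1) * (2 * (‖θ‖ + 1)) := by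
  refine (Finset.abs_sum_le_sum_abs _ _).trans ?_
  calc _ ≤ ∑ k ∈ Finset.range (K + 1), 2 * (‖θ‖ + 1) := by
        refine Finset.sum_le_sum fun k _ => ?_
        rw [abs_mul]
        have h1 : |B.indicator (1 : ℝ → ℝ) (z k)| ≤ 1 := by
          by_cases h : z k ∈ B <;> simp [h]
        calc _ ≤ 2 * (‖θ‖ + 1) * 1 := by
              gcongr
              exact abs_linPMF_le hφ1 θ s k
          _ = _ := mul_one _
    _ = _ := by simp

lemma abs_pushCDF_le (hφ1 : ∀ s, ‖φ s‖ ≤ 1) (θ : Param d K) (y : A × ℝ × S) (x : ℝ) :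
    ‖pushCDF γ φ θ y x‖ ≤ (K + 1) * (2 * (‖θ‖ + 1)) :=
  abs_sum_linPMF_indicator_le hφ1 θ _ _ _

lemma measurable_pushCDF (hφ : Measurable φ) (θ : Param d K) :
    Measurable fun p : (A × ℝ × S) × ℝ => pushCDF γ φ θ p.1 p.2 := by
  unfold pushCDF
  refine Finset.measurable_fun_sum _ fun k _ => ?_
  refine ((measurable_linPMF hφ θ k).comp (by fun_prop)).mul ?_
  have hz : Measurable fun p : (A × ℝ × S) × ℝ => p.1.2.1 + γ * atom γ K k := by fun_prop
  exact (measurable_const (a := (1 : ℝ))).indicator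
    ((measurableSet_le measurable_const hz).inter (measurableSet_le hz measurable_snd))

variable [IsMarkovKernel π] [IsMarkovKernel P]

/-- On the families `η_θ` the distributional Bellman operator is given by its defining formula. -/
lemma bellman_linCat_apply (hφ : Measurable φ) (hφ1 : ∀ s, ‖φ s‖ ≤ 1) (θ : Param d K) (s : S)
    {B : Set ℝ} (hB : MeasurableSet B) :
    bellman γ π P (linCat γ φ θ) s B = ∫ y, ∑ k ∈ Finset.range (K + 1),
      linPMF φ θ y.2.2 k * B.indicator 1 (y.2.1 + γ * atom γ K k) ∂((π ⊗ₖ P) s) := by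
  have hmap : ∀ (y : A × ℝ × S) {B : Set ℝ}, MeasurableSet B →
      ((linCat γ φ θ y.2.2).map (fun x => y.2.1 + γ * x)) B
        = ∑ k ∈ Finset.range (K + 1),
          linPMF φ θ y.2.2 k * B.indicator 1 (y.2.1 + γ * atom γ K k) := by
    intro y B hB
    have hm : Measurable fun x : ℝ => y.2.1 + γ * x := by fun_prop
    rw [VectorMeasure.map_apply _ hm hB, linCat_apply θ _ (hm hB)]
    rfl
  have hex : ∃ ν : SignedMeasure ℝ, ∀ B : Set ℝ, MeasurableSet B →
      ν B = ∫ y, ((linCat γ φ θ y.2.2).map (fun x => y.2.1 + γ * x)) B ∂((π ⊗ₖ P) s) := by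
    refine ⟨∑ k ∈ Finset.range (K + 1),
      (((π ⊗ₖ P) s).withDensityᵥ fun y => linPMF φ θ y.2.2 k).map
        (fun y => y.2.1 + γ * atom γ K k), fun B hB => ?_⟩
    simp_rw [hmap _ hB]
    have hmp : ∀ k, Measurable fun y : A × ℝ × S => linPMF φ θ y.2.2 k := fun k =>
      (measurable_linPMF hφ θ k).comp (by fun_prop)
    have hip : ∀ k, Integrable (fun y : A × ℝ × S => linPMF φ θ y.2.2 k) ((π ⊗ₖ P) s) := fun k =>
      integrable_of_norm_le (hmp k) _ fun y => abs_linPMF_le hφ1 θ _ k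
    have hz : ∀ k, Measurable fun y : A × ℝ × S => y.2.1 + γ * atom γ K k := fun k => by
      fun_prop
    have e : ∀ k, (fun y : A × ℝ × S =>
        linPMF φ θ y.2.2 k * B.indicator 1 (y.2.1 + γ * atom γ K k))
        = ((fun y : A × ℝ × S => y.2.1 + γ * atom γ K k) ⁻¹' B).indicator
          (fun y => linPMF φ θ y.2.2 k) := fun k => by
      funext y
      by_cases h : y.2.1 + γ * atom γ K k ∈ B
      · rw [Set.indicator_of_mem h, Set.indicator_of_mem (by exact h)]; simp
      · rw [Set.indicator_of_notMem h, Set.indicator_of_notMem (by exact h)]; simp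
    rw [signedMeasure_sum_apply, integral_finsetSum]
    · refine Finset.sum_congr rfl fun k _ => ?_
      rw [VectorMeasure.map_apply _ (hz k) hB, withDensityᵥ_apply (hip k) (hz k hB), e k,
        integral_indicator (hz k hB)]
    · intro k _
      rw [e k]
      exact (hip k).indicator (hz k hB)
  rw [bellman, dif_pos hex, hex.choose_spec B hB]
  simp_rw [hmap _ hB]

lemma cdf_bellman_linCat (hφ : Measurable φ) (hφ1 : ∀ s, ‖φ s‖ ≤ 1) (θ : Param d K) (s : S)
    (x : ℝ) :
    cdf (bellman γ π P (linCat γ φ θ) s) x = ∫ y, pushCDF γ φ θ y x ∂((π ⊗ₖ P) s) :=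
  bellman_linCat_apply hφ hφ1 θ s measurableSet_Icc

lemma abs_cdf_bellman_le (hφ : Measurable φ) (hφ1 : ∀ s, ‖φ s‖ ≤ 1) (θ : Param d K) (s : S)
    (x : ℝ) :
    |cdf (bellman γ π P (linCat γ φ θ) s) x| ≤ (K + 1) * (2 * (‖θ‖ + 1)) := by
  rw [cdf_bellman_linCat hφ hφ1, ← Real.norm_eq_abs]
  refine (norm_integral_le_of_norm_le_const (Filter.Eventually.of_forall fun y =>
    abs_pushCDF_le hφ1 θ y x)).trans (by simp)

lemma measurable_cdf_bellman (hφ : Measurable φ) (hφ1 : ∀ s, ‖φ s‖ ≤ 1) (θ : Param d K) :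
    Measurable fun p : S × ℝ => cdf (bellman γ π P (linCat γ φ θ) p.1) p.2 := by
  simp_rw [cdf_bellman_linCat hφ hφ1]
  have hf : StronglyMeasurable fun q : (S × ℝ) × (A × ℝ × S) => pushCDF γ φ θ q.2 q.1.2 :=
    ((measurable_pushCDF hφ θ).comp
      (measurable_snd.prodMk (measurable_snd.comp measurable_fst))).stronglyMeasurable
  exact (hf.integral_kernel_prod_right' (κ := Kernel.prodMkRight ℝ (π ⊗ₖ P))).measurable

lemma measurable_cdf_linCat (hφ : Measurable φ) (θ : Param d K) :
    Measurable fun p : S × ℝ => cdf (linCat γ φ θ p.1) p.2 := by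
  simp_rw [cdf_linCat_eq_sum]
  refine Finset.measurable_fun_sum _ fun k _ => ?_
  refine ((measurable_linPMF hφ θ k).comp measurable_fst).mul ?_
  have hz : Measurable fun _ : S × ℝ => atom γ K k := measurable_const
  exact (measurable_const (a := (1 : ℝ))).indicator
    ((measurableSet_le measurable_const hz).inter (measurableSet_le hz measurable_snd))

lemma integral_step_eq {a b : ℝ} (hab : a ≤ b) (z : ℝ) :
    ∫ x in a..b, (if z ≤ x then (1 : ℝ) else 0) = max (min (b - z) (b - a)) 0 := by
  have e : (fun x : ℝ => if z ≤ x then (1 : ℝ) else 0) = (Set.Ici z).indicator 1 := by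
    funext x; simp [Set.indicator_apply]
  rw [e, intervalIntegral.integral_of_le hab, integral_indicator_one measurableSet_Ici]
  rw [measureReal_restrict_apply measurableSet_Ici]
  rcases le_or_gt z a with h | h
  · have : Set.Ici z ∩ Set.Ioc a b = Set.Ioc a b :=
      Set.inter_eq_right.2 fun x hx => h.trans hx.1.le
    rw [this, Real.volume_real_Ioc_of_le hab, min_eq_right (by linarith),
      max_eq_left (by linarith)]
  · have : Set.Ici z ∩ Set.Ioc a b = Set.Icc z b := by
      ext x
      simp only [Set.mem_inter_iff, Set.mem_Ici, Set.mem_Ioc, Set.mem_Icc]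
      exact ⟨fun hx => ⟨hx.1, hx.2.2⟩, fun hx => ⟨hx.1, h.trans_le hx.1, hx.2⟩⟩
    rw [this, Real.volume_real_Icc, min_eq_left (by linarith)]

lemma integral_cell_step (hg : 0 < gap γ K) (r : ℝ) (j k : ℕ) :
    ∫ x in atom γ K k..atom γ K (k + 1), (if r + γ * atom γ K j ≤ x then (1 : ℝ) else 0)
      = gap γ K * ramp (gridPos γ K r j - k) := by
  rw [integral_step_eq (by rw [atom_succ]; linarith), ramp,
    mul_max_of_nonneg _ _ hg.le, mul_min_of_nonneg _ _ hg.le, mul_zero, mul_one, atom_succ]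
  congr 2
  · unfold gridPos atom
    field_simp
    ring
  · ring

/-- The mass below the cell `k` after projecting the pushed-forward `η_θ(s')`. -/
lemma sum_linPMF_ramp (θ : Param d K) (s : S) (r : ℝ) (k : ℕ) :
    ∑ j ∈ Finset.range (K + 1), linPMF φ θ s j * ramp (gridPos γ K r j - k)
      = ∑ j : Fin K, transEntry γ K r k j * feat φ θ s j
        + ((K : ℝ) + 1)⁻¹ * ∑ j ∈ Finset.range (K + 1), ramp (gridPos γ K r j - k) := by
  set m : ℕ → ℝ := fun j => ramp (gridPos γ K r j - k) with hm
  have abel : ∀ n : ℕ, ∑ j ∈ Finset.range (n + 1), m j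
      = ∑ j ∈ Finset.range n, ((j : ℝ) + 1) * (m j - m (j + 1)) + ((n : ℝ) + 1) * m n := by
    intro n
    induction n with
    | zero => simp
    | succ n ih => rw [Finset.sum_range_succ, ih, Finset.sum_range_succ]; push_cast; ring
  rw [sum_linPMF_mul θ s m, abel K, linCDF_self,
    ← Fin.sum_univ_eq_sum_range (fun j => linCDF φ θ s j * (m j - m (j + 1))),
    ← Fin.sum_univ_eq_sum_range (fun j => ((j : ℝ) + 1) * (m j - m (j + 1)))]
  have hK : (K : ℝ) + 1 ≠ 0 := by positivity
  rw [mul_add, ← mul_assoc, inv_mul_cancel₀ hK, one_mul, ← add_assoc, Finset.mul_sum,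
    ← Finset.sum_add_distrib]
  congr 1
  refine Finset.sum_congr rfl fun j _ => ?_
  rw [linCDF_of_lt, transEntry]
  simp only [hm]
  field_simp

/-- Fubini: averaging the CDF of the Bellman image over the cell `k`. -/
lemma integral_cell_cdf_bellman (hg : 0 < gap γ K) (hγ : 0 ≤ γ)
    (hr : ∀ sa : S × A, ∀ᵐ z ∂(P sa), z.1 ∈ Set.Icc (0 : ℝ) 1)
    (hφ : Measurable φ) (hφ1 : ∀ s, ‖φ s‖ ≤ 1) (θ : Param d K) (s : S) (k : ℕ) :
    ∫ x in atom γ K k..atom γ K (k + 1), cdf (bellman γ π P (linCat γ φ θ) s) x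
      = gap γ K * ∫ y, ∑ j ∈ Finset.range (K + 1),
          linPMF φ θ y.2.2 j * ramp (gridPos γ K y.2.1 j - k) ∂((π ⊗ₖ P) s) := by
  have hle : atom γ K k ≤ atom γ K (k + 1) := by rw [atom_succ]; linarith
  simp_rw [cdf_bellman_linCat hφ hφ1]
  rw [intervalIntegral.integral_of_le hle, integral_integral_swap]
  · rw [← integral_const_mul]
    refine integral_congr_ae ?_
    filter_upwards [ae_reward_kernel hr s] with y hy
    have e : ∀ x, pushCDF γ φ θ y x = ∑ j ∈ Finset.range (K + 1),
        linPMF φ θ y.2.2 j * (if y.2.1 + γ * atom γ K j ≤ x then (1 : ℝ) else 0) := by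
      intro x
      refine Finset.sum_congr rfl fun j _ => ?_
      have h0 : 0 ≤ y.2.1 + γ * atom γ K j := by
        have := hy.1
        unfold atom
        positivity
      simp [Set.indicator_apply, h0]
    simp_rw [e]
    rw [← intervalIntegral.integral_of_le hle, intervalIntegral.integral_finsetSum]
    · rw [Finset.mul_sum]
      refine Finset.sum_congr rfl fun j _ => ?_
      rw [intervalIntegral.integral_const_mul, integral_cell_step hg]
      ring
    · intro j _
      refine IntervalIntegrable.const_mul ?_ _
      rw [intervalIntegrable_iff_integrableOn_Ioc_of_le hle]
      refine integrable_of_norm_le (C := 1) ?_ fun x => ?_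
      · exact Measurable.ite measurableSet_Ici measurable_const measurable_const
      · split_ifs <;> simp
  · have hm : Measurable fun q : ℝ × (A × ℝ × S) => pushCDF γ φ θ q.2 q.1 := by
      have := (measurable_pushCDF (A := A) (γ := γ) hφ θ).comp
        ((measurable_snd (α := ℝ) (β := A × ℝ × S)).prodMk measurable_fst)
      simpa only [Function.comp_def] using this
    exact integrable_of_norm_le hm _ fun q => abs_pushCDF_le hφ1 θ q.2 q.1

end Bellman

/-! ### The projected Bellman equation -/

section Projection

variable {S A : Type*} [MeasurableSpace S] [MeasurableSpace A] {d K : ℕ} {γ : ℝ}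
  {φ : S → EuclideanSpace ℝ (Fin d)} {π : Kernel S A} {P : Kernel (S × A) (ℝ × S)}
  {μ : Measure S} [IsMarkovKernel π] [IsMarkovKernel P]

/-- The squared Cramér distance at the state `s` between the Bellman image of `η_θ` and `η_θ'`. -/
noncomputable def bellmanGap (γ : ℝ) (π : Kernel S A) (P : Kernel (S × A) (ℝ × S))
    (φ : S → EuclideanSpace ℝ (Fin d)) (θ θ' : Param d K) (s : S) : ℝ :=
  ∫ x in (0 : ℝ)..(1 - γ)⁻¹,
    (cdf (bellman γ π P (linCat γ φ θ) s) x - cdf (linCat γ φ θ' s) x) ^ 2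

lemma abs_cdf_sub_le (hφ : Measurable φ) (hφ1 : ∀ s, ‖φ s‖ ≤ 1) (θ θ' : Param d K) (s : S)
    (x : ℝ) :
    |cdf (bellman γ π P (linCat γ φ θ) s) x - cdf (linCat γ φ θ' s) x|
      ≤ (K + 1) * (2 * (‖θ‖ + 1)) + (K + 1) * (2 * (‖θ'‖ + 1)) := by
  refine (abs_sub _ _).trans (add_le_add (abs_cdf_bellman_le hφ hφ1 θ s x) ?_)
  rw [cdf_linCat_eq_sum]
  exact abs_sum_linPMF_indicator_le hφ1 θ' s _ _

lemma intervalIntegrable_of_abs_le {f : ℝ → ℝ} (hf : Measurable f) {C : ℝ}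
    (h : ∀ x, |f x| ≤ C) (a b : ℝ) : IntervalIntegrable f volume a b :=
  ⟨integrable_of_norm_le hf C h, integrable_of_norm_le hf C h⟩

lemma measurable_cdf_bellman_right (hφ : Measurable φ) (hφ1 : ∀ s, ‖φ s‖ ≤ 1)
    (θ : Param d K) (s : S) :
    Measurable fun x => cdf (bellman γ π P (linCat γ φ θ) s) x := by
  have h := (measurable_cdf_bellman (γ := γ) (π := π) (P := P) hφ hφ1 θ).comp
    (measurable_prodMk_left (x := s) (β := ℝ))
  simpa only [Function.comp_def] using h

lemma measurable_cdf_linCat_right (hφ : Measurable φ) (θ : Param d K) (s : S) :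
    Measurable fun x => cdf (linCat γ φ θ s) x := by
  have h := (measurable_cdf_linCat (γ := γ) hφ θ).comp
    (measurable_prodMk_left (x := s) (β := ℝ))
  simpa only [Function.comp_def] using h

lemma bellmanGap_eq_sum_cells (hg : 0 < gap γ K) (hK : 0 < K) (hφ : Measurable φ)
    (hφ1 : ∀ s, ‖φ s‖ ≤ 1) (θ θ' : Param d K) (s : S) :
    bellmanGap γ π P φ θ θ' s = ∑ k : Fin K, ∫ x in atom γ K k..atom γ K (k + 1),
      (cdf (bellman γ π P (linCat γ φ θ) s) x - linCDF φ θ' s k) ^ 2 := by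
  rw [bellmanGap, integral_eq_sum_cells hK, ← Fin.sum_univ_eq_sum_range (fun k =>
    ∫ x in atom γ K k..atom γ K (k + 1),
      (cdf (bellman γ π P (linCat γ φ θ) s) x - cdf (linCat γ φ θ' s) x) ^ 2)]
  · refine Finset.sum_congr rfl fun k _ => ?_
    exact integral_cell_congr hg θ' s k.2
      (fun x c => (cdf (bellman γ π P (linCat γ φ θ) s) x - c) ^ 2)
  · refine intervalIntegrable_of_abs_le (((measurable_cdf_bellman_right hφ hφ1 θ s).sub
      (measurable_cdf_linCat_right hφ θ' s)).pow_const 2)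
      (C := ((K + 1) * (2 * (‖θ‖ + 1)) + (K + 1) * (2 * (‖θ'‖ + 1))) ^ 2) fun x => ?_
    rw [abs_pow]
    exact pow_le_pow_left₀ (abs_nonneg _) (abs_cdf_sub_le hφ hφ1 θ θ' s x) 2

lemma abs_sum_linPMF_ramp_le (hφ1 : ∀ s, ‖φ s‖ ≤ 1) (θ : Param d K) (s : S) (r : ℝ) (k : ℕ) :
    |∑ j ∈ Finset.range (K + 1), linPMF φ θ s j * ramp (gridPos γ K r j - k)|
      ≤ (K + 1) * (2 * (‖θ‖ + 1)) := by
  refine (Finset.abs_sum_le_sum_abs _ _).trans ?_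
  calc _ ≤ ∑ k ∈ Finset.range (K + 1), 2 * (‖θ‖ + 1) * 1 := by
        refine Finset.sum_le_sum fun j _ => ?_
        rw [abs_mul, abs_of_nonneg (ramp_nonneg _)]
        exact mul_le_mul (abs_linPMF_le hφ1 θ s j) (ramp_le_one _) (ramp_nonneg _) (by positivity)
    _ = _ := by simp

/-- The first variation of the Cramér distance, at a single state: up to the factor `-ι_K` it is
the conditional mean of the update direction of the algorithm. -/
lemma sum_feat_mul_cell (hg : 0 < gap γ K) (hγ : 0 ≤ γ)
    (hr : ∀ sa : S × A, ∀ᵐ z ∂(P sa), z.1 ∈ Set.Icc (0 : ℝ) 1)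
    (hφ : Measurable φ) (hφ1 : ∀ s, ‖φ s‖ ≤ 1) (θ h : Param d K) (s : S) :
    ∑ k : Fin K, feat φ h s k * ∫ x in atom γ K k..atom γ K (k + 1),
        (cdf (bellman γ π P (linCat γ φ θ) s) x - linCDF φ θ s k)
      = -(gap γ K * ∫ y, inner ℝ h (tdOp γ K φ (s, y) θ - tdVec γ K φ (s, y))
          ∂((π ⊗ₖ P) s)) := by
  have hcell : ∀ k : Fin K, ∫ x in atom γ K k..atom γ K (k + 1),
        (cdf (bellman γ π P (linCat γ φ θ) s) x - linCDF φ θ s k)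
      = gap γ K * ∫ y, (∑ j ∈ Finset.range (K + 1),
          linPMF φ θ y.2.2 j * ramp (gridPos γ K y.2.1 j - k) - linCDF φ θ s k)
            ∂((π ⊗ₖ P) s) := fun k => by
    have hi : Integrable (fun y : A × ℝ × S => ∑ j ∈ Finset.range (K + 1),
        linPMF φ θ y.2.2 j * ramp (gridPos γ K y.2.1 j - k)) ((π ⊗ₖ P) s) := by
      refine integrable_of_norm_le (Finset.measurable_fun_sum _ fun j _ => ?_) _
        fun y => abs_sum_linPMF_ramp_le hφ1 θ _ _ _
      refine ((measurable_linPMF hφ θ j).comp (by fun_prop)).mul ?_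
      exact continuous_ramp.measurable.comp
        (((measurable_gridPos j).comp (by fun_prop)).sub_const _)
    rw [intervalIntegral.integral_sub (intervalIntegrable_of_abs_le
      (measurable_cdf_bellman_right hφ hφ1 θ s) (abs_cdf_bellman_le hφ hφ1 θ s) _ _)
      intervalIntegrable_const, integral_cell_cdf_bellman hg hγ hr hφ hφ1,
      integral_sub hi (integrable_const _)]
    simp [atom_succ]
    ring
  have hinner : ∀ᵐ y ∂((π ⊗ₖ P) s), inner ℝ h (tdOp γ K φ (s, y) θ - tdVec γ K φ (s, y))
      = -∑ k : Fin K, feat φ h s k * (∑ j ∈ Finset.range (K + 1),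
          linPMF φ θ y.2.2 j * ramp (gridPos γ K y.2.1 j - k) - linCDF φ θ s k) := by
    filter_upwards [ae_reward_kernel hr s] with y hy
    have hc : clipReward (s, y) = (s, y) := clipReward_eq hy
    rw [inner_of_coord (x := (s, y)) (φ := φ)
      (c := fun k => tdCoord γ φ θ (s, y) k - tdShift γ K y.2.1 k) (fun ki => by
        rw [PiLp.sub_apply, tdOp_apply hg hγ, tdVec_apply hg hγ, hc]; ring),
      ← Finset.sum_neg_distrib]
    refine Finset.sum_congr rfl fun k _ => ?_
    rw [sum_linPMF_ramp, linCDF_of_lt, tdCoord, tdShift]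
    ring
  have hi : ∀ k : Fin K, Integrable (fun y : A × ℝ × S => feat φ h s k *
      (∑ j ∈ Finset.range (K + 1), linPMF φ θ y.2.2 j * ramp (gridPos γ K y.2.1 j - k)
        - linCDF φ θ s k)) ((π ⊗ₖ P) s) := fun k => by
    refine Integrable.const_mul (Integrable.sub ?_ (integrable_const _)) _
    refine integrable_of_norm_le (Finset.measurable_fun_sum _ fun j _ => ?_) _
      fun y => abs_sum_linPMF_ramp_le hφ1 θ _ _ _
    refine ((measurable_linPMF hφ θ j).comp (by fun_prop)).mul ?_
    exact continuous_ramp.measurable.comp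
      (((measurable_gridPos j).comp (by fun_prop)).sub_const _)
  rw [integral_congr_ae hinner, integral_neg, integral_finsetSum _ fun k _ => hi k, mul_neg,
    neg_neg, Finset.mul_sum]
  refine Finset.sum_congr rfl fun k _ => ?_
  rw [hcell, integral_const_mul]
  ring

/-- The projection objective at a single state is an explicit quadratic function. -/
lemma bellmanGap_add (hg : 0 < gap γ K) (hK : 0 < K) (hγ : 0 ≤ γ)
    (hr : ∀ sa : S × A, ∀ᵐ z ∂(P sa), z.1 ∈ Set.Icc (0 : ℝ) 1)
    (hφ : Measurable φ) (hφ1 : ∀ s, ‖φ s‖ ≤ 1) (θ h : Param d K) (s : S) :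
    bellmanGap γ π P φ θ (θ + h) s = bellmanGap γ π P φ θ θ s
      + 2 * gap γ K * ∫ y, inner ℝ h (tdOp γ K φ (s, y) θ - tdVec γ K φ (s, y)) ∂((π ⊗ₖ P) s)
      + gap γ K * featSq φ h s := by
  have hm := measurable_cdf_bellman_right (γ := γ) (π := π) (P := P) hφ hφ1 θ s
  have hcell : ∀ k : Fin K, ∫ x in atom γ K k..atom γ K (k + 1),
      (cdf (bellman γ π P (linCat γ φ θ) s) x - linCDF φ (θ + h) s k) ^ 2
      = (∫ x in atom γ K k..atom γ K (k + 1),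
          (cdf (bellman γ π P (linCat γ φ θ) s) x - linCDF φ θ s k) ^ 2)
        - 2 * (feat φ h s k * ∫ x in atom γ K k..atom γ K (k + 1),
          (cdf (bellman γ π P (linCat γ φ θ) s) x - linCDF φ θ s k))
        + gap γ K * feat φ h s k ^ 2 := fun k => by
    set Ψ := fun x => cdf (bellman γ π P (linCat γ φ θ) s) x - linCDF φ θ s k with hΨ
    have hb : ∀ x, |Ψ x| ≤ (K + 1) * (2 * (‖θ‖ + 1)) + |linCDF φ θ s k| := fun x =>
      (abs_sub _ _).trans (add_le_add (abs_cdf_bellman_le hφ hφ1 θ s x) le_rfl)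
    have hΨm : Measurable Ψ := hm.sub_const _
    have i1 := intervalIntegrable_of_abs_le (hΨm.pow_const 2)
      (C := ((K + 1) * (2 * (‖θ‖ + 1)) + |linCDF φ θ s k|) ^ 2) (fun x => by
        rw [abs_pow]; exact pow_le_pow_left₀ (abs_nonneg _) (hb x) 2)
      (atom γ K k) (atom γ K (k + 1))
    have i2 := (intervalIntegrable_of_abs_le hΨm hb
      (atom γ K k) (atom γ K (k + 1))).const_mul (2 * feat φ h s k)
    have e : ∀ x, (cdf (bellman γ π P (linCat γ φ θ) s) x - linCDF φ (θ + h) s k) ^ 2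
        = Ψ x ^ 2 - 2 * feat φ h s k * Ψ x + feat φ h s k ^ 2 := fun x => by
      rw [linCDF_of_lt, feat_add]
      simp only [hΨ]
      rw [linCDF_of_lt]
      ring
    simp_rw [e]
    rw [intervalIntegral.integral_add (i1.sub i2) intervalIntegrable_const,
      intervalIntegral.integral_sub i1 i2, intervalIntegral.integral_const_mul,
      intervalIntegral.integral_const, atom_succ, smul_eq_mul]
    ring
  rw [bellmanGap_eq_sum_cells hg hK hφ hφ1, bellmanGap_eq_sum_cells hg hK hφ hφ1]
  simp_rw [hcell]
  rw [Finset.sum_add_distrib, Finset.sum_sub_distrib, ← Finset.mul_sum, ← Finset.mul_sum,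
    sum_feat_mul_cell hg hγ hr hφ hφ1, featSq]
  ring

variable [IsProbabilityMeasure μ]

lemma integrable_bellmanGap (hφ : Measurable φ)
    (hφ1 : ∀ s, ‖φ s‖ ≤ 1) (θ θ' : Param d K) : Integrable (bellmanGap γ π P φ θ θ') μ := by
  set C := (((K : ℝ) + 1) * (2 * (‖θ‖ + 1)) + (K + 1) * (2 * (‖θ'‖ + 1))) ^ 2
  refine integrable_of_norm_le ?_ (C * |(1 - γ)⁻¹ - 0|) fun s => ?_
  · have h : StronglyMeasurable fun p : S × ℝ =>
        (cdf (bellman γ π P (linCat γ φ θ) p.1) p.2 - cdf (linCat γ φ θ' p.1) p.2) ^ 2 :=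
      (((measurable_cdf_bellman hφ hφ1 θ).sub (measurable_cdf_linCat hφ θ')).pow_const
        2).stronglyMeasurable
    unfold bellmanGap
    simp only [intervalIntegral]
    exact (h.integral_prod_right (ν := volume.restrict (Set.Ioc 0 (1 - γ)⁻¹))).measurable.sub
      (h.integral_prod_right (ν := volume.restrict (Set.Ioc (1 - γ)⁻¹ 0))).measurable
  · refine intervalIntegral.norm_integral_le_of_norm_le_const fun x _ => ?_
    rw [norm_pow, Real.norm_eq_abs]
    exact pow_le_pow_left₀ (abs_nonneg _) (abs_cdf_sub_le hφ hφ1 θ θ' s x) 2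

lemma cramerWeighted_bellman (hγ : γ < 1) (θ θ' : Param d K) :
    cramerWeighted γ μ (bellman γ π P (linCat γ φ θ)) (linCat γ φ θ')
      = √(∫ s, bellmanGap γ π P φ θ θ' s ∂μ) := by
  unfold cramerWeighted cramer
  congr 1
  refine integral_congr_ae (Filter.Eventually.of_forall fun s => ?_)
  have : 0 ≤ (1 - γ)⁻¹ := by
    have : 0 < 1 - γ := by linarith
    positivity
  exact Real.sq_sqrt (intervalIntegral.integral_nonneg this fun x _ => sq_nonneg _)

lemma integrable_td_residual (hg : 0 < gap γ K) (hγ : 0 ≤ γ) (hγ1 : γ < 1)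
    (hK : 1 ≤ K * (1 - γ)) (hφ : Measurable φ) (hφ1 : ∀ s, ‖φ s‖ ≤ 1) (θ : Param d K) :
    Integrable (fun x => tdOp γ K φ x θ - tdVec γ K φ x) (sampleLaw π P μ) :=
  (integrable_of_norm_le (measurable_tdOp_apply hg hγ hφ θ) _
    fun x => norm_tdOp_le hg hγ hγ1.le hφ1 x θ).sub
  (integrable_of_norm_le (measurable_tdVec hg hγ hφ) _
    fun x => norm_tdVec_le hg hγ hγ1.le hK hφ1 x)

/-- The projection objective is an explicit quadratic function, whose gradient at `θ` is a multiple
of the mean update direction of the algorithm. -/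
lemma integral_bellmanGap_add (hg : 0 < gap γ K) (hγ : 0 ≤ γ) (hγ1 : γ < 1)
    (hK : 1 ≤ K * (1 - γ)) (hK0 : 0 < K)
    (hr : ∀ sa : S × A, ∀ᵐ z ∂(P sa), z.1 ∈ Set.Icc (0 : ℝ) 1)
    (hφ : Measurable φ) (hφ1 : ∀ s, ‖φ s‖ ≤ 1) (θ h : Param d K) :
    ∫ s, bellmanGap γ π P φ θ (θ + h) s ∂μ = ∫ s, bellmanGap γ π P φ θ θ s ∂μ
      + 2 * gap γ K * inner ℝ h (∫ x, (tdOp γ K φ x θ - tdVec γ K φ x) ∂(sampleLaw π P μ))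
      + gap γ K * covSq μ φ h := by
  have hres := integrable_td_residual (π := π) (P := P) (μ := μ) hg hγ hγ1 hK hφ hφ1 θ
  have hin := hres.const_inner (𝕜 := ℝ) h
  have e1 : ∫ s, ∫ y, inner ℝ h (tdOp γ K φ (s, y) θ - tdVec γ K φ (s, y)) ∂((π ⊗ₖ P) s) ∂μ
      = inner ℝ h (∫ x, (tdOp γ K φ x θ - tdVec γ K φ x) ∂(sampleLaw π P μ)) := by
    rw [← integral_inner hres]
    exact (Measure.integral_compProd hin).symm
  have i1 : Integrable (fun s => ∫ y, inner ℝ h (tdOp γ K φ (s, y) θ - tdVec γ K φ (s, y))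
      ∂((π ⊗ₖ P) s)) μ := hin.integral_compProd
  simp_rw [bellmanGap_add hg hK0 hγ hr hφ hφ1]
  have i2 := i1.const_mul (2 * gap γ K)
  have i3 := integrable_bellmanGap (γ := γ) (π := π) (P := P) (μ := μ) hφ hφ1 θ θ
  have i4 : Integrable (fun s => bellmanGap γ π P φ θ θ s + 2 * gap γ K *
      ∫ y, inner ℝ h (tdOp γ K φ (s, y) θ - tdVec γ K φ (s, y)) ∂((π ⊗ₖ P) s)) μ := i3.add i2
  rw [integral_add i4 ((integrable_featSq hφ hφ1 h).const_mul _), integral_add i3 i2,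
    integral_const_mul, integral_const_mul, e1, covSq]

/-- The projected Bellman equation is the linear system "mean update direction `= 0`". -/
theorem isProjectedBellmanSolution_iff (hg : 0 < gap γ K) (hγ : 0 ≤ γ) (hγ1 : γ < 1)
    (hK : 1 ≤ K * (1 - γ)) (hK0 : 0 < K)
    (hr : ∀ sa : S × A, ∀ᵐ z ∂(P sa), z.1 ∈ Set.Icc (0 : ℝ) 1)
    (hφ : Measurable φ) (hφ1 : ∀ s, ‖φ s‖ ≤ 1) (θ : Param d K) :
    IsProjectedBellmanSolution γ π P μ φ θ ↔
      ∫ x, (tdOp γ K φ x θ - tdVec γ K φ x) ∂(sampleLaw π P μ) = 0 := by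
  unfold IsProjectedBellmanSolution IsLinCatProjection
  simp_rw [cramerWeighted_bellman hγ1]
  set G := ∫ x, (tdOp γ K φ x θ - tdVec γ K φ x) ∂(sampleLaw π P μ) with hG
  have key := integral_bellmanGap_add (π := π) (P := P) (μ := μ) hg hγ hγ1 hK hK0 hr hφ hφ1 θ
  rw [← hG] at key
  constructor
  · intro h
    -- Along `-G` the objective changes by at most `-2 ι ‖G‖² + ι ‖G‖²`, with `ι` the grid gap.
    have h1 := h (θ + -G)
    have hnn : 0 ≤ ∫ s, bellmanGap γ π P φ θ (θ + -G) s ∂μ := by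
      refine integral_nonneg fun s => ?_
      have : 0 ≤ (1 - γ)⁻¹ := by
        have : 0 < 1 - γ := by linarith
        positivity
      exact intervalIntegral.integral_nonneg this fun x _ => sq_nonneg _
    rw [Real.sqrt_le_sqrt_iff hnn, key, inner_neg_left, real_inner_self_eq_norm_sq] at h1
    have h2 := covSq_le (μ := μ) hφ hφ1 (-G)
    rw [norm_neg] at h2
    have h3 : ‖G‖ ^ 2 ≤ 0 := by
      by_contra hc
      have : 0 < gap γ K * ‖G‖ ^ 2 := mul_pos hg (not_le.1 hc)
      nlinarith
    have h4 : ‖G‖ = 0 := by nlinarith [norm_nonneg G]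
    exact norm_eq_zero.1 h4
  · intro h0 θ'
    refine Real.sqrt_le_sqrt ?_
    have := key (θ' - θ)
    rw [add_sub_cancel, h0, inner_zero_right, mul_zero, add_zero] at this
    rw [this]
    have := mul_nonneg hg.le (covSq_nonneg (μ := μ) (φ := φ) (θ' - θ))
    linarith

/-- The mean operator is injective by coercivity, hence bijective in finite dimension. -/
lemma exists_unique_zero_mean (hg : 0 < gap γ K) (hγ0 : 0 < γ) (hγ1 : γ < 1)
    (hK : 1 ≤ K * (1 - γ)) (hinv : (stateKernel π P).Invariant μ) (hd : 0 < d)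
    (hφ : Measurable φ) (hφ1 : ∀ s, ‖φ s‖ ≤ 1) (hpos : (featureCov μ φ).PosDef) :
    ∃! θ : Param d K, ∫ x, (tdOp γ K φ x θ - tdVec γ K φ x) ∂(sampleLaw π P μ) = 0 := by
  have hi : ∀ u : Param d K, Integrable (fun x => tdOp γ K φ x u) (sampleLaw π P μ) := fun u =>
    integrable_of_norm_le (measurable_tdOp_apply hg hγ0.le hφ u) _
      fun x => norm_tdOp_le hg hγ0.le hγ1.le hφ1 x u
  have hb : Integrable (tdVec γ K φ) (sampleLaw π P μ) :=
    integrable_of_norm_le (measurable_tdVec hg hγ0.le hφ) _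
      fun x => norm_tdVec_le hg hγ0.le hγ1.le hK hφ1 x
  let L : Param d K →ₗ[ℝ] Param d K :=
    { toFun := fun u => ∫ x, tdOp γ K φ x u ∂(sampleLaw π P μ)
      map_add' := fun u v => by
        simp only [map_add]; exact integral_add (hi u) (hi v)
      map_smul' := fun c u => by
        simp only [map_smul, RingHom.id_apply]; exact integral_smul c _ }
  have hLinj : Function.Injective L := by
    rw [injective_iff_map_eq_zero]
    intro u hu
    have h1 := le_integral_inner_tdOp (π := π) (P := P) (μ := μ) hg hγ0 hγ1.le hinv hφ hφ1 u
    rw [integral_inner (hi u)] at h1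
    have hu' : ∫ x, tdOp γ K φ x u ∂(sampleLaw π P μ) = 0 := hu
    rw [hu', inner_zero_right] at h1
    have hs : √γ < 1 := by rw [← Real.sqrt_one]; exact Real.sqrt_lt_sqrt hγ0.le hγ1
    have h2 := lambdaMin_mul_norm_sq_le hφ hφ1 hpos u
    have h3 := lambdaMin_pos hd hpos
    have h4 : covSq μ φ u ≤ 0 := by
      by_contra hc
      nlinarith [not_le.1 hc]
    have h5 : ‖u‖ ^ 2 ≤ 0 := by
      by_contra hc
      nlinarith [not_le.1 hc]
    have h6 : ‖u‖ = 0 := by nlinarith [norm_nonneg u]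
    exact norm_eq_zero.1 h6
  have hiff : ∀ θ : Param d K, ∫ x, (tdOp γ K φ x θ - tdVec γ K φ x) ∂(sampleLaw π P μ) = 0 ↔
      L θ = ∫ x, tdVec γ K φ x ∂(sampleLaw π P μ) := fun θ => by
    rw [integral_sub (hi θ) hb, sub_eq_zero]
    rfl
  simp_rw [hiff]
  obtain ⟨θ, hθ⟩ := LinearMap.injective_iff_surjective.1 hLinj
    (∫ x, tdVec γ K φ x ∂(sampleLaw π P μ))
  exact ⟨θ, hθ, fun θ' hθ' => hLinj (hθ'.trans hθ.symm)⟩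

end Projection

/-! ### The Wasserstein loss and the constants -/

section Loss

variable {S A : Type*} [MeasurableSpace S] [MeasurableSpace A] {d K : ℕ} {γ : ℝ}
  {φ : S → EuclideanSpace ℝ (Fin d)} {π : Kernel S A} {P : Kernel (S × A) (ℝ × S)}
  {μ : Measure S} [IsProbabilityMeasure μ]

/-- Both CDFs are constant on the grid cells, which makes the Wasserstein distance a finite sum. -/
lemma W1_linCat (hg : 0 < gap γ K) (hK : 0 < K) (hφ : Measurable φ)
    (hφ1 : ∀ s, ‖φ s‖ ≤ 1) (θ θ' : Param d K) (s : S) :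
    W1 γ (linCat γ φ θ s) (linCat γ φ θ' s)
      = ∑ k : Fin K, gap γ K * |feat φ (θ - θ') s k| := by
  have hb : ∀ (θ : Param d K) x, |cdf (linCat γ φ θ s) x| ≤ (K + 1) * (2 * (‖θ‖ + 1)) := by
    intro θ x
    rw [cdf_linCat_eq_sum]
    exact abs_sum_linPMF_indicator_le hφ1 θ s _ _
  rw [W1, integral_eq_sum_cells hK, ← Fin.sum_univ_eq_sum_range (fun k =>
    ∫ x in atom γ K k..atom γ K (k + 1),
      |cdf (linCat γ φ θ s) x - cdf (linCat γ φ θ' s) x|)]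
  · refine Finset.sum_congr rfl fun k _ => ?_
    rw [integral_cell_congr hg θ s k.2 (fun x c => |c - cdf (linCat γ φ θ' s) x|),
      integral_cell_congr hg θ' s k.2 (fun _ c => |linCDF φ θ s k - c|),
      intervalIntegral.integral_const, atom_succ, linCDF_of_lt, linCDF_of_lt, feat_sub,
      smul_eq_mul]
    congr 2 <;> ring
  · refine intervalIntegrable_of_abs_le (continuous_abs.measurable.comp
      ((measurable_cdf_linCat_right hφ θ s).sub (measurable_cdf_linCat_right hφ θ' s)))
      (C := (K + 1) * (2 * (‖θ‖ + 1)) + (K + 1) * (2 * (‖θ'‖ + 1))) fun x => ?_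
    simp only [abs_abs]
    exact (abs_sub _ _).trans (add_le_add (hb θ x) (hb θ' x))

lemma loss_nonneg (θ θ' : Param d K) : 0 ≤ loss γ μ φ θ θ' := Real.sqrt_nonneg _

/-- Cauchy–Schwarz over the support points compares the Wasserstein loss with `covSq`. -/
lemma loss_le (hg : 0 < gap γ K) (hK : 0 < K) (hγ1 : γ < 1) (hφ : Measurable φ)
    (hφ1 : ∀ s, ‖φ s‖ ≤ 1) (θ θ' : Param d K) :
    loss γ μ φ θ θ' ≤ √(covSq μ φ (θ - θ')) / (√K * (1 - γ)) := by
  have hG : 0 < 1 - γ := by linarith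
  have hK' : (0 : ℝ) < K := by exact_mod_cast hK
  have hpt : ∀ s, W1 γ (linCat γ φ θ s) (linCat γ φ θ' s) ^ 2
      ≤ (K * (1 - γ) ^ 2)⁻¹ * featSq φ (θ - θ') s := fun s => by
    rw [W1_linCat hg hK hφ hφ1, ← Finset.mul_sum, mul_pow]
    have h := sq_sum_le_card_mul_sum_sq (s := (Finset.univ : Finset (Fin K)))
      (f := fun k => |feat φ (θ - θ') s k|)
    simp only [Finset.card_univ, Fintype.card_fin, sq_abs] at h
    calc _ ≤ gap γ K ^ 2 * (K * featSq φ (θ - θ') s) :=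
          mul_le_mul_of_nonneg_left h (sq_nonneg _)
      _ = _ := by unfold gap; field_simp
  have hle : ∫ s, W1 γ (linCat γ φ θ s) (linCat γ φ θ' s) ^ 2 ∂μ
      ≤ (K * (1 - γ) ^ 2)⁻¹ * covSq μ φ (θ - θ') := by
    rw [covSq, ← integral_const_mul]
    exact integral_mono_of_nonneg (Filter.Eventually.of_forall fun s => sq_nonneg _)
      ((integrable_featSq hφ hφ1 _).const_mul _) (Filter.Eventually.of_forall hpt)
  refine (Real.sqrt_le_sqrt hle).trans (le_of_eq ?_)
  rw [Real.sqrt_mul (by positivity), Real.sqrt_inv, Real.sqrt_mul hK'.le, Real.sqrt_sq hG.le,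
    inv_mul_eq_div]

lemma measurable_loss (hg : 0 < gap γ K) (hK : 0 < K) (hφ : Measurable φ)
    (hφ1 : ∀ s, ‖φ s‖ ≤ 1) (θ : Param d K) : Measurable (loss γ μ φ θ) := by
  unfold loss W1Weighted
  simp_rw [W1_linCat hg hK hφ hφ1]
  have h : StronglyMeasurable fun q : Param d K × S =>
      (∑ k : Fin K, gap γ K * |feat φ (θ - q.1) q.2 k|) ^ 2 := by
    refine ((Finset.measurable_fun_sum _ fun k _ => ?_).pow_const 2).stronglyMeasurable
    refine (continuous_abs.measurable.comp ?_).const_mul _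
    exact (measurable_feat_prod hφ k).comp
      ((measurable_const.sub measurable_fst).prodMk measurable_snd)
  exact Real.continuous_sqrt.measurable.comp h.integral_prod_right.measurable

/-- On rewards in `[0, 1]` the error of the algorithm is the centred recursion. -/
lemma iterate_sub_eq_chain {α : ℝ} {θ₀ θ : Param d K} {x : ℕ → S × A × ℝ × S}
    (hx : ∀ t, (x t).2.2.1 ∈ Set.Icc (0 : ℝ) 1) (t : ℕ) :
    iterate γ α φ θ₀ x t = θ + chain α (tdOp γ K φ) (fun y => tdOp γ K φ y θ - tdVec γ K φ y)
      (θ₀ - θ) x t := by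
  induction t with
  | zero => simp [iterate, chain]
  | succ t ih =>
    have e : WithLp.toLp 2 (sampleA γ K φ (x (t + 1)) *ᵥ (iterate γ α φ θ₀ x t).ofLp
        - sampleB γ K φ (x (t + 1)))
        = tdOp γ K φ (x (t + 1)) (iterate γ α φ θ₀ x t) - tdVec γ K φ (x (t + 1)) := by
      rw [tdOp, tdVec, clipReward_eq (hx (t + 1)), Matrix.toLpLin_apply, WithLp.toLp_sub]
    rw [iterate, e, chain, ih, map_add, ← add_sub_assoc]
    congr 2
    abel

/-- For even `T` the tail average is the average over the `T / 2 + 1` times from `T / 2` on. -/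
lemma tailAverage_eq {α : ℝ} {θ₀ θ : Param d K} {x : ℕ → S × A × ℝ × S}
    (hx : ∀ t, (x t).2.2.1 ∈ Set.Icc (0 : ℝ) 1) (m : ℕ) :
    tailAverage γ α φ θ₀ x (m + m) = θ + ((m + 1 : ℕ) : ℝ)⁻¹ • ∑ i ∈ Finset.range (m + 1),
      chain α (tdOp γ K φ) (fun y => tdOp γ K φ y θ - tdVec γ K φ y) (θ₀ - θ) x (m + i) := by
  have h1 : (m + m) / 2 = m := by omega
  have h2 : (((m + m : ℕ) : ℝ) / 2 + 1) = ((m + 1 : ℕ) : ℝ) := by push_cast; ring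
  have h3 : Finset.Icc m (m + m) = Finset.Ico m (m + m + 1) := by
    ext i; simp only [Finset.mem_Icc, Finset.mem_Ico]; omega
  have h4 : ((m + 1 : ℕ) : ℝ) ≠ 0 := by positivity
  rw [tailAverage, h1, h2, h3, Finset.sum_Ico_eq_sum_range, show m + m + 1 - m = m + 1 by omega]
  simp_rw [iterate_sub_eq_chain (θ := θ) hx]
  rw [Finset.sum_add_distrib, smul_add, Finset.sum_const, Finset.card_range,
    ← Nat.cast_smul_eq_nsmul ℝ, smul_smul, inv_mul_cancel₀ h4, one_smul]

/-- Coercivity of the mean operator turns its value at `e` into a bound on `e`. -/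
lemma sqrt_covSq_le [IsMarkovKernel π] [IsMarkovKernel P] (hg : 0 < gap γ K) (hγ0 : 0 < γ)
    (hγ1 : γ < 1) (hinv : (stateKernel π P).Invariant μ) (hd : 0 < d)
    (hφ : Measurable φ) (hφ1 : ∀ s, ‖φ s‖ ≤ 1) (hpos : (featureCov μ φ).PosDef)
    (e : Param d K) :
    √(covSq μ φ e) ≤ ‖∫ x, tdOp γ K φ x e ∂(sampleLaw π P μ)‖
      / ((1 - √γ) * √(lambdaMin μ φ)) := by
  have hi : Integrable (fun x => tdOp γ K φ x e) (sampleLaw π P μ) :=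
    integrable_of_norm_le (measurable_tdOp_apply hg hγ0.le hφ e) _
      fun x => norm_tdOp_le hg hγ0.le hγ1.le hφ1 x e
  have h1 := le_integral_inner_tdOp (π := π) (P := P) (μ := μ) hg hγ0 hγ1.le hinv hφ hφ1 e
  rw [integral_inner hi] at h1
  set z := ∫ x, tdOp γ K φ x e ∂(sampleLaw π P μ)
  have hs : √γ < 1 := by rw [← Real.sqrt_one]; exact Real.sqrt_lt_sqrt hγ0.le hγ1
  have hl := lambdaMin_pos hd hpos
  have h2 := lambdaMin_mul_norm_sq_le hφ hφ1 hpos e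
  have h3 := covSq_nonneg (μ := μ) (φ := φ) e
  have h4 : √(lambdaMin μ φ) * ‖e‖ ≤ √(covSq μ φ e) := by
    refine Real.le_sqrt_of_sq_le ?_
    rwa [mul_pow, Real.sq_sqrt hl.le]
  have h5 := real_inner_le_norm e z
  have hl' : 0 < √(lambdaMin μ φ) := Real.sqrt_pos.2 hl
  rw [le_div_iff₀ (mul_pos (by linarith) hl')]
  rcases (Real.sqrt_nonneg (covSq μ φ e)).eq_or_lt with h0 | h0
  · rw [← h0, zero_mul]; exact norm_nonneg _
  · refine le_of_mul_le_mul_left ?_ h0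
    have h6 : √(covSq μ φ e) * √(covSq μ φ e) = covSq μ φ e := Real.mul_self_sqrt h3
    calc √(covSq μ φ e) * (√(covSq μ φ e) * ((1 - √γ) * √(lambdaMin μ φ)))
        = √(lambdaMin μ φ) * ((1 - √γ) * (√(covSq μ φ e) * √(covSq μ φ e))) := by ring
      _ = √(lambdaMin μ φ) * ((1 - √γ) * covSq μ φ e) := by rw [h6]
      _ ≤ √(lambdaMin μ φ) * (‖e‖ * ‖z‖) :=
          mul_le_mul_of_nonneg_left (h1.trans h5) hl'.le
      _ = (√(lambdaMin μ φ) * ‖e‖) * ‖z‖ := by ring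
      _ ≤ √(covSq μ φ e) * ‖z‖ := mul_le_mul_of_nonneg_right h4 (norm_nonneg _)

end Loss

section Constants

/-- The squared bounds along the trajectory, summed by the geometric series. -/
lemma sum_sq_add_le {r e m : ℝ} (hr0 : 0 ≤ r) (hr1 : r < 1) (n₀ n : ℕ) :
    ∑ i ∈ Finset.range n, (r ^ (n₀ + i) * e + m) ^ 2
      ≤ 2 * ((r ^ n₀ * e) ^ 2 / (1 - r) + n * m ^ 2) := by
  have hgeo : ∑ i ∈ Finset.range n, r ^ i ≤ (1 - r)⁻¹ := by
    rw [← one_div, le_div_iff₀ (by linarith), geom_sum_mul_neg]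
    linarith [pow_nonneg hr0 n]
  calc ∑ i ∈ Finset.range n, (r ^ (n₀ + i) * e + m) ^ 2
      ≤ ∑ i ∈ Finset.range n, (2 * (r ^ n₀ * e) ^ 2 * r ^ i + 2 * m ^ 2) := by
        refine Finset.sum_le_sum fun i _ => ?_
        have h1 : r ^ i * r ^ i ≤ r ^ i :=
          mul_le_of_le_one_left (pow_nonneg hr0 i) (pow_le_one₀ hr0 hr1.le)
        have h2 := mul_le_mul_of_nonneg_left h1 (sq_nonneg (r ^ n₀ * e))
        rw [pow_add]
        nlinarith [sq_nonneg (r ^ n₀ * r ^ i * e - m)]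
    _ = 2 * ((r ^ n₀ * e) ^ 2 * ∑ i ∈ Finset.range n, r ^ i + n * m ^ 2) := by
        rw [Finset.sum_add_distrib, ← Finset.mul_sum, Finset.sum_const, Finset.card_range,
          nsmul_eq_mul]
        ring
    _ ≤ _ := by
        rw [div_eq_mul_inv]
        gcongr

/-- The stationary size of the error, for the noise levels of the algorithm. The letters
`g, l, q, w` stand for the square roots of `1 - γ`, `λ_min`, `p` and `α`. -/
lemma stationary_size_le {g l q w M κ : ℝ} (hg : 0 < g) (hg1 : g ≤ 1) (hl : 0 < l)
    (hq : 0 < q) (hw : 0 < w) (hM : 0 < M) (hκ : g ^ 2 / 2 ≤ κ) (hwq : w * q ≤ 1) :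
    √((2 * (w ^ 2 * q ^ 2) * (2 * M / l)) ^ 2
        + 22 * (w ^ 2 * q ^ 2) * (3 * M) ^ 2 / (κ * l ^ 2))
      ≤ 24 * (M * (w * q) / (g * l)) := by
  have hκ0 : 0 < κ := lt_of_lt_of_le (by positivity) hκ
  set Z := M * (w * q) / (g * l) with hZ
  refine Real.sqrt_le_iff.2 ⟨by positivity, ?_⟩
  have h1 : (2 * (w ^ 2 * q ^ 2) * (2 * M / l)) ^ 2 ≤ 16 * Z ^ 2 := by
    have e : (2 * (w ^ 2 * q ^ 2) * (2 * M / l)) ^ 2 = 16 * Z ^ 2 * (w * q * g) ^ 2 := by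
      rw [hZ]; field_simp; ring
    rw [e]
    have : (w * q * g) ^ 2 ≤ 1 := by
      refine pow_le_one₀ (by positivity) ?_
      nlinarith [mul_pos hw hq]
    nlinarith [sq_nonneg Z]
  have h2 : 22 * (w ^ 2 * q ^ 2) * (3 * M) ^ 2 / (κ * l ^ 2) ≤ 396 * Z ^ 2 := by
    calc _ ≤ 22 * (w ^ 2 * q ^ 2) * (3 * M) ^ 2 / (g ^ 2 / 2 * l ^ 2) := by gcongr
      _ = _ := by rw [hZ]; field_simp; ring
  nlinarith [sq_nonneg Z]

/-- The noise term over a window of length `ν²`. -/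
lemma sqrt_noise_le {l q ν M : ℝ} (hl : 0 < l) (hq : 0 < q) (hν : 0 < ν) (hM : 0 < M) :
    √((2 * q ^ 2 * (2 * M / l)) ^ 2 + ν ^ 2 * (6 * q ^ 2 * (3 * M) ^ 2))
      ≤ 4 * q ^ 2 * M / l + 8 * q * ν * M := by
  refine Real.sqrt_le_iff.2 ⟨by positivity, ?_⟩
  have e : 2 * q ^ 2 * (2 * M / l) = 4 * q ^ 2 * M / l := by ring
  rw [e]
  have h : 0 ≤ 4 * q ^ 2 * M / l * (8 * q * ν * M) := by positivity
  nlinarith [sq_nonneg (q * ν * M)]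

/-- The martingale of the random operators over a window of length `ν²`. -/
lemma sqrt_mult_le {g l q w ν m κ r e : ℝ} (hg : 0 < g) (hl : 0 < l) (hq : 1 ≤ q) (hw : 0 < w)
    (hν : 0 < ν) (hm : 0 ≤ m) (he : 0 ≤ e) (hκ : g ^ 2 / 2 ≤ κ)
    (hr : r = 1 - 1 / 2 * w ^ 2 * κ * l ^ 2) (hr0 : 0 ≤ r) (hq2 : 2 ≤ q ^ 2) (n₀ n : ℕ)
    (hn : (n : ℝ) = ν ^ 2) :
    √(32 * (1 + 2 * q ^ 2) * ∑ i ∈ Finset.range n, (r ^ (n₀ + i) * e + m) ^ 2)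
      ≤ 13 * q * (2 * (r ^ n₀ * e) / (w * g * l) + ν * m) := by
  have hκ0 : 0 < κ := lt_of_lt_of_le (by positivity) hκ
  have hr1 : 1 - r = 1 / 2 * w ^ 2 * κ * l ^ 2 := by rw [hr]; ring
  have hr1' : r < 1 := by
    have : 0 < 1 / 2 * w ^ 2 * κ * l ^ 2 := by positivity
    linarith
  set Y := r ^ n₀ * e with hY
  have hY0 : 0 ≤ Y := by positivity
  have h1 := sum_sq_add_le (e := e) (m := m) hr0 hr1' n₀ n
  rw [← hY, hn, hr1] at h1
  have h2 : Y ^ 2 / (1 / 2 * w ^ 2 * κ * l ^ 2) ≤ (2 * Y / (w * g * l)) ^ 2 := by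
    calc _ ≤ Y ^ 2 / (1 / 2 * w ^ 2 * (g ^ 2 / 2) * l ^ 2) := by gcongr
      _ = _ := by field_simp
  set Z := 2 * Y / (w * g * l) with hZ
  have hZ0 : 0 ≤ Z := by positivity
  refine Real.sqrt_le_iff.2 ⟨by positivity, ?_⟩
  have h3 : ∑ i ∈ Finset.range n, (r ^ (n₀ + i) * e + m) ^ 2 ≤ 2 * (Z + ν * m) ^ 2 := by
    nlinarith [mul_nonneg hZ0 (mul_nonneg hν.le hm)]
  calc _ ≤ 32 * (1 + 2 * q ^ 2) * (2 * (Z + ν * m) ^ 2) := by gcongr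
    _ ≤ 169 * q ^ 2 * (Z + ν * m) ^ 2 := by nlinarith [sq_nonneg (Z + ν * m)]
    _ = _ := by ring

/-- Collecting the error terms. The letters `g, l, q, w, t, ν, k` stand for the square roots of
`1 - γ`, `λ_min`, `p`, `α`, `T`, the window length and `K`. -/
lemma collect_terms {g l q w t ν k a R e F m : ℝ} (hg : 0 < g) (hg1 : g ≤ 1) (hl : 0 < l)
    (hq : 1 ≤ q) (hw : 0 < w) (ht : 0 < t) (hν : 0 < ν) (hk : 0 < k) (ha : 0 ≤ a) (hR : 0 ≤ R)
    (he : 0 ≤ e) (hF : F ≤ 2 / (k * g ^ 4 * l)) (hνt : t ^ 2 ≤ 2 * ν ^ 2)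
    (hm : m ≤ 24 * (k * g ^ 2 * a * (w * q) / (g * l))) (hm0 : 0 ≤ m) :
    F * ((ν ^ 2)⁻¹ * ((w ^ 2)⁻¹ * (2 * (R * e + m))
        + (4 * q ^ 2 * (k * g ^ 2 * a) / l + 8 * q * ν * (k * g ^ 2 * a))
        + 13 * q * (2 * (R * e) / (w * g * l) + ν * m)))
      ≤ 2000 * (q / t * (a / (g ^ 2 * l)) * (1 + (w * q + w ^ 2 * q ^ 2) / (g * l))
        + q ^ 2 / t ^ 2 * (a / (g ^ 3 * l ^ 2)) * (1 + 1 / (w * q))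
        + 1 / t ^ 2 * (R / (w * g ^ 2 * l)) * (1 / w + q ^ 2 / (g * l))
          * (1 / (k * g ^ 2) * e)) := by
  have hq0 : 0 < q := by linarith
  set m' := 24 * (k * g ^ 2 * a * (w * q) / (g * l)) with hm'
  have h1 : (ν ^ 2)⁻¹ ≤ 2 / t ^ 2 := by
    rw [inv_le_comm₀ (by positivity) (by positivity), inv_div]
    linarith
  have h2 : ν⁻¹ ≤ 2 / t := by
    rw [inv_le_comm₀ (by positivity) (by positivity), inv_div]
    nlinarith
  have hsplit : (ν ^ 2)⁻¹ * ((w ^ 2)⁻¹ * (2 * (R * e + m))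
        + (4 * q ^ 2 * (k * g ^ 2 * a) / l + 8 * q * ν * (k * g ^ 2 * a))
        + 13 * q * (2 * (R * e) / (w * g * l) + ν * m))
      = (ν ^ 2)⁻¹ * ((w ^ 2)⁻¹ * (2 * (R * e + m)) + 4 * q ^ 2 * (k * g ^ 2 * a) / l
          + 13 * q * (2 * (R * e) / (w * g * l)))
        + ν⁻¹ * (8 * q * (k * g ^ 2 * a) + 13 * q * m) := by
    field_simp; ring
  -- The monomials of which both sides are nonnegative combinations.
  set X1 := q * a / (t * g ^ 2 * l) with hX1
  set X2 := q * a * (w * q) / (t * g ^ 3 * l ^ 2) with hX2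
  set X3 := q ^ 2 * a / (t ^ 2 * g ^ 3 * l ^ 2) with hX3
  set X4 := q * a / (t ^ 2 * g ^ 3 * l ^ 2 * w) with hX4
  set X5 := R * e / (t ^ 2 * w ^ 2 * g ^ 4 * l * k) with hX5
  set X6 := q * R * e / (t ^ 2 * w * g ^ 5 * l ^ 2 * k) with hX6
  have p1 : 0 ≤ X1 := by positivity
  have p2 : 0 ≤ X2 := by positivity
  have p3 : 0 ≤ X3 := by positivity
  have p4 : 0 ≤ X4 := by positivity
  have p5 : 0 ≤ X5 := by positivity
  have p6 : 0 ≤ X6 := by positivity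
  have hlhs : 2 / (k * g ^ 4 * l) * (2 / t ^ 2 * ((w ^ 2)⁻¹ * (2 * (R * e + m'))
          + 4 * q ^ 2 * (k * g ^ 2 * a) / l + 13 * q * (2 * (R * e) / (w * g * l)))
        + 2 / t * (8 * q * (k * g ^ 2 * a) + 13 * q * m'))
      = 32 * X1 + 1248 * X2 + 16 * (g * X3) + 192 * X4 + 8 * X5 + 104 * X6 := by
    rw [hm', hX1, hX2, hX3, hX4, hX5, hX6]; field_simp; ring
  have hrhs : q / t * (a / (g ^ 2 * l)) * (1 + (w * q + w ^ 2 * q ^ 2) / (g * l))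
        + q ^ 2 / t ^ 2 * (a / (g ^ 3 * l ^ 2)) * (1 + 1 / (w * q))
        + 1 / t ^ 2 * (R / (w * g ^ 2 * l)) * (1 / w + q ^ 2 / (g * l))
          * (1 / (k * g ^ 2) * e)
      = X1 + X2 + w * q * X2 + X3 + X4 + X5 + q * X6 := by
    rw [hX1, hX2, hX3, hX4, hX5, hX6]; field_simp; ring
  rw [hsplit, hrhs]
  have h3 : g * X3 ≤ X3 := mul_le_of_le_one_left p3 hg1
  have h4 : X6 ≤ q * X6 := le_mul_of_one_le_left p6 hq
  have h5 : 0 ≤ w * q * X2 := by positivity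
  calc _ ≤ 2 / (k * g ^ 4 * l) * (2 / t ^ 2 * ((w ^ 2)⁻¹ * (2 * (R * e + m'))
          + 4 * q ^ 2 * (k * g ^ 2 * a) / l + 13 * q * (2 * (R * e) / (w * g * l)))
        + 2 / t * (8 * q * (k * g ^ 2 * a) + 13 * q * m')) := by gcongr
    _ ≤ _ := by rw [hlhs]; linarith

end Constants

/-! ### The convergence rate -/

section Rate

variable {S A : Type*} [MeasurableSpace S] [MeasurableSpace A] {d K : ℕ} {γ : ℝ}
  {φ : S → EuclideanSpace ℝ (Fin d)} {π : Kernel S A} {P : Kernel (S × A) (ℝ × S)}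
  {μ : Measure S} [IsMarkovKernel π] [IsMarkovKernel P] [IsProbabilityMeasure μ]
  {Ω : Type*} [MeasurableSpace Ω] {ρ : Measure Ω} [IsProbabilityMeasure ρ]
  {X : ℕ → Ω → S × A × ℝ × S} {θ θ₀ : Param d K} {α p : ℝ}

/-- The average over the window `m, …, 2 m` of the recursion centred at `θ`, with clipped
rewards. -/
noncomputable def windowError (γ α : ℝ) (φ : S → EuclideanSpace ℝ (Fin d)) (θ θ₀ : Param d K)
    (m : ℕ) (x : ℕ → S × A × ℝ × S) : Param d K :=
  ((m + 1 : ℕ) : ℝ)⁻¹ • ∑ i ∈ Finset.range (m + 1),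
    chain α (tdOp γ K φ) (fun y => tdOp γ K φ y θ - tdVec γ K φ y) (θ₀ - θ) x (m + i)

lemma ae_tailAverage_eq (hr : ∀ sa : S × A, ∀ᵐ z ∂(P sa), z.1 ∈ Set.Icc (0 : ℝ) 1)
    (hX : ∀ t, Measurable (X t)) (hlaw : ∀ t, ρ.map (X t) = sampleLaw π P μ) (m : ℕ) :
    ∀ᵐ ω ∂ρ, tailAverage γ α φ θ₀ (fun t => X t ω) (m + m)
      = θ + windowError γ α φ θ θ₀ m (X · ω) := by
  have h : ∀ t, ∀ᵐ ω ∂ρ, (X t ω).2.2.1 ∈ Set.Icc (0 : ℝ) 1 := fun t => by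
    have := ae_reward (π := π) (P := P) (μ := μ) hr
    rw [← hlaw t] at this
    exact ae_of_ae_map (hX t).aemeasurable this
  filter_upwards [ae_all_iff.2 h] with ω hω
  exact tailAverage_eq hω m

/-- The `L ^ p` bound for the loss in terms of a bound for the mean operator at the window average.
The loss has all moments, because the centred recursion with clipped rewards is bounded at every time. -/
theorem integral_loss_rpow_le {N : Param d K → ℝ} {κ lam B σ C : ℝ}
    (hγ0 : 0 < γ) (hγ1 : γ < 1) (hK0 : 0 < K) (hinv : (stateKernel π P).Invariant μ) (hd : 0 < d)
    (hφ : Measurable φ) (hφ1 : ∀ s, ‖φ s‖ ≤ 1) (hpos : (featureCov μ φ).PosDef)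
    (hr : ∀ sa : S × A, ∀ᵐ z ∂(P sa), z.1 ∈ Set.Icc (0 : ℝ) 1)
    (hX : ∀ t, Measurable (X t)) (hlaw : ∀ t, ρ.map (X t) = sampleLaw π P μ) (hp : 2 < p)
    (hS : IsStableLSA (sampleLaw π P μ) (tdOp γ K φ)
      (fun x => tdOp γ K φ x θ - tdVec γ K φ x) N κ lam B σ) (m : ℕ)
    (hC : lpNorm (fun ω => ∫ y, tdOp γ K φ y (windowError γ α φ θ θ₀ m (X · ω))
      ∂(sampleLaw π P μ)) (ENNReal.ofReal p) ρ ≤ C) :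
    Integrable (fun ω => loss γ μ φ θ
        (tailAverage γ α φ θ₀ (fun t => X t ω) (m + m)) ^ p) ρ ∧
      (∫ ω, loss γ μ φ θ (tailAverage γ α φ θ₀ (fun t => X t ω) (m + m)) ^ p ∂ρ) ^ (1 / p)
        ≤ (√K * (1 - γ) * ((1 - √γ) * √(lambdaMin μ φ)))⁻¹ * C := by
  have hg := gap_pos hγ1 hK0
  have hG : 0 < 1 - γ := by linarith
  have hp0 : 0 < p := by linarith
  have hs : √γ < 1 := by rw [← Real.sqrt_one]; exact Real.sqrt_lt_sqrt hγ0.le hγ1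
  have hl : 0 < √(lambdaMin μ φ) := Real.sqrt_pos.2 (lambdaMin_pos hd hpos)
  have hK' : 0 < √(K : ℝ) := Real.sqrt_pos.2 (by exact_mod_cast hK0)
  have hκ : 0 < 1 - √γ := by linarith
  set F := (√K * (1 - γ) * ((1 - √γ) * √(lambdaMin μ φ)))⁻¹ with hF
  have hF0 : 0 ≤ F := by positivity
  set W : Ω → Param d K := fun ω => windowError γ α φ θ θ₀ m (X · ω) with hW
  set D : Ω → Param d K := fun ω => ∫ y, tdOp γ K φ y (W ω) ∂(sampleLaw π P μ) with hD
  have hWm : Measurable W := by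
    have h : Measurable fun ω => ∑ i ∈ Finset.range (m + 1), chain α (tdOp γ K φ)
        (fun y => tdOp γ K φ y θ - tdVec γ K φ y) (θ₀ - θ) (X · ω) (m + i) :=
      Finset.measurable_fun_sum _ fun i _ =>
        (hS.measurable_chain α (θ₀ - θ) (m + i)).mono (past_le hX _) le_rfl
    exact h.const_smul ((m + 1 : ℕ) : ℝ)⁻¹
  have hWb : ∃ b, ∀ ω, ‖W ω‖ ≤ b := by
    choose b hb using fun i => hS.bounded_chain α (θ₀ - θ) (m + i)
    refine ⟨‖((m + 1 : ℕ) : ℝ)⁻¹‖ * ∑ i ∈ Finset.range (m + 1), b i, fun ω => ?_⟩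
    rw [hW]
    simp only [windowError, norm_smul]
    exact mul_le_mul_of_nonneg_left ((norm_sum_le _ _).trans
      (Finset.sum_le_sum fun i _ => hb i _)) (norm_nonneg _)
  have hDb : ∀ ω, ‖D ω‖ ≤ 2 * ‖W ω‖ := fun ω => by
    refine (norm_integral_le_of_norm_le_const (Filter.Eventually.of_forall fun y =>
      norm_tdOp_le hg hγ0.le hγ1.le hφ1 y (W ω))).trans (by simp)
  have hDm : Measurable D := by
    have h : StronglyMeasurable fun q : Ω × (S × A × ℝ × S) => tdOp γ K φ q.2 (W q.1) :=
      ((measurable_tdOp hg hγ0.le hφ).comp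
        (measurable_snd.prodMk (hWm.comp measurable_fst))).stronglyMeasurable
    exact h.integral_prod_right.measurable
  have hloss : ∀ ω, loss γ μ φ θ (θ + W ω) ≤ F * ‖D ω‖ := fun ω => by
    refine (loss_le hg hK0 hγ1 hφ hφ1 θ (θ + W ω)).trans ?_
    have h1 := sqrt_covSq_le (π := π) (P := P) (μ := μ) hg hγ0 hγ1 hinv hd hφ hφ1 hpos (W ω)
    have h2 : covSq μ φ (θ - (θ + W ω)) = covSq μ φ (W ω) := by
      simp only [covSq, featSq, feat_sub, feat_add]
      congr 1; funext s; refine Finset.sum_congr rfl fun k _ => ?_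
      ring
    rw [h2, div_le_iff₀ (by positivity)]
    refine h1.trans (le_of_eq ?_)
    rw [hF]
    field_simp
    rfl
  have hDp : Integrable (fun ω => (F * ‖D ω‖) ^ p) ρ := by
    obtain ⟨b, hb⟩ := hWb
    exact integrable_continuous_comp (φ := fun u : Param d K => (F * ‖u‖) ^ p) hDm
      ⟨2 * b, fun ω => (hDb ω).trans (by linarith [hb ω])⟩
      ((continuous_const.mul continuous_norm).rpow_const fun _ => Or.inr hp0.le)
  have hLp : Integrable (fun ω => loss γ μ φ θ (θ + W ω) ^ p) ρ := by
    refine hDp.mono' ?_ (Filter.Eventually.of_forall fun ω => ?_)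
    · exact (((measurable_loss hg hK0 hφ hφ1 θ).comp
        (hWm.const_add θ)).pow_const p).aestronglyMeasurable
    · rw [Real.norm_of_nonneg (Real.rpow_nonneg (loss_nonneg _ _) _)]
      exact Real.rpow_le_rpow (loss_nonneg _ _) (hloss ω) hp0.le
  have hae : (fun ω => loss γ μ φ θ (tailAverage γ α φ θ₀ (fun t => X t ω) (m + m)) ^ p)
      =ᵐ[ρ] fun ω => loss γ μ φ θ (θ + W ω) ^ p := by
    filter_upwards [ae_tailAverage_eq (γ := γ) (α := α) (φ := φ) (θ := θ) (θ₀ := θ₀)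
      hr hX hlaw m] with ω hω
    rw [hω]
  refine ⟨(integrable_congr hae).2 hLp, ?_⟩
  rw [integral_congr_ae hae]
  calc (∫ ω, loss γ μ φ θ (θ + W ω) ^ p ∂ρ) ^ (1 / p)
      ≤ (∫ ω, (F * ‖D ω‖) ^ p ∂ρ) ^ (1 / p) := by
        refine Real.rpow_le_rpow (integral_nonneg fun ω =>
          Real.rpow_nonneg (loss_nonneg _ _) _) ?_ (by positivity)
        exact integral_mono hLp hDp fun ω =>
          Real.rpow_le_rpow (loss_nonneg _ _) (hloss ω) hp0.le
    _ = F * lpNorm D (ENNReal.ofReal p) ρ := by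
        simp_rw [Real.mul_rpow hF0 (norm_nonneg _)]
        rw [integral_const_mul, Real.mul_rpow (by positivity)
          (integral_nonneg fun ω => by positivity), one_div, Real.rpow_rpow_inv hF0 hp0.ne',
          lpNorm_eq_integral hp0 hDm.aestronglyMeasurable]
    _ ≤ F * C := mul_le_mul_of_nonneg_left hC hF0

/-- Comparison of the explicit bound with the form of the convergence rate; `κ` is `1 - √γ`. -/
lemma rate_le {γ κ α p lam V e : ℝ} {K m : ℕ} (hγ1 : γ < 1) (hγ0 : 0 ≤ γ) (hK0 : 0 < K)
    (hl : 0 < lam) (hκ1 : (1 - γ) / 2 ≤ κ) (hκle : κ ≤ 1) (hl1 : lam ≤ 1) (hp : 2 < p)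
    (hα : 0 < α) (hαp : α * p ≤ κ / 38) (hV : 0 ≤ V) (he : 0 ≤ e) (hm : 1 ≤ m) :
    (√K * (1 - γ) * (κ * √lam))⁻¹ * (((m + 1 : ℕ) : ℝ)⁻¹ *
        (α⁻¹ * (2 * ((1 - 1 / 2 * α * κ * lam) ^ m * e
            + √((2 * (α * p) * (2 * (V + √K * (1 - γ)) / √lam)) ^ 2
              + 22 * (α * p) * (3 * (V + √K * (1 - γ))) ^ 2 / (κ * lam))))
          + √((2 * p * (2 * (V + √K * (1 - γ)) / √lam)) ^ 2
              + ((m + 1 : ℕ) : ℝ) * (6 * p * (3 * (V + √K * (1 - γ))) ^ 2))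
          + √(32 * (1 + 2 * p) * ∑ i ∈ Finset.range (m + 1),
              ((1 - 1 / 2 * α * κ * lam) ^ (m + i) * e
                + √((2 * (α * p) * (2 * (V + √K * (1 - γ)) / √lam)) ^ 2
                  + 22 * (α * p) * (3 * (V + √K * (1 - γ))) ^ 2 / (κ * lam))) ^ 2)))
      ≤ 2000 * (√p / √((m + m : ℕ) : ℝ)
          * ((1 / (√K * (1 - γ)) * V + 1) / ((1 - γ) * √lam))
          * (1 + (√(α * p) + α * p) / √((1 - γ) * lam))
        + p / ((m + m : ℕ) : ℝ)
          * ((1 / (√K * (1 - γ)) * V + 1) / ((1 - γ) ^ (3 / 2 : ℝ) * lam))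
          * (1 + 1 / √(α * p))
        + 1 / ((m + m : ℕ) : ℝ)
          * ((1 - 1 / 2 * α * κ * lam) ^ (((m + m : ℕ) : ℝ) / 2) / (√α * (1 - γ) * √lam))
          * (1 / √α + p / √((1 - γ) * lam))
          * (1 / (√K * (1 - γ)) * e)) := by
  -- All parameters are written as squares, so that the inequality becomes rational.
  have sq : ∀ {x : ℝ}, 0 < x → ∃ y, 0 < y ∧ x = y ^ 2 := fun hx =>
    ⟨_, Real.sqrt_pos.2 hx, (Real.sq_sqrt hx.le).symm⟩
  obtain ⟨g, hg, hgγ⟩ := sq (sub_pos.2 hγ1)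
  obtain ⟨l, hl0, rfl⟩ := sq hl
  obtain ⟨q, hq, rfl⟩ := sq (show 0 < p by linarith)
  obtain ⟨w, hw, rfl⟩ := sq hα
  obtain ⟨k, hk, hkK⟩ := sq (show 0 < (K : ℝ) by exact_mod_cast hK0)
  obtain ⟨t, ht, htT⟩ := sq (show 0 < ((m + m : ℕ) : ℝ) by exact_mod_cast (by omega : 0 < m + m))
  obtain ⟨ν, hν, hνn⟩ := sq (show 0 < ((m + 1 : ℕ) : ℝ) by positivity)
  have hhalf : ((m + m : ℕ) : ℝ) / 2 = m := by push_cast; ring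
  have e1 : √(w ^ 2 * q ^ 2) = w * q := by rw [← mul_pow, Real.sqrt_sq (by positivity)]
  have e2 : √(g ^ 2 * l ^ 2) = g * l := by rw [← mul_pow, Real.sqrt_sq (by positivity)]
  have e3 : (g ^ 2) ^ (3 / 2 : ℝ) = g ^ 3 := by
    rw [← Real.rpow_natCast g 2, ← Real.rpow_mul hg.le, ← Real.rpow_natCast g 3]
    norm_num
  have hg2 : g ^ 2 ≤ 1 := by linarith
  have hg1 : g ≤ 1 := by nlinarith
  have hκ1' : g ^ 2 / 2 ≤ κ := by rw [← hgγ]; exact hκ1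
  have hκ0 : 0 < κ := lt_of_lt_of_le (by positivity) hκ1'
  have hwq : w * q ≤ 1 := by
    have : (w * q) ^ 2 ≤ 1 := by rw [mul_pow]; linarith
    exact (sq_le_one_iff₀ (by positivity)).1 this
  have hq1 : 1 ≤ q := by nlinarith
  have hα1 : w ^ 2 ≤ 1 := by nlinarith [sq_nonneg w]
  have hr0 : 0 ≤ 1 - 1 / 2 * w ^ 2 * κ * l ^ 2 := by
    have h1 : w ^ 2 * κ ≤ 1 := mul_le_one₀ hα1 hκ0.le hκle
    have h2 : w ^ 2 * κ * l ^ 2 ≤ 1 := mul_le_one₀ h1 (sq_nonneg _) hl1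
    linarith
  have hk' : √(K : ℝ) = k := by rw [hkK, Real.sqrt_sq hk.le]
  rw [hhalf, Real.rpow_natCast, hgγ, e1, e2, e3, hk', htT, hνn, Real.sqrt_sq ht.le,
    Real.sqrt_sq hl0.le, Real.sqrt_sq hq.le, Real.sqrt_sq hw.le]
  set a := 1 / (k * g ^ 2) * V + 1 with ha
  have hM : V + k * g ^ 2 = k * g ^ 2 * a := by rw [ha]; field_simp
  have ha0 : 0 < a := by positivity
  rw [hM]
  have hM0 : 0 < k * g ^ 2 * a := by positivity
  have hs := stationary_size_le hg hg1 hl0 hq hw hM0 hκ1' hwq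
  set s := √((2 * (w ^ 2 * q ^ 2) * (2 * (k * g ^ 2 * a) / l)) ^ 2
        + 22 * (w ^ 2 * q ^ 2) * (3 * (k * g ^ 2 * a)) ^ 2 / (κ * l ^ 2))
  have hs0 : 0 ≤ s := Real.sqrt_nonneg _
  have hF : (k * g ^ 2 * (κ * l))⁻¹ ≤ 2 / (k * g ^ 4 * l) := by
    calc (k * g ^ 2 * (κ * l))⁻¹ ≤ (k * g ^ 2 * (g ^ 2 / 2 * l))⁻¹ := by gcongr
      _ = _ := by field_simp
  have hνt : t ^ 2 ≤ 2 * ν ^ 2 := by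
    rw [← htT, ← hνn]; push_cast; linarith
  refine le_trans ?_ (collect_terms hg hg1 hl0 hq1 hw ht hν hk ha0.le (pow_nonneg hr0 m) he hF
    hνt hs hs0)
  gcongr
  · exact sqrt_noise_le hl0 hq hν hM0
  · exact sqrt_mult_le hg hl0 hq1 hw hν hs0 he hκ1' rfl hr0 hp.le m (m + 1) hνn

end Rate

end LinearCTD

theorem mainTheorem2 :
    ∃ c : ℝ, 0 < c ∧
    ∀ (S A : Type*)
      [TopologicalSpace S] [PolishSpace S] [MeasurableSpace S] [BorelSpace S]
      [TopologicalSpace A] [PolishSpace A] [MeasurableSpace A] [BorelSpace A]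
      (γ : ℝ) (P : Kernel (S × A) (ℝ × S)) (π : Kernel S A)
      [IsMarkovKernel P] [IsMarkovKernel π] (μ : Measure S)
      (d K : ℕ) (φ : S → EuclideanSpace ℝ (Fin d)),
      0 < γ → γ < 1 →
      (∀ sa : S × A, ∀ᵐ z ∂(P sa), z.1 ∈ Set.Icc (0 : ℝ) 1) →
      LinearCTD.IsUniqueStationary π P μ →
      0 < d → Measurable φ → (∀ s, ‖φ s‖ ≤ 1) → (LinearCTD.featureCov μ φ).PosDef →
      (1 - γ)⁻¹ ≤ (K : ℝ) →
      ∃ θstar : LinearCTD.Param d K,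
        LinearCTD.IsProjectedBellmanSolution γ π P μ φ θstar ∧
        (∀ θ : LinearCTD.Param d K,
          LinearCTD.IsProjectedBellmanSolution γ π P μ φ θ → θ = θstar) ∧
        ∀ (Ω : Type*) [MeasurableSpace Ω] (ρ : Measure Ω) [IsProbabilityMeasure ρ]
          (X : ℕ → Ω → S × A × ℝ × S) (θ₀ : LinearCTD.Param d K) (p α : ℝ) (T : ℕ),
          (∀ t, Measurable (X t)) → iIndepFun X ρ →
          (∀ t, ρ.map (X t) = LinearCTD.sampleLaw π P μ) →
          2 < p → 2 ≤ T → Even T →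
          0 < α → α < (1 - Real.sqrt γ) / (38 * (p + Real.log T)) →
          Integrable (fun ω => LinearCTD.loss γ μ φ θstar
            (LinearCTD.tailAverage γ α φ θ₀ (fun t => X t ω) T) ^ p) ρ ∧
          (∫ ω, LinearCTD.loss γ μ φ θstar
            (LinearCTD.tailAverage γ α φ θ₀ (fun t => X t ω) T) ^ p ∂ρ) ^ (1 / p) ≤
          c * (Real.sqrt p / Real.sqrt T
                * ((1 / (Real.sqrt K * (1 - γ)) * LinearCTD.covNorm μ φ θstar + 1)
                    / ((1 - γ) * Real.sqrt (LinearCTD.lambdaMin μ φ)))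
                * (1 + (Real.sqrt (α * p) + α * p)
                    / Real.sqrt ((1 - γ) * LinearCTD.lambdaMin μ φ))
              + p / T
                * ((1 / (Real.sqrt K * (1 - γ)) * LinearCTD.covNorm μ φ θstar + 1)
                    / ((1 - γ) ^ (3 / 2 : ℝ) * LinearCTD.lambdaMin μ φ))
                * (1 + 1 / Real.sqrt (α * p))
              + 1 / T
                * ((1 - 1 / 2 * α * (1 - Real.sqrt γ) * LinearCTD.lambdaMin μ φ)
                      ^ ((T : ℝ) / 2)
                    / (Real.sqrt α * (1 - γ) * Real.sqrt (LinearCTD.lambdaMin μ φ)))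
                * (1 / Real.sqrt α + p / Real.sqrt ((1 - γ) * LinearCTD.lambdaMin μ φ))
                * (1 / (Real.sqrt K * (1 - γ)) * ‖θ₀ - θstar‖)) := by
  refine ⟨2000, by norm_num, ?_⟩
  intro S A _ _ _ _ _ _ _ _ γ P π _ _ μ d K φ hγ0 hγ1 hr hμ hd hφ hφ1 hpos hKγ
  have := hμ.isProbabilityMeasure
  have hinv := hμ.invariant
  have hG : 0 < 1 - γ := by linarith
  have hK : 1 ≤ K * (1 - γ) := by rwa [inv_le_iff_one_le_mul₀ hG] at hKγ
  have hK0 : 0 < K := by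
    rcases K.eq_zero_or_pos with h | h
    · subst h; norm_num at hK
    · exact h
  have hgap := LinearCTD.gap_pos hγ1 hK0
  obtain ⟨θ, hθ, hθu⟩ 
    := LinearCTD.exists_unique_zero_mean (π := π) (P := P) hgap hγ0 hγ1 hK hinv hd
    hφ hφ1 hpos
  have hiff := LinearCTD.isProjectedBellmanSolution_iff (π := π) (P := P) (μ := μ) hgap
    hγ0.le hγ1 hK hK0 hr hφ hφ1
  refine ⟨θ, (hiff θ).2 hθ, fun θ' h' => hθu θ' ((hiff θ').1 h'), ?_⟩
  intro Ω _ ρ _ X θ₀ p α T hX hind hlaw hp hT heven hα hαlt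
  obtain ⟨m, rfl⟩ := heven
  have hm1 : 1 ≤ m := by omega
  have hS := LinearCTD.isStableLSA_td (π := π) (P := P) hγ0 hγ1 hK hgap hinv hd hφ hφ1 hpos θ hθ
  have hl := LinearCTD.lambdaMin_pos hd hpos
  have hl1 := LinearCTD.lambdaMin_le_one hd hφ hφ1 hpos
  have hκ1 : (1 - γ) / 2 ≤ 1 - √γ := by
    nlinarith [Real.sq_sqrt hγ0.le, sq_nonneg (√γ - 1)]
  have hκ0 : 0 < 1 - √γ := by linarith
  have hκle : 1 - √γ ≤ 1 := by linarith [Real.sqrt_nonneg γ]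
  have hp0 : 0 < p := by linarith
  have hT1 : (1 : ℝ) ≤ ((m + m : ℕ) : ℝ) := by exact_mod_cast (by omega : 1 ≤ m + m)
  have hαp : α * p ≤ (1 - √γ) / 38 := by
    have hlog : 0 ≤ Real.log ((m + m : ℕ) : ℝ) := Real.log_nonneg hT1
    rw [lt_div_iff₀ (by positivity)] at hαlt
    nlinarith [mul_nonneg hα.le hlog]
  -- The tail window `m, …, 2 m` starts at `m = T / 2` and has length `m + 1`.
  have hC := hS.lpNorm_mean_window_le hX hind hlaw hα hp hαp (θ₀ - θ) m (m + 1) rfl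
  obtain ⟨hint, hbd⟩ := LinearCTD.integral_loss_rpow_le (θ := θ) (θ₀ := θ₀) (α := α)
    hγ0 hγ1 hK0 hinv hd hφ hφ1 hpos hr hX hlaw hp hS m hC
  refine ⟨hint, hbd.trans ?_⟩
  rw [LinearCTD.covNorm_eq hφ hφ1]
  exact LinearCTD.rate_le hγ1 hγ0.le hK0 hl hκ1 hκle hl1 hp hα hαp (Real.sqrt_nonneg _)
    (norm_nonneg _) hm1
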